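/- Let $M$ be a $4$-dimensional smooth semi-Riemannian manifold of index $q\in\{1,2\}$ with constant sectional curvature $G$, let $\langle\cdot,\cdot\rangle$ be its metric and $\nabla$ its Levi-Civita connection. Fix $a>0$. For a null curve $\gamma$ with parameter $s$ put $\eta=a^{-1/2}\,|\langle\nabla_{\gamma'}\gamma',\nabla_{\gamma'}\gamma'\rangle|^{1/4}$; $\gamma$ is parametrized by pseudo arc-length if $\eta\equiv1$, and $\Lambda$ denotes the space of smooth null curves in $M$ parametrized by pseudo arc-length. Let $I$ be a nonempty open interval and let $\gamma:I\to M$, with parameter $\sigma$, be a curve in $\Lambda$ with a smooth Cartan frame $T=\gamma',W_1,N,W_2$ and smooth curvatures $k_1,k_2$: $$\langle T,T\rangle=\langle N,N\rangle=\langle W_i,T\rangle=\langle W_i,N\rangle=\langle W_1,W_2\rangle=0,\quad \langle T,N\rangle=-1,\quad \langle W_i,W_i\rangle=\varepsilon_i\in\{1,-1\},$$ $$\nabla_TT=aW_1,\quad \nabla_TW_1=-k_1T+a\varepsilon_1N,\quad \nabla_TN=-\varepsilon_1k_1W_1+\varepsilon_2k_2W_2,\quad \nabla_TW_2=k_2T.$$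 A variation of $\gamma$ with variation field $V$ is a smooth map $\Gamma(s,t)$ into $M$, defined on an open neighbourhood of $I\times\{0\}$ in $\mathbb R^2$, with $\Gamma(s,0)=\gamma(s)$ and $\partial_t\Gamma(s,0)=V(s)$ for $s\in I$. A smooth vector field $V$ along $\gamma$ is tangent to $\Lambda$, $V\in T_\gamma\Lambda$, if it is the variation field of a variation all of whose curves $\Gamma(\cdot,t)$ are null and parametrized by pseudo arc-length. It locally preserves the causal character if $\langle\nabla_TV,T\rangle=0$, and it locally preserves the pseudo arc-length parameter if it is the variation field of a variation through null curves with $\partial_t\eta|_{t=0}=0$ on $I$. Write $f_V=-\langle V,N\rangle$, $h_V=\varepsilon_1\langle V,W_1\rangle$, $g_V=-\langle V,T\rangle$, $l_V=\varepsilon_2\langle V,W_2\rangle$, $\varphi_V=\varepsilon_1\langle\nabla_TV,W_1\rangle$, $\psi_V=\varepsilon_2\langle\nabla_TV,W_2\rangle$. These $f_V,h_V,g_V,l_V$ are smooth and $V=f_VT+h_VW_1+g_VN+l_VW_2$. Let $V$ be a smooth vector field along $\gamma$. Then: 1. $V\in T_\gamma\Lambda$ if and only if $V$ locally preserves the causal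 character and the pseudo arc-length parameter, and also if and only if $\langle\nabla_TV,T\rangle=\langle\nabla_T^2V,W_1\rangle=0$ on $I$. 2. $V\in T_\gamma\Lambda$ if and only if $$f_V=-\frac1{2a}\left[h_V'+ak_1D_\sigma^{-1}(h_V)-aD_\sigma^{-1}(k_1h_V-k_2l_V)\right],\qquad g_V=-\varepsilon_1a\,D_\sigma^{-1}(h_V)$$ for some choice of the indefinite integrals (antiderivatives) $D_\sigma^{-1}(h_V)$ (the same one in both formulas) and $D_\sigma^{-1}(k_1h_V-k_2l_V)$ on $I$. 3. If $V\in T_\gamma\Lambda$, then $$\begin{pmatrix}\varphi_V\\ \psi_V\end{pmatrix}=\begin{pmatrix}\frac a2\left(\frac1aD_\sigma+k_1D_\sigma^{-1}+D_\sigma^{-1}k_1\right)&-\frac a2D_\sigma^{-1}k_2\\-\varepsilon_1\varepsilon_2ak_2D_\sigma^{-1}&D_\sigma\end{pmatrix}\begin{pmatrix}h_V\\ l_V\end{pmatrix},$$ for every choice of antiderivatives $D_\sigma^{-1}(h_V)$, $D_\sigma^{-1}(k_1h_V)$, $D_\sigma^{-1}(k_2l_V)$ for which the formulas of part 2 hold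 with $D_\sigma^{-1}(k_1h_V-k_2l_V)=D_\sigma^{-1}(k_1h_V)-D_\sigma^{-1}(k_2l_V)$; and such a choice exists. -/

import Mathlib

open scoped Manifold ContDiff Matrix

noncomputable section

namespace NullCurve

/-- The model space `ℝ⁴` of a `4`-dimensional manifold. -/
abbrev E4 : Type := EuclideanSpace ℝ (Fin 4)

/-- The tangent space of a `4`-manifold `M` at `x`. -/
abbrev Tan (M : Type*) [TopologicalSpace M] [ChartedSpace E4 M] (x : M) : Type :=
  TangentSpace 𝓘(ℝ, E4) x

/-- A smooth semi-Riemannian metric of index `q` on a `4`-manifold `M`: a smooth symmetric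
`(0,2)`-tensor field which in a suitable basis of each tangent space is
`diag(-1, …, -1, 1, …, 1)` with `q` minus signs (in particular it is nondegenerate). -/
structure SemiRiemannianMetric (M : Type*) [TopologicalSpace M] [ChartedSpace E4 M]
    [IsManifold 𝓘(ℝ, E4) ∞ M] (q : ℕ) where
  inner : ∀ x : M, Tan M x →L[ℝ] Tan M x →L[ℝ] ℝ
  symm : ∀ (x : M) (v w : Tan M x), inner x v w = inner x w v
  index : ∀ x : M, ∃ b : Module.Basis (Fin 4) ℝ (Tan M x), ∀ i j : Fin 4,
    inner x (b i) (b j) = if i = j then (if (i : ℕ) < q then -1 else 1) else 0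
  contMDiff : ContMDiff 𝓘(ℝ, E4) (𝓘(ℝ, E4).prod 𝓘(ℝ, E4 →L[ℝ] E4 →L[ℝ] ℝ)) ∞
    (fun x ↦ Bundle.TotalSpace.mk' (F := E4 →L[ℝ] E4 →L[ℝ] ℝ)
      (E := fun x : M ↦ Tan M x →L[ℝ] Tan M x →L[ℝ] ℝ) x (inner x))

variable {M : Type*} [TopologicalSpace M] [ChartedSpace E4 M]

/-! ### Coordinates -/

/-- The differential at `x` of the chart of `M` around `x₀`. -/
def toCoord (x₀ x : M) : Tan M x →L[ℝ] E4 :=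
  mfderiv 𝓘(ℝ, E4) 𝓘(ℝ, E4) (extChartAt 𝓘(ℝ, E4) x₀) x

/-- The differential at `y ∈ ℝ⁴` of the inverse of the chart of `M` around `x₀`. -/
def ofCoord (x₀ : M) (y : E4) : E4 →L[ℝ] Tan M ((extChartAt 𝓘(ℝ, E4) x₀).symm y) :=
  mfderiv 𝓘(ℝ, E4) 𝓘(ℝ, E4) (extChartAt 𝓘(ℝ, E4) x₀).symm y

/-- The `i`-th standard basis vector of `ℝ⁴`. -/
def stdVec (i : Fin 4) : E4 := EuclideanSpace.single i 1

/-- A coordinate vector at the centre `x` of the chart around `x`, as a tangent vector at `x`: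
the inverse of the differential of the chart. -/
def ofCoordAt (x : M) : E4 →L[ℝ] Tan M x :=
  (toCoord x x).inverse

namespace SemiRiemannianMetric

variable [IsManifold 𝓘(ℝ, E4) ∞ M] {q : ℕ} (g : SemiRiemannianMetric M q)

/-- The matrix `(g_{ij})` of the metric in the chart around `x₀`, at the point with
coordinates `y`. -/
def gram (x₀ : M) (y : E4) : Matrix (Fin 4) (Fin 4) ℝ :=
  Matrix.of fun i j ↦ g.inner ((extChartAt 𝓘(ℝ, E4) x₀).symm y)
    (ofCoord x₀ y (stdVec i)) (ofCoord x₀ y (stdVec j))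

/-- The partial derivative `∂_k g_{ij}` in the chart around `x₀`. -/
def dGram (x₀ : M) (y : E4) (k i j : Fin 4) : ℝ :=
  fderiv ℝ (fun z ↦ g.gram x₀ z i j) y (stdVec k)

/-- The Christoffel symbol
`Γᵏ_{ij} = ½ ∑ₗ gᵏˡ (∂ᵢ g_{jl} + ∂ⱼ g_{il} - ∂ₗ g_{ij})` of the Levi-Civita connection in the
chart around `x₀`. -/
def christoffel (x₀ : M) (y : E4) (k i j : Fin 4) : ℝ :=
  (1 / 2) * ∑ l, (g.gram x₀ y)⁻¹ k l *
    (g.dGram x₀ y i j l + g.dGram x₀ y j i l - g.dGram x₀ y l i j)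

/-- The vector with components `∑_{ij} Γᵏ_{ij} uⁱ vʲ`. -/
def christoffelVec (x₀ : M) (y u v : E4) : E4 :=
  WithLp.toLp 2 fun k ↦ ∑ i, ∑ j, g.christoffel x₀ y k i j * u i * v j

/-- The curvature tensor `R(u,v)w = -∇_u∇_v w + ∇_v∇_u w + ∇_{[u,v]} w` in the chart around
`x₀`, for coordinate vectors (extended as constant vector fields). -/
def curvatureCoord (x₀ : M) (y u v w : E4) : E4 :=
  -(fderiv ℝ (fun z ↦ g.christoffelVec x₀ z v w) y u
      + g.christoffelVec x₀ y u (g.christoffelVec x₀ y v w))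
    + (fderiv ℝ (fun z ↦ g.christoffelVec x₀ z u w) y v
      + g.christoffelVec x₀ y v (g.christoffelVec x₀ y u w))

/-- The curvature tensor `R(u,v)w = -∇_u∇_v w + ∇_v∇_u w + ∇_{[u,v]} w` at `x`. -/
def curvature (x : M) (u v w : Tan M x) : Tan M x :=
  ofCoordAt x (g.curvatureCoord x (extChartAt 𝓘(ℝ, E4) x x)
    (toCoord x x u) (toCoord x x v) (toCoord x x w))

/-- The sectional curvature `K(u,v)` of the plane spanned by `u` and `v`. -/
def sectionalCurvature (x : M) (u v : Tan M x) : ℝ :=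
  g.inner x (g.curvature x u v u) v /
    (g.inner x u u * g.inner x v v - g.inner x u v ^ 2)

/-- `M` is a space form of curvature `G`: every nondegenerate tangent plane has sectional
curvature `G`. -/
def IsSpaceForm (G : ℝ) : Prop :=
  ∀ (x : M) (u v : Tan M x), g.inner x u u * g.inner x v v - g.inner x u v ^ 2 ≠ 0 →
    g.sectionalCurvature x u v = G

end SemiRiemannianMetric

/-! ### Curves and vector fields along curves -/

/-- The velocity `γ'` of a curve. -/
def velocity (γ : ℝ → M) (s : ℝ) : Tan M (γ s) :=
  mfderiv 𝓘(ℝ, ℝ) 𝓘(ℝ, E4) γ s (1 : ℝ)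

/-- `X` is a smooth vector field along `γ`, on the open set `J`. -/
def IsSmoothField [IsManifold 𝓘(ℝ, E4) ∞ M] (J : Set ℝ) (γ : ℝ → M)
    (X : ∀ s, Tan M (γ s)) : Prop :=
  ContMDiffOn 𝓘(ℝ, ℝ) 𝓘(ℝ, E4).tangent ∞
    (fun s ↦ (⟨γ s, X s⟩ : TangentBundle 𝓘(ℝ, E4) M)) J

namespace SemiRiemannianMetric

variable [IsManifold 𝓘(ℝ, E4) ∞ M] {q : ℕ} (g : SemiRiemannianMetric M q)

/-- The Levi-Civita covariant derivative `∇_{γ'} X` of a vector field `X` along `γ`, at the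
parameter `s`: in the chart around `γ s`, where `γ` has coordinates `c` and `X` has components
`ξ`, it is the vector `ξ' + Γ(c', ξ)`. -/
def covDeriv (γ : ℝ → M) (X : ∀ s, Tan M (γ s)) (s : ℝ) : Tan M (γ s) :=
  ofCoordAt (γ s)
    (deriv (fun τ ↦ toCoord (γ s) (γ τ) (X τ)) s +
      g.christoffelVec (γ s) (extChartAt 𝓘(ℝ, E4) (γ s) (γ s))
        (deriv (fun τ ↦ extChartAt 𝓘(ℝ, E4) (γ s) (γ τ)) s)
        (toCoord (γ s) (γ s) (X s)))

/-- The curve `γ` is null on `J`. -/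
def IsNullOn (J : Set ℝ) (γ : ℝ → M) : Prop :=
  ∀ s ∈ J, g.inner (γ s) (velocity γ s) (velocity γ s) = 0

/-- `⟨∇_{γ'} γ', ∇_{γ'} γ'⟩`. -/
def accelSq (γ : ℝ → M) (s : ℝ) : ℝ :=
  g.inner (γ s) (g.covDeriv γ (velocity γ) s) (g.covDeriv γ (velocity γ) s)

/-- The derivative `dσ/ds = a^{-1/2} |⟨∇_{γ'} γ', ∇_{γ'} γ'⟩|^{1/4}` of the pseudo arc-length
parameter (for the constant `a`) of a null curve with an arbitrary parameter `s`. -/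
def pseudoSpeed (a : ℝ) (γ : ℝ → M) (s : ℝ) : ℝ :=
  (1 / Real.sqrt a) * |g.accelSq γ s| ^ (1 / 4 : ℝ)

/-- The space `Λ`: `γ`, restricted to the open set `J`, is a smooth null curve which is
parametrized by the pseudo arc-length parameter for the constant `a`. -/
structure IsPseudoArcNullCurve (a : ℝ) (J : Set ℝ) (γ : ℝ → M) : Prop where
  smooth : ContMDiffOn 𝓘(ℝ, ℝ) 𝓘(ℝ, E4) ∞ γ J
  null : g.IsNullOn J γ
  pseudoArc : ∀ s ∈ J, g.pseudoSpeed a γ s = 1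

/-- A Cartan frame `T = γ', W₁, N, W₂` of the curve `γ : J → M`, with curvatures `k₁`, `k₂`. -/
structure CartanFrame (a ε₁ ε₂ : ℝ) (J : Set ℝ) (γ : ℝ → M) where
  W₁ : ∀ s, Tan M (γ s)
  N : ∀ s, Tan M (γ s)
  W₂ : ∀ s, Tan M (γ s)
  k₁ : ℝ → ℝ
  k₂ : ℝ → ℝ
  smooth_W₁ : IsSmoothField J γ W₁
  smooth_N : IsSmoothField J γ N
  smooth_W₂ : IsSmoothField J γ W₂
  smooth_k₁ : ContDiffOn ℝ ∞ k₁ J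
  smooth_k₂ : ContDiffOn ℝ ∞ k₂ J
  T_T : ∀ s ∈ J, g.inner (γ s) (velocity γ s) (velocity γ s) = 0
  N_N : ∀ s ∈ J, g.inner (γ s) (N s) (N s) = 0
  T_N : ∀ s ∈ J, g.inner (γ s) (velocity γ s) (N s) = -1
  W₁_T : ∀ s ∈ J, g.inner (γ s) (W₁ s) (velocity γ s) = 0
  W₁_N : ∀ s ∈ J, g.inner (γ s) (W₁ s) (N s) = 0
  W₂_T : ∀ s ∈ J, g.inner (γ s) (W₂ s) (velocity γ s) = 0
  W₂_N : ∀ s ∈ J, g.inner (γ s) (W₂ s) (N s) = 0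
  W₁_W₁ : ∀ s ∈ J, g.inner (γ s) (W₁ s) (W₁ s) = ε₁
  W₂_W₂ : ∀ s ∈ J, g.inner (γ s) (W₂ s) (W₂ s) = ε₂
  W₁_W₂ : ∀ s ∈ J, g.inner (γ s) (W₁ s) (W₂ s) = 0
  cartan_T : ∀ s ∈ J, g.covDeriv γ (velocity γ) s = a • W₁ s
  cartan_W₁ : ∀ s ∈ J, g.covDeriv γ W₁ s = -(k₁ s) • velocity γ s + (a * ε₁) • N s
  cartan_N : ∀ s ∈ J, g.covDeriv γ N s = -(ε₁ * k₁ s) • W₁ s + (ε₂ * k₂ s) • W₂ s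
  cartan_W₂ : ∀ s ∈ J, g.covDeriv γ W₂ s = k₂ s • velocity γ s

/-! ### Variations -/

/-- `Γ` is a smooth variation of the curve `γ : J → M` with variation vector field `V`. It is
defined on an open neighbourhood `U` of `J × {0}` in the `(s,t)`-plane. -/
structure IsVariation (J : Set ℝ) (γ : ℝ → M) (V : ∀ s, Tan M (γ s))
    (U : Set (ℝ × ℝ)) (Γ : ℝ × ℝ → M) : Prop where
  isOpen : IsOpen U
  mem : ∀ s ∈ J, (s, (0 : ℝ)) ∈ U
  smooth : ContMDiffOn 𝓘(ℝ, ℝ × ℝ) 𝓘(ℝ, E4) ∞ Γ U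
  start : ∀ s ∈ J, Γ (s, 0) = γ s
  field : ∀ s ∈ J, (⟨Γ (s, 0), velocity (fun t ↦ Γ (s, t)) 0⟩ : TangentBundle 𝓘(ℝ, E4) M)
    = ⟨γ s, V s⟩

/-- `V` is tangent to `Λ` at `γ`: it is the variation vector field of a variation of `γ` through
pseudo arc-length parametrized null curves. -/
def IsTangentToLambda (a : ℝ) (J : Set ℝ) (γ : ℝ → M) (V : ∀ s, Tan M (γ s)) : Prop :=
  ∃ (U : Set (ℝ × ℝ)) (Γ : ℝ × ℝ → M), IsVariation J γ V U Γ ∧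
    ∀ t : ℝ, g.IsPseudoArcNullCurve a {s | (s, t) ∈ U} (fun s ↦ Γ (s, t))

/-- `V` locally preserves the causal character: `⟨∇_T V, T⟩ = 0`. -/
def PreservesCausalCharacter (J : Set ℝ) (γ : ℝ → M) (V : ∀ s, Tan M (γ s)) : Prop :=
  ∀ s ∈ J, g.inner (γ s) (g.covDeriv γ V s) (velocity γ s) = 0

/-- `V` locally preserves the pseudo arc-length parameter along `γ`: it is the variation vector
field of a variation of `γ` through null curves such that the derivative
`η(s,t) = dσ/ds` of the pseudo arc-length parameter satisfies `∂η/∂t = 0` at `t = 0`. -/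
def PreservesPseudoArc (a : ℝ) (J : Set ℝ) (γ : ℝ → M) (V : ∀ s, Tan M (γ s)) : Prop :=
  ∃ (U : Set (ℝ × ℝ)) (Γ : ℝ × ℝ → M), IsVariation J γ V U Γ ∧
    (∀ t : ℝ, g.IsNullOn {s | (s, t) ∈ U} (fun s ↦ Γ (s, t))) ∧
    ∀ s ∈ J, HasDerivAt (fun t ↦ g.pseudoSpeed a (fun s' ↦ Γ (s', t)) s) 0 0

end SemiRiemannianMetric

/-- `p` is an indefinite integral `D_σ⁻¹ h` of `h` on `J`. -/
def IsAntiderivOn (J : Set ℝ) (p h : ℝ → ℝ) : Prop :=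
  ∀ s ∈ J, HasDerivAt p (h s) s

namespace SemiRiemannianMetric.CartanFrame

variable [IsManifold 𝓘(ℝ, E4) ∞ M] {q : ℕ} {g : SemiRiemannianMetric M q}
  {a ε₁ ε₂ : ℝ} {J : Set ℝ} {γ : ℝ → M}

/-- The `T`-component `f_V = -⟨V, N⟩`. -/
def fV (F : g.CartanFrame a ε₁ ε₂ J γ) (V : ∀ s, Tan M (γ s)) (s : ℝ) : ℝ :=
  -g.inner (γ s) (V s) (F.N s)

/-- The `W₁`-component `h_V = ε₁⟨V, W₁⟩`. -/
def hV (F : g.CartanFrame a ε₁ ε₂ J γ) (V : ∀ s, Tan M (γ s)) (s : ℝ) : ℝ :=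
  ε₁ * g.inner (γ s) (V s) (F.W₁ s)

/-- The `N`-component `g_V = -⟨V, T⟩`. -/
def gV (_F : g.CartanFrame a ε₁ ε₂ J γ) (V : ∀ s, Tan M (γ s)) (s : ℝ) : ℝ :=
  -g.inner (γ s) (V s) (velocity γ s)

/-- The `W₂`-component `l_V = ε₂⟨V, W₂⟩`. -/
def lV (F : g.CartanFrame a ε₁ ε₂ J γ) (V : ∀ s, Tan M (γ s)) (s : ℝ) : ℝ :=
  ε₂ * g.inner (γ s) (V s) (F.W₂ s)

/-- `φ_V = ε₁⟨∇_T V, W₁⟩`. -/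
def phiV (F : g.CartanFrame a ε₁ ε₂ J γ) (V : ∀ s, Tan M (γ s)) (s : ℝ) : ℝ :=
  ε₁ * g.inner (γ s) (g.covDeriv γ V s) (F.W₁ s)

/-- `ψ_V = ε₂⟨∇_T V, W₂⟩`. -/
def psiV (F : g.CartanFrame a ε₁ ε₂ J γ) (V : ∀ s, Tan M (γ s)) (s : ℝ) : ℝ :=
  ε₂ * g.inner (γ s) (g.covDeriv γ V s) (F.W₂ s)

/-- The formulas
`f_V = -(1/2a)[h_V' + a k₁ D_σ⁻¹(h_V) - a D_σ⁻¹(k₁ h_V - k₂ l_V)]`, `g_V = -ε₁ a D_σ⁻¹(h_V)`,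
where `p` stands for `D_σ⁻¹(h_V)` and `r` for `D_σ⁻¹(k₁ h_V - k₂ l_V)`. -/
def Compatibility (F : g.CartanFrame a ε₁ ε₂ J γ) (V : ∀ s, Tan M (γ s)) (p r : ℝ → ℝ) : Prop :=
  IsAntiderivOn J p (F.hV V) ∧
  IsAntiderivOn J r (fun s ↦ F.k₁ s * F.hV V s - F.k₂ s * F.lV V s) ∧
  ∀ s ∈ J,
    F.fV V s = -(1 / (2 * a)) * (deriv (F.hV V) s + a * F.k₁ s * p s - a * r s) ∧
    F.gV V s = -ε₁ * a * p s

end SemiRiemannianMetric.CartanFrame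

end NullCurve

end

/-! Call `V` admissible when ⟨∇_T V, T⟩ = 0 and ⟨∇_T² V, W₁⟩ = 0 (`IsAdmissible`). Every equivalence
passes through this pair of equations.

Necessity: let `V` be the field of a variation Γ through null curves. Differentiating ⟨Γ_s, Γ_s⟩ = 0
in t and exchanging ∇_t Γ_s = ∇_s Γ_t gives the first equation. If η is stationary, so is ⟨∇_T T,
∇_T T⟩. Commuting ∇_t past ∇_s produces ∇_T² V and the curvature term G(⟨T,T⟩V − ⟨V,T⟩T), which is
orthogonal to ∇_T T = aW₁, and the second equation follows (`IsVariation.inner_covDeriv_velocity`,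
`IsVariation.inner_covDeriv_covDeriv`).

Sufficiency: an admissible field has to be integrated to an actual variation. Instead of the curve,
the Cartan equations are deformed. For each t one solves Y_s = e₀, ∇_s e = K e with K = C + tL,
where C is the Cartan matrix of γ. If K is skew for the Gram matrix of the frame, the Gram matrix is
constant; if the first row of K stays (0, a, 0, 0), each curve is null with ⟨∇_T T, ∇_T T⟩ = a²ε₁,
hence lies in Λ. The matrix L is forced: if ∇_t e = Ωe at t = 0, commuting ∇_s and ∇_t gives L = Ω'
+ [Ω, C] + (curvature term). The first row of Ω holds the components of ∇_T V, and two further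
entries of Ω are free. They are chosen to cancel two entries of the first row of L; a third vanishes
by skewness, the last by the second admissibility equation (`IsAdmissible.cartanVariation_zero`).
The variation field is `V` because the differences between the actual and the intended t-derivatives
of the frame solve a homogeneous linear system in s and vanish at s₀ (`velocity_frame_family`).

The smooth family of frames over a neighbourhood of `J × {0}` comes from smooth dependence of
solutions on data (`exists_local_flow`, by the inverse function theorem in C([-1,1], F)) and a
continuation argument along `J` (`exists_frame_family`). Constant curvature enters through R(u,v)w =
G(⟨u,w⟩v − ⟨v,w⟩u), recovered from the sectional curvatures in `curv_eq_of_sectional`.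

The formulas for components are linear algebra: g' = −⟨∇_T V, T⟩ − aε₁h, and under the first
equation f + φ/a has derivative k₁h − k₂l + (ε₁/a)⟨∇_T² V, W₁⟩. So the two antiderivative conditions
are the two admissibility equations. -/

noncomputable section

namespace NullCurve

universe u

/-! ### Smoothness of superposition operators on spaces of continuous maps -/

section Superposition

variable {K : Type*} [TopologicalSpace K] [CompactSpace K]

/-- Pointwise application of a continuous family of operators, as a bounded bilinear map. -/
def ContinuousMap.clmApply (K : Type*) [TopologicalSpace K] [CompactSpace K]
    (F G : Type*) [NormedAddCommGroup F] [NormedSpace ℝ F]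
    [NormedAddCommGroup G] [NormedSpace ℝ G] : C(K, F →L[ℝ] G) →L[ℝ] C(K, F) →L[ℝ] C(K, G) :=
  LinearMap.mkContinuous₂
    (LinearMap.mk₂ ℝ (fun (A : C(K, F →L[ℝ] G)) (β : C(K, F)) ↦
        (⟨fun k ↦ A k (β k), by fun_prop⟩ : C(K, G)))
      (fun A B β ↦ by ext k; simp) (fun c A β ↦ by ext k; simp)
      (fun A β β' ↦ by ext k; simp) (fun c A β ↦ by ext k; simp)) 1
    (fun A β ↦ by
      rw [ContinuousMap.norm_le _ (by positivity)]
      intro k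
      calc ‖A k (β k)‖ ≤ ‖A k‖ * ‖β k‖ := (A k).le_opNorm _
        _ ≤ ‖A‖ * ‖β‖ := by
            gcongr
            · exact A.norm_coe_le_norm k
            · exact β.norm_coe_le_norm k
        _ = 1 * ‖A‖ * ‖β‖ := by ring)

@[simp] lemma ContinuousMap.clmApply_apply {F G : Type*} [NormedAddCommGroup F] [NormedSpace ℝ F]
    [NormedAddCommGroup G] [NormedSpace ℝ G] (A : C(K, F →L[ℝ] G)) (β : C(K, F)) (k : K) :
    ContinuousMap.clmApply K F G A β k = A k (β k) := rfl

/-- The mean value inequality is applied at each point of `K`. It is uniform in the point because α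
↦ f' ∘ α is continuous for the sup norm. -/
lemma ContinuousMap.hasFDerivAt_postcomp {F G : Type*} [NormedAddCommGroup F] [NormedSpace ℝ F]
    [NormedAddCommGroup G] [NormedSpace ℝ G] (f : C(F, G)) (f' : C(F, F →L[ℝ] G))
    (h : ∀ x, HasFDerivAt f (f' x) x) (α : C(K, F)) :
    HasFDerivAt (fun α : C(K, F) ↦ f.comp α) (ContinuousMap.clmApply K F G (f'.comp α)) α := by
  rw [hasFDerivAt_iff_isLittleO_nhds_zero, Asymptotics.isLittleO_iff]
  intro ε hε
  have hc : Filter.Tendsto (fun α : C(K, F) ↦ f'.comp α) (nhds α) (nhds (f'.comp α)) :=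
    (ContinuousMap.continuous_postcomp (X := K) f').continuousAt (x := α)
  obtain ⟨δ, hδ, H⟩ := (Metric.tendsto_nhds_nhds (α := C(K, F)) (β := C(K, F →L[ℝ] G))).1 hc ε hε
  filter_upwards [Metric.ball_mem_nhds (0 : C(K, F)) hδ] with β hβ
  rw [mem_ball_zero_iff] at hβ
  rw [ContinuousMap.norm_le _ (by positivity)]
  intro k
  have hb : ∀ x ∈ Metric.closedBall (α k) ‖β‖, ‖f' x - f' (α k)‖ ≤ ε := by
    intro x hx
    -- A point `x` near `α k` is the value at `k` of `α` shifted by a constant, so sup-norm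
    -- continuity at `α` controls `f' x - f' (α k)`.
    set b : C(K, F) := ContinuousMap.const K (x - α k) with hbdef
    have hbn : ‖b‖ ≤ ‖β‖ := by
      rw [ContinuousMap.norm_le _ (norm_nonneg _)]
      intro _
      simpa [hbdef, dist_eq_norm] using hx
    have h1 : dist (f'.comp (α + b)) (f'.comp α) < ε := by
      apply H
      rw [dist_eq_norm, add_sub_cancel_left]
      exact hbn.trans_lt hβ
    have h2 := (ContinuousMap.dist_apply_le_dist (f := f'.comp (α + b)) (g := f'.comp α) k)
    have h3 : f'.comp (α + b) k = f' x := by simp [hbdef]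
    rw [h3, dist_eq_norm] at h2
    exact h2.trans h1.le
  have key := Convex.norm_image_sub_le_of_norm_hasFDerivWithin_le' (𝕜 := ℝ) (f := f) (f' := f')
    (φ := f' (α k)) (C := ε) (s := Metric.closedBall (α k) ‖β‖) (x := α k) (y := α k + β k)
    (fun x _ ↦ (h x).hasFDerivWithinAt) hb (convex_closedBall _ _)
    (Metric.mem_closedBall_self (norm_nonneg _))
    (by simpa using β.norm_coe_le_norm k)
  rw [add_sub_cancel_left] at key
  refine key.trans ?_
  gcongr
  exact β.norm_coe_le_norm k

/-- The derivative at `α` is multiplication by f' ∘ α, again a superposition, so the order of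
smoothness rises by induction. The target `G` is quantified inside the induction because f' takes
values in `F →L[ℝ] G`. -/
lemma ContinuousMap.contDiff_postcomp_nat {F : Type u} [NormedAddCommGroup F] [NormedSpace ℝ F]
    (n : ℕ) : ∀ {G : Type u} [NormedAddCommGroup G] [NormedSpace ℝ G] (f : C(F, G)),
    ContDiff ℝ ∞ f → ContDiff ℝ n (fun α : C(K, F) ↦ f.comp α) := by
  induction n with
  | zero =>
    intro G _ _ f _
    simpa using ContinuousMap.continuous_postcomp (X := K) f
  | succ n ih =>
    intro G _ _ f hf
    have hf1 : ContDiff ℝ ∞ (fderiv ℝ f) := hf.fderiv_right (by simp)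
    let f' : C(F, F →L[ℝ] G) := ⟨fderiv ℝ f, hf1.continuous⟩
    have hd : ∀ x, HasFDerivAt f (f' x) x := fun x ↦
      ((hf.differentiable (by simp)) x).hasFDerivAt
    push_cast
    rw [contDiff_succ_iff_hasFDerivAt]
    have hM : ContDiff ℝ n fun B : C(K, F →L[ℝ] G) ↦ ContinuousMap.clmApply K F G B :=
      ContinuousLinearMap.contDiff (𝕜 := ℝ) (E := C(K, F →L[ℝ] G)) (F := C(K, F) →L[ℝ] C(K, G))
        (ContinuousMap.clmApply K F G)
    exact ⟨fun α ↦ ContinuousMap.clmApply K F G (f'.comp α), hM.comp (ih f' hf1),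
      fun α ↦ ContinuousMap.hasFDerivAt_postcomp f f' hd α⟩

/-- Postcomposition with a smooth map is a smooth map between spaces of continuous maps. -/
lemma ContinuousMap.contDiff_postcomp {F : Type u} [NormedAddCommGroup F] [NormedSpace ℝ F]
    {G : Type u} [NormedAddCommGroup G] [NormedSpace ℝ G] (f : C(F, G))
    (hf : ContDiff ℝ ∞ f) : ContDiff ℝ ∞ (fun α : C(K, F) ↦ f.comp α) :=
  contDiff_infty.2 fun n ↦ ContinuousMap.contDiff_postcomp_nat n f hf

end Superposition

/-! ### Smooth local flows from the inverse function theorem -/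

section LocalFlow

variable {F : Type u} [NormedAddCommGroup F] [NormedSpace ℝ F]

/-- The interval `[-1, 1]` as a type. -/
abbrev UnitIcc : Type := Set.Icc (-1 : ℝ) 1

instance : Fact ((-1 : ℝ) ≤ 1) := ⟨by norm_num⟩

/-- The primitive vanishing at `0`, as a bounded operator on `C([-1, 1], F)`. -/
def primitiveCLM (F : Type*) [NormedAddCommGroup F] [NormedSpace ℝ F] :
    C(UnitIcc, F) →L[ℝ] C(UnitIcc, F) :=
  LinearMap.mkContinuous
    { toFun := fun β ↦ ⟨fun σ ↦ ∫ u in (0 : ℝ)..σ, Set.IccExtend (by norm_num) β u, by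
        have h : Continuous (Set.IccExtend (by norm_num : (-1 : ℝ) ≤ 1) β) := β.continuous.Icc_extend'
        exact (intervalIntegral.continuous_primitive
          (fun a b ↦ h.intervalIntegrable a b) 0).comp continuous_subtype_val⟩
      map_add' := fun β β' ↦ by
        ext σ
        have h (β : C(UnitIcc, F)) : Continuous (Set.IccExtend (by norm_num : (-1 : ℝ) ≤ 1) β) :=
          β.continuous.Icc_extend'
        exact intervalIntegral.integral_add ((h β).intervalIntegrable _ _)
          ((h β').intervalIntegrable _ _)
      map_smul' := fun c β ↦ by
        ext σ
        exact intervalIntegral.integral_smul _ _ } 1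
    (fun β ↦ by
      rw [ContinuousMap.norm_le _ (by positivity)]
      intro σ
      have h := intervalIntegral.norm_integral_le_of_norm_le_const (a := 0) (b := (σ : ℝ))
        (f := Set.IccExtend (by norm_num : (-1 : ℝ) ≤ 1) β) (C := ‖β‖)
        (fun x _ ↦ β.norm_coe_le_norm _)
      refine h.trans ?_
      rw [one_mul, sub_zero]
      exact mul_le_of_le_one_right (norm_nonneg _) (abs_le.2 ⟨σ.2.1, σ.2.2⟩))

lemma primitiveCLM_apply (β : C(UnitIcc, F)) (σ : UnitIcc) :
    primitiveCLM F β σ = ∫ u in (0 : ℝ)..σ, Set.IccExtend (by norm_num) β u := rfl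

/-- Constant functions, as a bounded operator. -/
def constCLM (F : Type*) [NormedAddCommGroup F] [NormedSpace ℝ F] : F →L[ℝ] C(UnitIcc, F) :=
  LinearMap.mkContinuous
    { toFun := fun z ↦ ContinuousMap.const _ z
      map_add' := fun _ _ ↦ rfl
      map_smul' := fun _ _ ↦ rfl } 1
    (fun z ↦ by
      rw [ContinuousMap.norm_le _ (by positivity)]
      intro σ
      exact (one_mul ‖z‖).ge)

@[simp] lemma constCLM_apply (z : F) (σ : UnitIcc) : constCLM F z σ = z := rfl

/-- The equation `α = z + τ ∫₀ f ∘ α` for a rescaled integral curve, as a map. -/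
def picardDefect (f : C(F, F)) (p : (F × ℝ) × C(UnitIcc, F)) : (F × ℝ) × C(UnitIcc, F) :=
  (p.1, p.2 - constCLM F p.1.1 - p.1.2 • primitiveCLM F (f.comp p.2))

lemma contDiff_picardDefect (f : C(F, F)) (hf : ContDiff ℝ ∞ f) :
    ContDiff ℝ ∞ (picardDefect f) := by
  have h := ContinuousMap.contDiff_postcomp (K := UnitIcc) f hf
  unfold picardDefect
  refine contDiff_fst.prodMk ((contDiff_snd.sub ?_).sub ?_)
  · exact (constCLM F).contDiff.comp (contDiff_fst.comp contDiff_fst)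
  · exact (contDiff_snd.comp contDiff_fst).smul
      ((primitiveCLM F).contDiff.comp (h.comp contDiff_snd))

/-- The linear automorphism `(p, α) ↦ (p, α - B p)`. -/
def shearEquiv {P Q : Type*} [NormedAddCommGroup P] [NormedSpace ℝ P] [NormedAddCommGroup Q]
    [NormedSpace ℝ Q] (B : P →L[ℝ] Q) : (P × Q) ≃L[ℝ] (P × Q) :=
  ContinuousLinearEquiv.equivOfInverse
    ((ContinuousLinearMap.fst ℝ P Q).prod
      (ContinuousLinearMap.snd ℝ P Q - B.comp (ContinuousLinearMap.fst ℝ P Q)))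
    ((ContinuousLinearMap.fst ℝ P Q).prod
      (ContinuousLinearMap.snd ℝ P Q + B.comp (ContinuousLinearMap.fst ℝ P Q)))
    (fun x ↦ by ext <;> simp) (fun x ↦ by ext <;> simp)

/-- At τ = 0 the factor τ removes the derivative of `f`, so only a shear is left, which is
invertible without any smallness condition. Carrying the parameters `p.1` along turns the implicit
function theorem into the inverse function theorem. -/
lemma hasFDerivAt_picardDefect (f : C(F, F)) (hf : ContDiff ℝ ∞ f) (z₀ : F) :
    HasFDerivAt (picardDefect f)
      (shearEquiv ((constCLM F).comp (ContinuousLinearMap.fst ℝ F ℝ) +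
        (ContinuousLinearMap.snd ℝ F ℝ).smulRight
          (primitiveCLM F (f.comp (constCLM F z₀)))) :
        (F × ℝ) × C(UnitIcc, F) →L[ℝ] (F × ℝ) × C(UnitIcc, F))
      ((z₀, 0), constCLM F z₀) := by
  have hN : ContDiff ℝ ∞ (fun α : C(UnitIcc, F) ↦ f.comp α) :=
    ContinuousMap.contDiff_postcomp f hf
  have hNd : HasFDerivAt (fun p : (F × ℝ) × C(UnitIcc, F) ↦ primitiveCLM F (f.comp p.2))
      ((primitiveCLM F).comp ((fderiv ℝ (fun α : C(UnitIcc, F) ↦ f.comp α) (constCLM F z₀)).comp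
        (ContinuousLinearMap.snd ℝ (F × ℝ) C(UnitIcc, F)))) ((z₀, 0), constCLM F z₀) :=
    (primitiveCLM F).hasFDerivAt.comp _
      (HasFDerivAt.comp ((z₀, (0 : ℝ)), constCLM F z₀)
        (g := fun α : C(UnitIcc, F) ↦ f.comp α)
        (((hN.differentiable (by simp)) _).hasFDerivAt) hasFDerivAt_snd)
  have h1 : HasFDerivAt (fun p : (F × ℝ) × C(UnitIcc, F) ↦ p.1.2)
      ((ContinuousLinearMap.snd ℝ F ℝ).comp (ContinuousLinearMap.fst ℝ (F × ℝ) C(UnitIcc, F)))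
      ((z₀, 0), constCLM F z₀) :=
    ((ContinuousLinearMap.snd ℝ F ℝ).comp
      (ContinuousLinearMap.fst ℝ (F × ℝ) C(UnitIcc, F))).hasFDerivAt
  have h2 : HasFDerivAt (fun p : (F × ℝ) × C(UnitIcc, F) ↦ constCLM F p.1.1)
      ((constCLM F).comp ((ContinuousLinearMap.fst ℝ F ℝ).comp
        (ContinuousLinearMap.fst ℝ (F × ℝ) C(UnitIcc, F))))
      ((z₀, 0), constCLM F z₀) :=
    ((constCLM F).comp ((ContinuousLinearMap.fst ℝ F ℝ).comp
      (ContinuousLinearMap.fst ℝ (F × ℝ) C(UnitIcc, F)))).hasFDerivAt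
  have := (hasFDerivAt_fst (𝕜 := ℝ) (p := ((z₀, (0 : ℝ)), constCLM F z₀))).prodMk
    (((hasFDerivAt_snd (𝕜 := ℝ) (p := ((z₀, (0 : ℝ)), constCLM F z₀))).sub h2).sub (h1.smul hNd))
  refine this.congr_fderiv ?_
  ext x <;> simp [shearEquiv]

end LocalFlow

section LocalFlow

variable {F : Type u} [NormedAddCommGroup F] [NormedSpace ℝ F]

lemma picardDefect_eq_iff (f : C(F, F)) (z : F) (τ : ℝ) (α : C(UnitIcc, F)) :
    picardDefect f ((z, τ), α) = ((z, τ), 0) ↔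
      ∀ σ : UnitIcc, α σ = z + τ • ∫ u in (0 : ℝ)..σ, f (Set.IccExtend (by norm_num) α u) := by
  unfold picardDefect
  rw [Prod.mk.injEq, eq_self, true_and, sub_sub, sub_eq_zero, ContinuousMap.ext_iff]
  rfl

/-- Reparametrization `σ ↦ cσ` of the interval `[-1, 1]`, for `c` in that interval. -/
def scaleIcc (c : UnitIcc) : C(UnitIcc, UnitIcc) where
  toFun σ := ⟨c * σ, by
    rw [Set.mem_Icc, ← abs_le, abs_mul]
    exact mul_le_one₀ (abs_le.2 c.2) (abs_nonneg _) (abs_le.2 σ.2)⟩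
  continuous_toFun := by fun_prop

/-- If α(σ) = x(τσ) for an integral curve x, then α(cσ) = x(τcσ). This consistency between different
τ lets one curve α describe the flow at all smaller times. -/
lemma picardDefect_comp_scaleIcc (f : C(F, F)) {z : F} {τ : ℝ} {α : C(UnitIcc, F)}
    (h : picardDefect f ((z, τ), α) = ((z, τ), 0)) (c : UnitIcc) :
    picardDefect f ((z, τ * c), α.comp (scaleIcc c)) = ((z, τ * c), 0) := by
  rw [picardDefect_eq_iff] at h ⊢
  intro σ
  rw [ContinuousMap.comp_apply, h (scaleIcc c σ), mul_smul]
  congr 2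
  have : ((scaleIcc c σ : UnitIcc) : ℝ) = c * σ := rfl
  rw [this]
  have h1 := intervalIntegral.smul_integral_comp_mul_left (a := 0) (b := (σ : ℝ))
    (fun u ↦ f (Set.IccExtend (by norm_num : (-1 : ℝ) ≤ 1) α u)) (c : ℝ)
  rw [mul_zero] at h1
  rw [← h1]
  congr 1
  apply intervalIntegral.integral_congr
  intro u hu
  have hu1 : u ∈ Set.Icc (-1 : ℝ) 1 := by
    have hs := σ.2
    rcases Set.mem_uIcc.1 hu with h | h <;> constructor <;> linarith [hs.1, hs.2, h.1, h.2]
  have hu2 : (c : ℝ) * u ∈ Set.Icc (-1 : ℝ) 1 := (scaleIcc c ⟨u, hu1⟩).2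
  simp only [Set.IccExtend_of_mem _ _ hu1, Set.IccExtend_of_mem _ _ hu2]
  rfl

lemma hasDerivAt_of_picardDefect [CompleteSpace F] (f : C(F, F)) {z : F} {τ : ℝ}
    {α : C(UnitIcc, F)}
    (h : picardDefect f ((z, τ), α) = ((z, τ), 0)) {s : ℝ} (hs : s ∈ Set.Ioo (-1 : ℝ) 1) :
    HasDerivAt (Set.IccExtend (by norm_num) α) (τ • f (Set.IccExtend (by norm_num) α s)) s := by
  rw [picardDefect_eq_iff] at h
  have hc : Continuous (fun u ↦ f (Set.IccExtend (by norm_num : (-1 : ℝ) ≤ 1) α u)) :=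
    f.continuous.comp α.continuous.Icc_extend'
  have h1 := ((intervalIntegral.integral_hasDerivAt_right (hc.intervalIntegrable 0 s)
    (hc.stronglyMeasurableAtFilter _ _) hc.continuousAt).const_smul τ).const_add z
  refine h1.congr_of_eventuallyEq ?_
  filter_upwards [Ioo_mem_nhds hs.1 hs.2] with u hu
  rw [Set.IccExtend_of_mem _ _ (Set.Ioo_subset_Icc_self hu)]
  exact h ⟨u, _⟩

/-- The flow of a smooth vector field is locally defined and jointly smooth. -/
theorem exists_local_flow [CompleteSpace F] (f : F → F) (hf : ContDiff ℝ ∞ f) (z₀ : F) :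
    ∃ ε > 0, ∃ φ : F × ℝ → F, (∀ z ∈ Metric.ball z₀ ε, φ (z, 0) = z) ∧
      (∀ z ∈ Metric.ball z₀ ε, ∀ τ ∈ Set.Ioo (-ε) ε, ContDiffAt ℝ ∞ φ (z, τ)) ∧
      ∀ z ∈ Metric.ball z₀ ε, ∀ τ ∈ Set.Ioo (-ε) ε,
        HasDerivAt (fun τ ↦ φ (z, τ)) (f (φ (z, τ))) τ := by
  let fc : C(F, F) := ⟨f, hf.continuous⟩
  have hf' : ContDiff ℝ ∞ fc := hf
  have hH := contDiff_picardDefect fc hf'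
  have hHd := hasFDerivAt_picardDefect fc hf' z₀
  set w₀ : (F × ℝ) × C(UnitIcc, F) := ((z₀, 0), constCLM F z₀) with hw₀
  let Φ : OpenPartialHomeomorph ((F × ℝ) × C(UnitIcc, F)) ((F × ℝ) × C(UnitIcc, F)) :=
    ContDiffAt.toOpenPartialHomeomorph (picardDefect fc) (hH.contDiffAt (x := w₀)) hHd (by simp)
  have hΦ : (Φ : (F × ℝ) × C(UnitIcc, F) → (F × ℝ) × C(UnitIcc, F)) = picardDefect fc := rfl
  have hsrc : w₀ ∈ Φ.source := ContDiffAt.mem_toOpenPartialHomeomorph_source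
    (hH.contDiffAt (x := w₀)) hHd (by simp)
  have hΦw : Φ w₀ = ((z₀, 0), 0) := by
    rw [hΦ, hw₀, picardDefect_eq_iff]
    intro σ
    simp
  have htgt : ((z₀, (0 : ℝ)), (0 : C(UnitIcc, F))) ∈ Φ.target := hΦw ▸ Φ.map_source hsrc
  have hsymm : Φ.symm ((z₀, 0), 0) = w₀ := by rw [← hΦw, Φ.left_inv hsrc]
  have hcs : ContinuousAt Φ.symm ((z₀, (0 : ℝ)), (0 : C(UnitIcc, F))) := Φ.continuousAt_symm htgt
  -- Invertible operators form an open set, so the derivative is invertible near `w₀`; this makes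
  -- the local inverse smooth at all nearby points and not just at one.
  have hinv : ∀ᶠ w in nhds w₀, (∃ e : ((F × ℝ) × C(UnitIcc, F)) ≃L[ℝ] ((F × ℝ) × C(UnitIcc, F)),
        (e : (F × ℝ) × C(UnitIcc, F) →L[ℝ] (F × ℝ) × C(UnitIcc, F)) =
          fderiv ℝ (picardDefect fc) w) := by
    have hcf : ContinuousAt (fderiv ℝ (picardDefect fc)) w₀ :=
      (hH.continuous_fderiv (by simp)).continuousAt
    refine hcf.eventually_mem (s := Set.range ContinuousLinearEquiv.toContinuousLinearMap) ?_
    rw [hHd.fderiv]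
    exact ContinuousLinearEquiv.nhds _
  obtain ⟨ρ, hρ, hball⟩ := Metric.isOpen_iff.1 Φ.open_source w₀ hsrc
  have hcont : ContinuousAt (fun p : F × ℝ ↦ (p, (0 : C(UnitIcc, F)))) (z₀, 0) := by fun_prop
  have hev : ∀ᶠ p : F × ℝ in nhds (z₀, 0), (p, (0 : C(UnitIcc, F))) ∈ Φ.target ∧
      (∃ e : ((F × ℝ) × C(UnitIcc, F)) ≃L[ℝ] ((F × ℝ) × C(UnitIcc, F)),
        (e : (F × ℝ) × C(UnitIcc, F) →L[ℝ] (F × ℝ) × C(UnitIcc, F)) =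
          fderiv ℝ (picardDefect fc) (Φ.symm (p, 0))) ∧
      Φ.symm (p, 0) ∈ Metric.ball w₀ ρ ∧ p ∈ Metric.ball (z₀, (0 : ℝ)) ρ := by
    have h1 := hcont.eventually (Φ.open_target.mem_nhds htgt)
    have hcs' : Filter.Tendsto Φ.symm (nhds ((z₀, (0 : ℝ)), (0 : C(UnitIcc, F)))) (nhds w₀) := by
      have := hcs.tendsto
      rwa [hsymm] at this
    have h2 := hcont.eventually (hcs'.eventually hinv)
    have h3 := hcont.eventually (hcs'.eventually (Metric.ball_mem_nhds w₀ hρ))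
    filter_upwards [h1, h2, h3, Metric.ball_mem_nhds _ hρ] with p a b c d using ⟨a, b, c, d⟩
  obtain ⟨ε, hε, hεb⟩ := Metric.eventually_nhds_iff_ball.1 hev
  have hmem : ∀ z ∈ Metric.ball z₀ ε, ∀ τ ∈ Set.Ioo (-ε) ε, (z, τ) ∈ Metric.ball (z₀, (0 : ℝ)) ε := by
    intro z hz τ hτ
    rw [← ball_prod_same]
    exact ⟨hz, by rw [Real.ball_eq_Ioo]; simpa using hτ⟩
  set α : F → ℝ → C(UnitIcc, F) := fun z τ ↦ (Φ.symm ((z, τ), 0)).2 with hα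
  have hfst : ∀ z ∈ Metric.ball z₀ ε, ∀ τ ∈ Set.Ioo (-ε) ε,
      Φ.symm ((z, τ), 0) = ((z, τ), α z τ) ∧ picardDefect fc ((z, τ), α z τ) = ((z, τ), 0) := by
    intro z hz τ hτ
    have ht := (hεb _ (hmem z hz τ hτ)).1
    have h1 : picardDefect fc (Φ.symm ((z, τ), 0)) = ((z, τ), 0) := Φ.right_inv ht
    have h2 : (Φ.symm ((z, τ), 0)).1 = (z, τ) := by
      have := congrArg Prod.fst h1
      exact this
    have h3 : Φ.symm ((z, τ), 0) = ((z, τ), α z τ) := Prod.ext h2 rfl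
    exact ⟨h3, h3 ▸ h1⟩
  have hone : (1 : ℝ) ∈ Set.Icc (-1 : ℝ) 1 := by constructor <;> norm_num
  -- The rescaled curve and the curve for τc solve the same equation. Both lie where `picardDefect`
  -- is injective, so they coincide.
  have hscale : ∀ z ∈ Metric.ball z₀ ε, ∀ τ ∈ Set.Ioo (-ε) ε, ∀ c : UnitIcc,
      α z τ c = α z (τ * c) ⟨1, hone⟩ := by
    intro z hz τ hτ c
    have hτc : τ * c ∈ Set.Ioo (-ε) ε := by
      rw [Set.mem_Ioo, ← abs_lt] at hτ ⊢
      rw [abs_mul]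
      exact lt_of_le_of_lt (mul_le_of_le_one_right (abs_nonneg _) (abs_le.2 c.2)) hτ
    obtain ⟨h1, h2⟩ := hfst z hz τ hτ
    obtain ⟨h1', h2'⟩ := hfst z hz _ hτc
    have hs2 : ((z, τ * (c : ℝ)), α z (τ * c)) ∈ Φ.source :=
      h1' ▸ Φ.map_target (hεb _ (hmem z hz _ hτc)).1
    have hb : ((z, τ), α z τ) ∈ Metric.ball w₀ ρ := h1 ▸ (hεb _ (hmem z hz τ hτ)).2.2.1
    have hb' := (hεb _ (hmem z hz _ hτc)).2.2.2
    -- Rescaling takes values already taken by `α z τ`, so the distance to the constant curve does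
    -- not grow.
    have hs1 : ((z, τ * (c : ℝ)), (α z τ).comp (scaleIcc c)) ∈ Φ.source := by
      apply hball
      rw [hw₀, ← ball_prod_same] at hb ⊢
      refine ⟨hb', ?_⟩
      have hb2 := hb.2
      rw [Metric.mem_ball] at hb2 ⊢
      refine lt_of_le_of_lt ?_ hb2
      rw [ContinuousMap.dist_le dist_nonneg]
      intro σ
      exact ContinuousMap.dist_apply_le_dist (f := α z τ) (g := constCLM F z₀) (scaleIcc c σ)
    have heq := Φ.injOn hs1 hs2 ((picardDefect_comp_scaleIcc fc h2 c).trans h2'.symm)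
    have h3 : (α z τ).comp (scaleIcc c) = α z (τ * c) := congrArg Prod.snd heq
    rw [← h3, ContinuousMap.comp_apply]
    congr 1
    exact Subtype.ext (mul_one (c : ℝ)).symm
  -- The flow at time τ is the endpoint σ = 1 of the rescaled curve.
  refine ⟨ε, hε, fun p ↦ α p.1 p.2 ⟨1, hone⟩, ?_, ?_, ?_⟩
  · intro z hz
    have := (picardDefect_eq_iff fc z 0 _).1 (hfst z hz 0 ⟨by linarith, hε⟩).2 ⟨1, hone⟩
    simpa using this
  · intro z hz τ hτ
    obtain ⟨ht, ⟨e, he⟩, -, -⟩ := hεb _ (hmem z hz τ hτ)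
    have hd : HasFDerivAt Φ (e : (F × ℝ) × C(UnitIcc, F) →L[ℝ] (F × ℝ) × C(UnitIcc, F))
        (Φ.symm ((z, τ), 0)) := by
      rw [he]
      exact (hH.differentiable (by simp) _).hasFDerivAt
    have hsm : ContDiffAt ℝ ∞ Φ.symm ((z, τ), 0) := Φ.contDiffAt_symm ht hd hH.contDiffAt
    have h1 : ContDiffAt ℝ ∞ (fun p : F × ℝ ↦ (p, (0 : C(UnitIcc, F)))) (z, τ) :=
      contDiffAt_id.prodMk contDiffAt_const
    have h2 : ContDiffAt ℝ ∞ (fun p : F × ℝ ↦ (Φ.symm (p, 0)).2) (z, τ) :=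
      (ContDiffAt.comp (z, τ) (g := Φ.symm) hsm h1).snd
    exact (ContinuousLinearMap.contDiff (𝕜 := ℝ) (E := C(UnitIcc, F)) (F := F)
      (ContinuousMap.evalCLM ℝ (⟨1, hone⟩ : UnitIcc))).contDiffAt.comp _ h2
  · intro z hz τ hτ
    -- With |τ| < τ₁ < ε, the flow at times τ' near τ is read off the single curve `α z τ₁` at the
    -- interior parameter τ'/τ₁, where the fundamental theorem of calculus applies.
    obtain ⟨τ₁, h1, h2⟩ := exists_between (abs_lt.2 hτ)
    have hpos : 0 < τ₁ := (abs_nonneg τ).trans_lt h1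
    have hτ₁ : τ₁ ∈ Set.Ioo (-ε) ε := ⟨by linarith, h2⟩
    have hq : ∀ τ' : ℝ, |τ'| < τ₁ → τ' / τ₁ ∈ Set.Ioo (-1 : ℝ) 1 := by
      intro τ' h
      rw [Set.mem_Ioo, ← abs_lt, abs_div, abs_of_pos hpos, div_lt_one hpos]
      exact h
    have hval : ∀ τ' : ℝ, |τ'| < τ₁ → α z τ' ⟨1, hone⟩ =
        Set.IccExtend (by norm_num : (-1 : ℝ) ≤ 1) (α z τ₁) (τ' / τ₁) := by
      intro τ' h
      rw [Set.IccExtend_of_mem _ _ (Set.Ioo_subset_Icc_self (hq τ' h)), hscale z hz τ₁ hτ₁]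
      congr 2
      field_simp
    have hd := hasDerivAt_of_picardDefect fc (hfst z hz τ₁ hτ₁).2 (hq τ h1)
    have hd2 := HasDerivAt.scomp τ hd ((hasDerivAt_id τ).div_const τ₁)
    rw [← hval τ h1, smul_smul, one_div, inv_mul_cancel₀ hpos.ne', one_smul] at hd2
    refine hd2.congr_of_eventuallyEq ?_
    filter_upwards [(continuous_abs.tendsto τ).eventually (Iio_mem_nhds h1)] with τ' hτ'
    exact hval τ' hτ'

end LocalFlow

/-! ### Parameter dependence and uniqueness for ordinary differential equations -/

section ODE

/-- Multiplication by a bump function supported in the domain. The flow theorem above asks for a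
globally smooth field, while the fields of interest live on chart domains. -/
lemma exists_contDiff_eventuallyEq {F G : Type*} [NormedAddCommGroup F] [NormedSpace ℝ F]
    [FiniteDimensional ℝ F] [NormedAddCommGroup G] [NormedSpace ℝ G] {f : F → G} {Ω : Set F}
    (hΩ : IsOpen Ω) (hf : ContDiffOn ℝ ∞ f Ω) {z₀ : F} (hz : z₀ ∈ Ω) :
    ∃ g : F → G, ContDiff ℝ ∞ g ∧ g =ᶠ[nhds z₀] f := by
  obtain ⟨r, hr, hrΩ⟩ := Metric.nhds_basis_closedBall.mem_iff.1 (hΩ.mem_nhds hz)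
  let b : ContDiffBump z₀ := ⟨r / 2, r, by linarith, by linarith⟩
  refine ⟨fun z ↦ b z • f z, ?_, ?_⟩
  · rw [contDiff_iff_contDiffAt]
    intro x
    by_cases hx : x ∈ Ω
    · exact b.contDiff.contDiffAt.smul ((hf x hx).contDiffAt (hΩ.mem_nhds hx))
    · have hx' : x ∈ (Metric.closedBall z₀ r)ᶜ := fun h ↦ hx (hrΩ h)
      have : (fun z ↦ b z • f z) =ᶠ[nhds x] fun _ ↦ 0 := by
        filter_upwards [Metric.isClosed_closedBall.isOpen_compl.mem_nhds hx'] with z hz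
        rw [b.zero_of_le_dist (le_of_lt (by simpa using hz)), zero_smul]
      exact contDiffAt_const.congr_of_eventuallyEq this
  · filter_upwards [b.eventuallyEq_one] with z hz
    rw [hz]; simp

lemma eq_add_of_hasDerivAt_const {G : Type*} [NormedAddCommGroup G] [NormedSpace ℝ G]
    {x : ℝ → G} {c : G} {ε : ℝ} (h : ∀ τ ∈ Set.Ioo (-ε) ε, HasDerivAt x c τ) {τ : ℝ}
    (hτ : τ ∈ Set.Ioo (-ε) ε) : x τ = x 0 + τ • c := by
  have h1 : ∀ u ∈ Set.Ioo (-ε) ε, HasDerivAt (fun u ↦ x u - u • c) 0 u := by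
    intro u hu
    have := (h u hu).sub ((hasDerivAt_id u).smul_const c)
    rw [one_smul, sub_self] at this
    exact this
  have h0 : (0 : ℝ) ∈ Set.Ioo (-ε) ε := by
    have := hτ.1.trans hτ.2
    constructor <;> linarith
  have := isOpen_Ioo.is_const_of_deriv_eq_zero isPreconnected_Ioo
    (fun u hu ↦ (h1 u hu).differentiableAt.differentiableWithinAt)
    (fun u hu ↦ (h1 u hu).deriv) hτ h0
  simp only [zero_smul, sub_zero] at this
  rw [← this]; abel

/-- Smooth dependence on the initial time, a parameter and the initial value of the solutions
of `x' = f(s, t, x)`, where `t` is the parameter. -/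
theorem exists_local_flow_param {E : Type u} [NormedAddCommGroup E] [NormedSpace ℝ E]
    [FiniteDimensional ℝ E] {f : ℝ × ℝ × E → E} {Ω : Set (ℝ × ℝ × E)} (hΩ : IsOpen Ω)
    (hf : ContDiffOn ℝ ∞ f Ω) {z₀ : ℝ × ℝ × E} (hz₀ : z₀ ∈ Ω) :
    ∃ ε > 0, ∃ φ : (ℝ × ℝ × E) × ℝ → E, ∀ p ∈ Metric.ball z₀ ε, φ (p, 0) = p.2.2 ∧
      ∀ τ ∈ Set.Ioo (-ε) ε, ContDiffAt ℝ ∞ φ (p, τ) ∧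
        (p.1 + τ, p.2.1, φ (p, τ)) ∈ Ω ∧
        HasDerivAt (fun τ ↦ φ (p, τ)) (f (p.1 + τ, p.2.1, φ (p, τ))) τ := by
  have : CompleteSpace E := FiniteDimensional.complete ℝ E
  -- Time and parameter become coordinates of an autonomous system, moving with velocities 1 and 0.
  have hF : ContDiffOn ℝ ∞ (fun z ↦ ((1 : ℝ), (0 : ℝ), f z)) Ω :=
    contDiffOn_const.prodMk (contDiffOn_const.prodMk hf)
  obtain ⟨g, hg, hgf⟩ := exists_contDiff_eventuallyEq hΩ hF hz₀
  obtain ⟨ε₀, hε₀, φ, h0, hsm, hd⟩ := exists_local_flow g hg z₀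
  have hz0b := Metric.mem_ball_self (x := z₀) hε₀
  have hW : ∀ᶠ z in nhds z₀, z ∈ Ω ∧ g z = ((1 : ℝ), (0 : ℝ), f z) :=
    (hΩ.eventually_mem hz₀).and hgf
  have hcφ : Filter.Tendsto φ (nhds (z₀, 0)) (nhds z₀) := by
    have := (hsm z₀ hz0b 0 ⟨by linarith, hε₀⟩).continuousAt.tendsto
    rwa [h0 z₀ hz0b] at this
  obtain ⟨ε₁, hε₁, hb⟩ := Metric.eventually_nhds_iff_ball.1 (hcφ.eventually hW)
  set ε := min ε₀ ε₁ with hε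
  have hεpos : 0 < ε := lt_min hε₀ hε₁
  refine ⟨ε, hεpos, fun q ↦ (φ q).2.2, ?_⟩
  intro p hp
  have hp0 : p ∈ Metric.ball z₀ ε₀ := Metric.ball_subset_ball (min_le_left _ _) hp
  have hI0 : ∀ τ ∈ Set.Ioo (-ε) ε, τ ∈ Set.Ioo (-ε₀) ε₀ := fun τ hτ ↦
    ⟨by linarith [hτ.1, min_le_left ε₀ ε₁], by linarith [hτ.2, min_le_left ε₀ ε₁]⟩
  have hev : ∀ τ ∈ Set.Ioo (-ε) ε, φ (p, τ) ∈ Ω ∧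
      g (φ (p, τ)) = ((1 : ℝ), (0 : ℝ), f (φ (p, τ))) := by
    intro τ hτ
    apply hb
    rw [← ball_prod_same]
    refine ⟨Metric.ball_subset_ball (min_le_right _ _) hp, ?_⟩
    rw [Real.ball_eq_Ioo]
    exact ⟨by linarith [hτ.1, min_le_right ε₀ ε₁], by linarith [hτ.2, min_le_right ε₀ ε₁]⟩
  have hder : ∀ τ ∈ Set.Ioo (-ε) ε,
      HasDerivAt (fun τ ↦ φ (p, τ)) ((1 : ℝ), (0 : ℝ), f (φ (p, τ))) τ := by
    intro τ hτ
    rw [← (hev τ hτ).2]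
    exact hd p hp0 τ (hI0 τ hτ)
  have h1 : ∀ τ ∈ Set.Ioo (-ε) ε, (φ (p, τ)).1 = p.1 + τ := by
    intro τ hτ
    have := eq_add_of_hasDerivAt_const (x := fun τ ↦ (φ (p, τ)).1) (c := (1 : ℝ))
      (fun τ hτ ↦ (hder τ hτ).fst) hτ
    simpa [h0 p hp0] using this
  have h2 : ∀ τ ∈ Set.Ioo (-ε) ε, (φ (p, τ)).2.1 = p.2.1 := by
    intro τ hτ
    have := eq_add_of_hasDerivAt_const (x := fun τ ↦ (φ (p, τ)).2.1) (c := (0 : ℝ))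
      (fun τ hτ ↦ (hder τ hτ).snd.fst) hτ
    simpa [h0 p hp0] using this
  refine ⟨by simp [h0 p hp0], fun τ hτ ↦ ?_⟩
  have heq : φ (p, τ) = (p.1 + τ, p.2.1, (φ (p, τ)).2.2) :=
    Prod.ext (h1 τ hτ) (Prod.ext (h2 τ hτ) rfl)
  refine ⟨(hsm p hp0 τ (hI0 τ hτ)).snd.snd, heq ▸ (hev τ hτ).1, ?_⟩
  have := (hder τ hτ).snd.snd
  rwa [heq] at this

/-- A C¹ field is locally Lipschitz, and Grönwall's inequality then gives uniqueness near the common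
point. -/
lemma ode_eventuallyEq {E : Type*} [NormedAddCommGroup E] [NormedSpace ℝ E] {f : ℝ × E → E}
    {x y : ℝ → E} {s : ℝ} (hf : ContDiffAt ℝ 1 f (s, x s))
    (hx : ∀ᶠ u in nhds s, HasDerivAt x (f (u, x u)) u)
    (hy : ∀ᶠ u in nhds s, HasDerivAt y (f (u, y u)) u) (h : x s = y s) : x =ᶠ[nhds s] y := by
  obtain ⟨K, V, hV, hL⟩ := hf.exists_lipschitzOnWith
  have hcx : ContinuousAt (fun u ↦ (u, x u)) s :=
    continuousAt_id.prodMk hx.self_of_nhds.continuousAt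
  have hcy : ContinuousAt (fun u ↦ (u, y u)) s :=
    continuousAt_id.prodMk hy.self_of_nhds.continuousAt
  refine ODE_solution_unique_of_eventually (v := fun u e ↦ f (u, e)) (K := K)
    (s := fun u ↦ {e | (u, e) ∈ V}) (Filter.Eventually.of_forall fun u ↦ ?_) ?_ ?_ h
  · intro e he e' he'
    have := hL he he'
    simpa [Prod.edist_eq] using this
  · exact hx.and (hcx.eventually_mem hV)
  · exact hy.and (hcy.eventually_mem (by rw [← h]; exact hV))

/-- Two solutions of `x' = f(s, x)` which agree at a point agree. -/
theorem ode_eqOn {E : Type*} [NormedAddCommGroup E] [NormedSpace ℝ E] {f : ℝ × E → E}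
    {x y : ℝ → E} {I : Set ℝ} (hI : IsOpen I) (hI' : IsPreconnected I)
    (hf : ∀ s ∈ I, ContDiffAt ℝ 1 f (s, x s))
    (hx : ∀ s ∈ I, HasDerivAt x (f (s, x s)) s) (hy : ∀ s ∈ I, HasDerivAt y (f (s, y s)) s)
    {s₀ : ℝ} (hs₀ : s₀ ∈ I) (h : x s₀ = y s₀) : Set.EqOn x y I := by
  have hloc : ∀ s ∈ I, x s = y s → x =ᶠ[nhds s] y := fun s hs h ↦
    ode_eventuallyEq (hf s hs) ((hI.eventually_mem hs).mono hx) ((hI.eventually_mem hs).mono hy) h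
  -- The set where the germs agree is open by definition and relatively closed by continuity
  -- together with local uniqueness; `I` is connected.
  have key : I ⊆ {s | x =ᶠ[nhds s] y} := by
    refine hI'.subset_of_closure_inter_subset isOpen_setOfPred_eventually_nhds
      ⟨s₀, hs₀, hloc s₀ hs₀ h⟩ ?_
    rintro s ⟨hcl, hs⟩
    refine hloc s hs ?_
    by_contra hne
    have : ∀ᶠ u in nhds s, x u ≠ y u :=
      ((hx s hs).continuousAt.ne_iff_eventually_ne (hy s hs).continuousAt).1 hne
    obtain ⟨u, hu1, hu2⟩ := mem_closure_iff_nhds.1 hcl _ this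
    exact hu1 (Filter.EventuallyEq.eq_of_nhds hu2)
  exact fun s hs ↦ (key hs).eq_of_nhds

end ODE

/-! ### Levi-Civita calculus on an open subset of a vector space -/

section CoordinateGeometry

variable {E : Type*} [NormedAddCommGroup E] [NormedSpace ℝ E]
  {G : Type*} [NormedAddCommGroup G] [NormedSpace ℝ G]
  {P : Type*} [NormedAddCommGroup P] [NormedSpace ℝ P]

lemma fderiv_bilin_comp {B : E → E →L[ℝ] E →L[ℝ] G} {Y a b : P → E} {p : P}
    (hB : DifferentiableAt ℝ B (Y p)) (hY : DifferentiableAt ℝ Y p)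
    (ha : DifferentiableAt ℝ a p) (hb : DifferentiableAt ℝ b p) (h : P) :
    fderiv ℝ (fun q ↦ B (Y q) (a q) (b q)) p h =
      fderiv ℝ B (Y p) (fderiv ℝ Y p h) (a p) (b p) + B (Y p) (fderiv ℝ a p h) (b p) +
        B (Y p) (a p) (fderiv ℝ b p h) := by
  have h1 : HasFDerivAt (fun q ↦ B (Y q)) ((fderiv ℝ B (Y p)).comp (fderiv ℝ Y p)) p :=
    HasFDerivAt.comp p (g := B) (f := Y) hB.hasFDerivAt hY.hasFDerivAt
  have h2 := (h1.clm_apply ha.hasFDerivAt).clm_apply hb.hasFDerivAt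
  rw [h2.fderiv]
  simp only [add_apply, ContinuousLinearMap.comp_apply,
    ContinuousLinearMap.flip_apply]
  abel

lemma differentiableAt_bilin_comp {B : E → E →L[ℝ] E →L[ℝ] G} {Y a b : P → E} {p : P}
    (hB : DifferentiableAt ℝ B (Y p)) (hY : DifferentiableAt ℝ Y p)
    (ha : DifferentiableAt ℝ a p) (hb : DifferentiableAt ℝ b p) :
    DifferentiableAt ℝ (fun q ↦ B (Y q) (a q) (b q)) p :=
  ((DifferentiableAt.comp p hB hY).clm_apply ha).clm_apply hb

lemma fderiv_fderiv_apply_const {f : P → G} {p : P} (hf : ContDiffAt ℝ ∞ f p) (h k : P) :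
    fderiv ℝ (fun q ↦ fderiv ℝ f q h) p k = fderiv ℝ (fderiv ℝ f) p k h := by
  have h1 : DifferentiableAt ℝ (fderiv ℝ f) p :=
    (hf.fderiv_right (m := ∞) (by simp)).differentiableAt (by simp)
  rw [(h1.hasFDerivAt.clm_apply (hasFDerivAt_const h p)).fderiv]
  simp

lemma fderiv_fderiv_symm {f : P → G} {p : P} (hf : ContDiffAt ℝ ∞ f p) (h k : P) :
    fderiv ℝ (fderiv ℝ f) p k h = fderiv ℝ (fderiv ℝ f) p h k :=
  (hf.isSymmSndFDerivAt (by simp only [minSmoothness_of_isRCLikeNormedField]; exact ENat.LEInfty.out)) k h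

lemma contDiffAt_fderiv_apply_const {f : P → G} {p : P} (hf : ContDiffAt ℝ ∞ f p) (h : P) :
    ContDiffAt ℝ ∞ (fun q ↦ fderiv ℝ f q h) p :=
  (hf.fderiv_right (m := ∞) (by simp)).clm_apply contDiffAt_const

/-- A metric `gl` on an open subset `A` of a vector space, and the symmetric bilinear field `Ch`
of its Christoffel symbols. -/
structure CoordGeom (A : Set E) (gl : E → E →L[ℝ] E →L[ℝ] ℝ) (Ch : E → E →L[ℝ] E →L[ℝ] E) :
    Prop where
  isOpen : IsOpen A
  smooth_gl : ContDiffOn ℝ ∞ gl A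
  smooth_Ch : ContDiffOn ℝ ∞ Ch A
  symm_gl : ∀ y ∈ A, ∀ u v, gl y u v = gl y v u
  nondeg : ∀ y ∈ A, ∀ u, (∀ v, gl y u v = 0) → u = 0
  symm_Ch : ∀ y ∈ A, ∀ u v, Ch y u v = Ch y v u
  compat : ∀ y ∈ A, ∀ u v w,
    fderiv ℝ gl y u v w = gl y (Ch y u v) w + gl y v (Ch y u w)

/-- The covariant derivative in the direction `h` of a field `X` along a map `Y`. -/
def covD (Ch : E → E →L[ℝ] E →L[ℝ] E) (Y X : P → E) (h : P) (p : P) : E :=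
  fderiv ℝ X p h + Ch (Y p) (fderiv ℝ Y p h) (X p)

/-- The curvature `R(u,v)w = -∇_u∇_v w + ∇_v∇_u w` for constant vector fields. -/
def curv (Ch : E → E →L[ℝ] E →L[ℝ] E) (y u v w : E) : E :=
  -(fderiv ℝ Ch y u v w + Ch y u (Ch y v w)) + (fderiv ℝ Ch y v u w + Ch y v (Ch y u w))

namespace CoordGeom

variable {A A' : Set E} {gl gl' : E → E →L[ℝ] E →L[ℝ] ℝ} {Ch Ch' : E → E →L[ℝ] E →L[ℝ] E}

lemma contDiffAt_gl (H : CoordGeom A gl Ch) {y : E} (hy : y ∈ A) : ContDiffAt ℝ ∞ gl y :=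
  (H.smooth_gl y hy).contDiffAt (H.isOpen.mem_nhds hy)

lemma contDiffAt_Ch (H : CoordGeom A gl Ch) {y : E} (hy : y ∈ A) : ContDiffAt ℝ ∞ Ch y :=
  (H.smooth_Ch y hy).contDiffAt (H.isOpen.mem_nhds hy)

lemma differentiableAt_gl (H : CoordGeom A gl Ch) {y : E} (hy : y ∈ A) :
    DifferentiableAt ℝ gl y := (H.contDiffAt_gl hy).differentiableAt (by simp)

lemma differentiableAt_Ch (H : CoordGeom A gl Ch) {y : E} (hy : y ∈ A) :
    DifferentiableAt ℝ Ch y := (H.contDiffAt_Ch hy).differentiableAt (by simp)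

lemma ext_of_gl (H : CoordGeom A gl Ch) {y : E} (hy : y ∈ A) {u v : E}
    (h : ∀ w, gl y u w = gl y v w) : u = v := by
  rw [← sub_eq_zero]
  refine H.nondeg y hy _ fun w ↦ ?_
  rw [map_sub, sub_apply, h, sub_self]

/-- Metric compatibility along a map. -/
lemma fderiv_gl_comp (H : CoordGeom A gl Ch) {Y a b : P → E} {p : P} (hp : Y p ∈ A)
    (hY : DifferentiableAt ℝ Y p) (ha : DifferentiableAt ℝ a p) (hb : DifferentiableAt ℝ b p)
    (h : P) :
    fderiv ℝ (fun q ↦ gl (Y q) (a q) (b q)) p h =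
      gl (Y p) (covD Ch Y a h p) (b p) + gl (Y p) (a p) (covD Ch Y b h p) := by
  rw [fderiv_bilin_comp (H.differentiableAt_gl hp) hY ha hb, H.compat _ hp]
  simp only [covD, map_add, add_apply]
  ring

lemma contDiffAt_covD (H : CoordGeom A gl Ch) {Y X : P → E} {p : P} (hp : Y p ∈ A)
    (hY : ContDiffAt ℝ ∞ Y p) (hX : ContDiffAt ℝ ∞ X p) (h : P) :
    ContDiffAt ℝ ∞ (covD Ch Y X h) p := by
  unfold covD
  exact (contDiffAt_fderiv_apply_const hX h).add
    ((((H.contDiffAt_Ch hp).comp p hY).clm_apply (contDiffAt_fderiv_apply_const hY h)).clm_apply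
      hX)

/-- The Levi-Civita connection is torsion-free. -/
lemma covD_fderiv_comm (H : CoordGeom A gl Ch) {Y : P → E} {p : P} (hp : Y p ∈ A)
    (hY : ContDiffAt ℝ ∞ Y p) (h k : P) :
    covD Ch Y (fun q ↦ fderiv ℝ Y q h) k p = covD Ch Y (fun q ↦ fderiv ℝ Y q k) h p := by
  rw [covD, covD, fderiv_fderiv_apply_const hY, fderiv_fderiv_apply_const hY,
    fderiv_fderiv_symm hY, H.symm_Ch _ hp]

/-- The commutator of covariant derivatives is the curvature. -/
lemma covD_comm (H : CoordGeom A gl Ch) {Y X : P → E} {p : P} (hp : Y p ∈ A)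
    (hY : ContDiffAt ℝ ∞ Y p) (hX : ContDiffAt ℝ ∞ X p) (h k : P) :
    covD Ch Y (covD Ch Y X h) k p =
      covD Ch Y (covD Ch Y X k) h p + curv Ch (Y p) (fderiv ℝ Y p h) (fderiv ℝ Y p k) (X p) := by
  have hYd := hY.differentiableAt (by simp)
  have hXd := hX.differentiableAt (by simp)
  have hCd := H.differentiableAt_Ch hp
  -- After full expansion, the second derivatives of `X` and `Y` and the mixed first-order products
  -- are symmetric in `h`, `k` and cancel in the difference. The derivative of `Ch` and the double
  -- products of `Ch` remain, and these form `curv`.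
  have key : ∀ h k : P, covD Ch Y (covD Ch Y X h) k p =
      fderiv ℝ (fderiv ℝ X) p k h + (fderiv ℝ Ch (Y p) (fderiv ℝ Y p k) (fderiv ℝ Y p h) (X p) +
        Ch (Y p) (fderiv ℝ (fderiv ℝ Y) p k h) (X p) +
        Ch (Y p) (fderiv ℝ Y p h) (fderiv ℝ X p k)) +
      Ch (Y p) (fderiv ℝ Y p k) (fderiv ℝ X p h + Ch (Y p) (fderiv ℝ Y p h) (X p)) := by
    intro h k
    have hYh := (contDiffAt_fderiv_apply_const hY h).differentiableAt (by simp)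
    have hXh := (contDiffAt_fderiv_apply_const hX h).differentiableAt (by simp)
    have : fderiv ℝ (covD Ch Y X h) p k = fderiv ℝ (fun q ↦ fderiv ℝ X q h) p k +
        fderiv ℝ (fun q ↦ Ch (Y q) (fderiv ℝ Y q h) (X q)) p k := by
      unfold covD
      rw [fderiv_fun_add hXh (differentiableAt_bilin_comp hCd hYd hYh hXd)]
      rfl
    rw [covD, this, fderiv_bilin_comp hCd hYd hYh hXd, fderiv_fderiv_apply_const hX,
      fderiv_fderiv_apply_const hY]
    rfl
  rw [key, key, fderiv_fderiv_symm hX h k, fderiv_fderiv_symm hY h k, curv]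
  simp only [map_add]
  abel

/-- The transformation law of the Christoffel symbols under an isometry. -/
lemma chart_change (H : CoordGeom A gl Ch) (H' : CoordGeom A' gl' Ch') {ψ : E → E} {y : E}
    (hy : y ∈ A) (hy' : ψ y ∈ A') (hψ : ContDiffAt ℝ ∞ ψ y)
    (hsurj : Function.Surjective (fderiv ℝ ψ y))
    (hiso : ∀ᶠ z in nhds y, ∀ u v, gl z u v = gl' (ψ z) (fderiv ℝ ψ z u) (fderiv ℝ ψ z v))
    (u v : E) :
    fderiv ℝ (fderiv ℝ ψ) y u v + Ch' (ψ y) (fderiv ℝ ψ y u) (fderiv ℝ ψ y v) =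
      fderiv ℝ ψ y (Ch y u v) := by
  -- `Q` is the defect of the transformation law. The argument is that for uniqueness of the
  -- Levi-Civita connection: symmetry of `Q` expresses zero torsion, and differentiating the
  -- isometry condition makes ⟨Q(w,u), ψ'v⟩ skew in `u`, `v`.
  set Q : E → E → E := fun u v ↦ fderiv ℝ (fderiv ℝ ψ) y u v +
    Ch' (ψ y) (fderiv ℝ ψ y u) (fderiv ℝ ψ y v) - fderiv ℝ ψ y (Ch y u v) with hQ
  have hQsymm : ∀ u v, Q u v = Q v u := by
    intro u v
    simp only [hQ]
    rw [fderiv_fderiv_symm hψ, H'.symm_Ch _ hy', H.symm_Ch _ hy]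
  have hψd := hψ.differentiableAt (by simp)
  have hskew : ∀ w u v, gl' (ψ y) (Q w u) (fderiv ℝ ψ y v) =
      -gl' (ψ y) (Q w v) (fderiv ℝ ψ y u) := by
    intro w u v
    have h1 : fderiv ℝ (fun z ↦ gl z u v) y w = fderiv ℝ gl y w u v := by
      have := fderiv_bilin_comp (B := gl) (Y := fun z : E ↦ z) (a := fun _ ↦ u) (b := fun _ ↦ v)
        (p := y) (H.differentiableAt_gl hy) differentiableAt_id (differentiableAt_const u)
        (differentiableAt_const v) w
      simpa using this
    have h2 : fderiv ℝ (fun z ↦ gl z u v) y w =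
        fderiv ℝ (fun z ↦ gl' (ψ z) (fderiv ℝ ψ z u) (fderiv ℝ ψ z v)) y w := by
      rw [Filter.EventuallyEq.fderiv_eq (hiso.mono fun z hz ↦ hz u v)]
    rw [H'.fderiv_gl_comp hy' hψd ((contDiffAt_fderiv_apply_const hψ u).differentiableAt (by simp))
      ((contDiffAt_fderiv_apply_const hψ v).differentiableAt (by simp)), h1, H.compat _ hy,
      hiso.self_of_nhds, hiso.self_of_nhds, covD, covD, fderiv_fderiv_apply_const hψ,
      fderiv_fderiv_apply_const hψ] at h2
    rw [H'.symm_gl _ hy' (Q w v)]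
    simp only [hQ, map_sub, sub_apply]
    linarith
  -- A trilinear form symmetric in its first two and skew in its last two arguments vanishes.
  have hzero : ∀ w u v, gl' (ψ y) (Q w u) (fderiv ℝ ψ y v) = 0 := by
    intro w u v
    have e1 := hskew w u v
    have e2 := hskew v w u
    have e3 := hskew u v w
    rw [hQsymm w v] at e1
    rw [hQsymm v u] at e2
    rw [hQsymm u w] at e3
    linarith
  have : Q u v = 0 := by
    refine H'.nondeg _ hy' _ fun w ↦ ?_
    obtain ⟨w', rfl⟩ := hsurj w
    exact hzero u v w'
  exact sub_eq_zero.1 this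

lemma fderiv_pushforward {ψ : E → E} {Y X : P → E} {p : P} (hψ : ContDiffAt ℝ ∞ ψ (Y p))
    (hY : DifferentiableAt ℝ Y p) (hX : DifferentiableAt ℝ X p) (h : P) :
    fderiv ℝ (fun q ↦ fderiv ℝ ψ (Y q) (X q)) p h =
      fderiv ℝ (fderiv ℝ ψ) (Y p) (fderiv ℝ Y p h) (X p) + fderiv ℝ ψ (Y p) (fderiv ℝ X p h) := by
  have h1 : DifferentiableAt ℝ (fderiv ℝ ψ) (Y p) :=
    (hψ.fderiv_right (m := ∞) (by simp)).differentiableAt (by simp)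
  have h2 : HasFDerivAt (fun q ↦ fderiv ℝ ψ (Y q))
      ((fderiv ℝ (fderiv ℝ ψ) (Y p)).comp (fderiv ℝ Y p)) p :=
    HasFDerivAt.comp p (g := fderiv ℝ ψ) (f := Y) h1.hasFDerivAt hY.hasFDerivAt
  rw [(h2.clm_apply hX.hasFDerivAt).fderiv]
  simp [add_comm]

/-- The covariant derivative is invariant under isometries. -/
lemma covD_chart_change (H : CoordGeom A gl Ch) (H' : CoordGeom A' gl' Ch') {ψ : E → E}
    {Y X : P → E} {p : P}
    (hy : Y p ∈ A) (hy' : ψ (Y p) ∈ A') (hψ : ContDiffAt ℝ ∞ ψ (Y p))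
    (hsurj : Function.Surjective (fderiv ℝ ψ (Y p)))
    (hiso : ∀ᶠ z in nhds (Y p), ∀ u v,
      gl z u v = gl' (ψ z) (fderiv ℝ ψ z u) (fderiv ℝ ψ z v))
    (hY : DifferentiableAt ℝ Y p) (hX : DifferentiableAt ℝ X p) (h : P) :
    covD Ch' (fun q ↦ ψ (Y q)) (fun q ↦ fderiv ℝ ψ (Y q) (X q)) h p =
      fderiv ℝ ψ (Y p) (covD Ch Y X h p) := by
  have h1 : fderiv ℝ (fun q ↦ ψ (Y q)) p h = fderiv ℝ ψ (Y p) (fderiv ℝ Y p h) := by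
    have : HasFDerivAt (fun q ↦ ψ (Y q)) ((fderiv ℝ ψ (Y p)).comp (fderiv ℝ Y p)) p :=
      HasFDerivAt.comp p (g := ψ) (f := Y) (hψ.differentiableAt (by simp)).hasFDerivAt
        hY.hasFDerivAt
    rw [this.fderiv]
    rfl
  rw [covD, covD, h1, fderiv_pushforward hψ hY hX, map_add,
    ← H.chart_change H' hy hy' hψ hsurj hiso]
  abel

/-! ### Symmetries of the curvature -/

lemma curv_antisymm (y u v w : E) : curv Ch y u v w = -curv Ch y v u w := by
  simp only [curv]; abel

/-- Symmetry of `Ch` holds on an open set, hence passes to its derivative; then all terms cancel in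
pairs. -/
lemma curv_bianchi (H : CoordGeom A gl Ch) {y : E} (hy : y ∈ A) (u v w : E) :
    curv Ch y u v w + curv Ch y v w u + curv Ch y w u v = 0 := by
  have hd : ∀ a b c, fderiv ℝ Ch y a b c = fderiv ℝ Ch y a c b := by
    intro a b c
    have hCd := H.differentiableAt_Ch hy
    have e (b c : E) : fderiv ℝ (fun z ↦ Ch z b c) y a = fderiv ℝ Ch y a b c := by
      have := fderiv_bilin_comp (B := Ch) (Y := fun z : E ↦ z) (a := fun _ ↦ b) (b := fun _ ↦ c)
        (p := y) hCd differentiableAt_id (differentiableAt_const b) (differentiableAt_const c) a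
      simpa using this
    rw [← e, ← e]
    have : (fun z ↦ Ch z b c) =ᶠ[nhds y] fun z ↦ Ch z c b :=
      (H.isOpen.eventually_mem hy).mono fun z hz ↦ H.symm_Ch z hz b c
    rw [this.fderiv_eq]
  simp only [curv]
  rw [hd u v w, hd v w u, hd w u v, H.symm_Ch y hy v w, H.symm_Ch y hy u w, H.symm_Ch y hy v u]
  abel

/-- The function x ↦ ⟨w, z⟩ₓ with `w`, `z` constant has a symmetric second derivative. Computing it
by metric compatibility applied twice, antisymmetrization in `u`, `v` leaves exactly the two
curvature terms. -/
lemma gl_curv_antisymm (H : CoordGeom A gl Ch) {y : E} (hy : y ∈ A) (u v w z : E) :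
    gl y (curv Ch y u v w) z = -gl y (curv Ch y u v z) w := by
  have hCd := H.differentiableAt_Ch hy
  have hgd := H.differentiableAt_gl hy
  set f : E → ℝ := fun x ↦ gl x w z with hf
  have hfs : ContDiffAt ℝ ∞ f y :=
    ((H.contDiffAt_gl hy).clm_apply contDiffAt_const).clm_apply contDiffAt_const
  have hfd : ∀ x ∈ A, ∀ u, fderiv ℝ f x u = gl x (Ch x u w) z + gl x w (Ch x u z) := by
    intro x hx u
    have := fderiv_bilin_comp (B := gl) (Y := fun z : E ↦ z) (a := fun _ ↦ w) (b := fun _ ↦ z)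
      (p := x) (H.differentiableAt_gl hx) differentiableAt_id (differentiableAt_const w)
      (differentiableAt_const z) u
    rw [← H.compat x hx]
    simpa using this
  have key : ∀ u v, fderiv ℝ (fderiv ℝ f) y v u =
      (gl y (Ch y v (Ch y u w)) z + gl y (Ch y u w) (Ch y v z) +
        gl y (fderiv ℝ Ch y v u w) z) +
      (gl y (Ch y v w) (Ch y u z) + gl y w (Ch y v (Ch y u z)) +
        gl y w (fderiv ℝ Ch y v u z)) := by
    intro u v
    have eC (b c : E) : fderiv ℝ (fun x ↦ Ch x b c) y v = fderiv ℝ Ch y v b c := by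
      have := fderiv_bilin_comp (B := Ch) (Y := fun z : E ↦ z) (a := fun _ ↦ b) (b := fun _ ↦ c)
        (p := y) hCd differentiableAt_id (differentiableAt_const b) (differentiableAt_const c) v
      simpa using this
    have dC (b c : E) : DifferentiableAt ℝ (fun x ↦ Ch x b c) y :=
      (hCd.clm_apply (differentiableAt_const b)).clm_apply (differentiableAt_const c)
    have e2 : (fun x ↦ fderiv ℝ f x u) =ᶠ[nhds y]
        fun x ↦ gl x (Ch x u w) z + gl x w (Ch x u z) :=
      (H.isOpen.eventually_mem hy).mono fun x hx ↦ hfd x hx u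
    have f1 := fderiv_bilin_comp (B := gl) (Y := fun x : E ↦ x) (a := fun x ↦ Ch x u w)
      (b := fun _ ↦ z) (p := y) hgd differentiableAt_id (dC u w) (differentiableAt_const z) v
    have f2 := fderiv_bilin_comp (B := gl) (Y := fun x : E ↦ x) (a := fun _ ↦ w)
      (b := fun x ↦ Ch x u z) (p := y) hgd differentiableAt_id (differentiableAt_const w) (dC u z) v
    have g1 := differentiableAt_bilin_comp (B := gl) (Y := fun x : E ↦ x) (a := fun x ↦ Ch x u w)
      (b := fun _ ↦ z) (p := y) hgd differentiableAt_id (dC u w) (differentiableAt_const z)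
    have g2 := differentiableAt_bilin_comp (B := gl) (Y := fun x : E ↦ x) (a := fun _ ↦ w)
      (b := fun x ↦ Ch x u z) (p := y) hgd differentiableAt_id (differentiableAt_const w) (dC u z)
    rw [← fderiv_fderiv_apply_const hfs, e2.fderiv_eq, fderiv_fun_add g1 g2, add_apply, f1, f2,
      eC, eC]
    simp only [fderiv_fun_id, ContinuousLinearMap.id_apply, fderiv_fun_const, Pi.zero_apply,
      zero_apply, map_zero, add_zero]
    rw [H.compat y hy, H.compat y hy]
  have h1 := key u v
  have h2 := key v u
  rw [fderiv_fderiv_symm hfs] at h2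
  rw [H.symm_gl y hy _ w]
  simp only [curv, map_add, map_neg, add_apply, neg_apply]
  linarith

/-- The classical octahedron argument: four Bianchi identities combined with skewness in the first
and in the last pair. -/
lemma gl_curv_pair_symm (H : CoordGeom A gl Ch) {y : E} (hy : y ∈ A) (u v w z : E) :
    gl y (curv Ch y u v w) z = gl y (curv Ch y w z u) v := by
  have b (u v w z : E) : gl y (curv Ch y u v w) z + gl y (curv Ch y v w u) z +
      gl y (curv Ch y w u v) z = 0 := by
    rw [← add_apply, ← add_apply, ← map_add, ← map_add,
      H.curv_bianchi hy]
    simp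
  have s (u v w z : E) : gl y (curv Ch y u v w) z = -gl y (curv Ch y v u w) z := by
    rw [curv_antisymm, map_neg, neg_apply]
  have t (u v w z : E) := H.gl_curv_antisymm hy u v w z
  linarith [b u v w z, b v w z u, b w z u v, b z u v w, s u v w z, t u v w z, s v w u z,
    t v w u z, s w u v z, t w u v z, s v w z u, t v w z u, s w z v u, t w z v u, s z v w u,
    t z v w u, s w z u v, t w z u v, s z u w v, t z u w v, s u w z v, t u w z v, s z u v w,
    t z u v w, s u v z w, t u v z w, s v z u w, t v z u w]

end CoordGeom

end CoordinateGeometry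

/-! ### The metric in the charts of the manifold -/

section Charts

variable {M : Type*} [TopologicalSpace M] [ChartedSpace E4 M] [IsManifold 𝓘(ℝ, E4) ∞ M]

local notation "φ[" x "]" => extChartAt 𝓘(ℝ, E4) x

lemma isManifold_one : IsManifold 𝓘(ℝ, E4) 1 M :=
  IsManifold.of_le (n := ∞) (by simp)

lemma toCoord_ofCoord {x₀ : M} {y : E4} (hy : y ∈ (φ[x₀]).target) (v : E4) :
    toCoord x₀ ((φ[x₀]).symm y) (ofCoord x₀ y v) = v := by
  have := isManifold_one (M := M)
  have h := mfderiv_extChartAt_comp_mfderivWithin_extChartAt_symm (I := 𝓘(ℝ, E4)) (x := x₀) hy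
  rw [modelWithCornersSelf_coe, Set.range_id, mfderivWithin_univ] at h
  exact DFunLike.congr_fun h v

lemma ofCoord_toCoord {x₀ : M} {y : E4} (hy : y ∈ (φ[x₀]).target)
    (v : Tan M ((φ[x₀]).symm y)) :
    ofCoord x₀ y (toCoord x₀ ((φ[x₀]).symm y) v) = v := by
  have := isManifold_one (M := M)
  have h := mfderivWithin_extChartAt_symm_comp_mfderiv_extChartAt (I := 𝓘(ℝ, E4)) (x := x₀) hy
  rw [modelWithCornersSelf_coe, Set.range_id, mfderivWithin_univ] at h
  exact DFunLike.congr_fun h v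

/-- A vector at `x` with given components in the chart around `x₀`. -/
lemma exists_toCoord_eq {x₀ x : M} (hx : x ∈ (φ[x₀]).source) (v : E4) :
    ∃ w : Tan M x, toCoord x₀ x w = v := by
  obtain ⟨y, hy, rfl⟩ : ∃ y ∈ (φ[x₀]).target, (φ[x₀]).symm y = x :=
    ⟨φ[x₀] x, (φ[x₀]).map_source hx, (φ[x₀]).left_inv hx⟩
  exact ⟨ofCoord x₀ y v, toCoord_ofCoord hy v⟩

lemma toCoord_injective {x₀ x : M} (hx : x ∈ (φ[x₀]).source) :
    Function.Injective (toCoord x₀ x) := by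
  obtain ⟨y, hy, rfl⟩ : ∃ y ∈ (φ[x₀]).target, (φ[x₀]).symm y = x :=
    ⟨φ[x₀] x, (φ[x₀]).map_source hx, (φ[x₀]).left_inv hx⟩
  intro v w h
  rw [← ofCoord_toCoord hy v, ← ofCoord_toCoord hy w, h]

lemma toCoord_ofCoordAt (x : M) (v : E4) : toCoord x x (ofCoordAt x v) = v := by
  -- `ContinuousLinearMap.inverse` has the default value 0 on non-invertible maps, so the
  -- differential of the chart at its centre has to be exhibited as a continuous linear equivalence.
  let e : Tan M x ≃L[ℝ] E4 :=
    { LinearEquiv.ofBijective (toCoord x x : Tan M x →ₗ[ℝ] E4)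
        ⟨toCoord_injective (mem_extChartAt_source x),
          fun v ↦ exists_toCoord_eq (mem_extChartAt_source x) v⟩ with
      continuous_toFun := (toCoord x x).continuous
      continuous_invFun := by
        let l : E4 →ₗ[ℝ] E4 := (LinearEquiv.ofBijective (toCoord x x : Tan M x →ₗ[ℝ] E4)
          ⟨toCoord_injective (mem_extChartAt_source x),
            fun v ↦ exists_toCoord_eq (mem_extChartAt_source x) v⟩).symm.toLinearMap
        exact l.continuous_of_finiteDimensional }
  have he : (e : Tan M x →L[ℝ] E4) = toCoord x x := by
    ext v; rfl
  rw [ofCoordAt, ← he, ContinuousLinearMap.inverse_equiv]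
  exact e.apply_symm_apply v

variable {P : Type*} [NormedAddCommGroup P] [NormedSpace ℝ P]

/-- Smoothness of a map into the tangent bundle, in terms of a chart of `M`. -/
lemma contMDiffAt_tangentBundle_iff {f : P → TangentBundle 𝓘(ℝ, E4) M} {p : P} {x₀ : M}
    (h : (f p).1 ∈ (φ[x₀]).source) :
    ContMDiffAt 𝓘(ℝ, P) 𝓘(ℝ, E4).tangent ∞ f p ↔
      ContMDiffAt 𝓘(ℝ, P) 𝓘(ℝ, E4) ∞ (fun q ↦ (f q).1) p ∧
        ContDiffAt ℝ ∞ (fun q ↦ toCoord x₀ (f q).1 (f q).2) p := by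
  have := isManifold_one (M := M)
  rw [extChartAt_source] at h
  rw [Bundle.Trivialization.contMDiffAt_iff (F := E4)
    (e := trivializationAt E4 (TangentSpace 𝓘(ℝ, E4)) x₀) h, ← contMDiffAt_iff_contDiffAt]
  refine and_congr_right fun hb ↦ ?_
  have hev : (fun q ↦ (trivializationAt E4 (TangentSpace 𝓘(ℝ, E4)) x₀ (f q)).2) =ᶠ[nhds p]
      fun q ↦ toCoord x₀ (f q).1 (f q).2 := by
    filter_upwards [hb.continuousAt.eventually_mem
      ((chartAt E4 x₀).open_source.mem_nhds h)] with q hq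
    have h1 := mfderiv_chartAt_eq_tangentCoordChange (I := 𝓘(ℝ, E4)) hq
    exact (DFunLike.congr_fun h1 (f q).2).symm
  exact ⟨fun H ↦ H.congr_of_eventuallyEq hev.symm, fun H ↦ H.congr_of_eventuallyEq hev⟩

lemma contMDiffAt_base_iff {f : P → M} {p : P} {x₀ : M} (hc : ContinuousAt f p)
    (h : f p ∈ (φ[x₀]).source) :
    ContMDiffAt 𝓘(ℝ, P) 𝓘(ℝ, E4) ∞ f p ↔ ContDiffAt ℝ ∞ (fun q ↦ φ[x₀] (f q)) p := by
  rw [← contMDiffAt_iff_contDiffAt]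
  rw [extChartAt_source] at h
  constructor
  · intro H
    exact ContMDiffAt.comp p (contMDiffAt_extChartAt' h) H
  · intro H
    have h1 : φ[x₀] (f p) ∈ (φ[x₀]).target := (φ[x₀]).map_source (by rwa [extChartAt_source])
    have h2 : ContMDiffAt 𝓘(ℝ, E4) 𝓘(ℝ, E4) ∞ (φ[x₀]).symm (φ[x₀] (f p)) :=
      (contMDiffOn_extChartAt_symm x₀ _ h1).contMDiffAt ((isOpen_extChartAt_target x₀).mem_nhds h1)
    have h3 := ContMDiffAt.comp p h2 H
    refine h3.congr_of_eventuallyEq ?_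
    filter_upwards [hc.eventually_mem ((chartAt E4 x₀).open_source.mem_nhds h)] with q hq
    exact ((φ[x₀]).left_inv (by rwa [extChartAt_source])).symm

/-- The velocity in a chart. -/
lemma toCoord_mfderiv {f : P → M} {p : P} {x₀ : M}
    (h : f p ∈ (φ[x₀]).source) (hf : MDifferentiableAt 𝓘(ℝ, P) 𝓘(ℝ, E4) f p) (v : P) :
    toCoord x₀ (f p) (mfderiv 𝓘(ℝ, P) 𝓘(ℝ, E4) f p v) =
      fderiv ℝ (fun q ↦ φ[x₀] (f q)) p v := by
  rw [extChartAt_source] at h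
  have h1 : MDifferentiableAt 𝓘(ℝ, E4) 𝓘(ℝ, E4) (φ[x₀]) (f p) :=
    (contMDiffAt_extChartAt' (n := ∞) h).mdifferentiableAt (by simp)
  rw [← mfderiv_eq_fderiv]
  exact (DFunLike.congr_fun (mfderiv_comp p h1 hf) v).symm

lemma toCoord_velocity {γ : ℝ → M} {s : ℝ} {x₀ : M}
    (h : γ s ∈ (φ[x₀]).source) (hf : MDifferentiableAt 𝓘(ℝ, ℝ) 𝓘(ℝ, E4) γ s) :
    toCoord x₀ (γ s) (velocity γ s) = deriv (fun τ ↦ φ[x₀] (γ τ)) s :=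
  toCoord_mfderiv h hf (1 : ℝ)

/-- The change of charts. -/
def trans (x₀ x₁ : M) (y : E4) : E4 := φ[x₁] ((φ[x₀]).symm y)

lemma trans_apply {x₀ x₁ x : M} (h : x ∈ (φ[x₀]).source) : trans x₀ x₁ (φ[x₀] x) = φ[x₁] x := by
  rw [trans, (φ[x₀]).left_inv h]

lemma contDiffAt_trans {x₀ x₁ : M} {y : E4} (hy : y ∈ (φ[x₀]).target)
    (hy' : (φ[x₀]).symm y ∈ (φ[x₁]).source) : ContDiffAt ℝ ∞ (trans x₀ x₁) y := by
  rw [← contMDiffAt_iff_contDiffAt]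
  rw [extChartAt_source] at hy'
  exact ContMDiffAt.comp y (contMDiffAt_extChartAt' hy')
    ((contMDiffOn_extChartAt_symm x₀ _ hy).contMDiffAt ((isOpen_extChartAt_target x₀).mem_nhds hy))

lemma fderiv_trans {x₀ x₁ : M} {y : E4} (hy : y ∈ (φ[x₀]).target)
    (hy' : (φ[x₀]).symm y ∈ (φ[x₁]).source) (v : E4) :
    fderiv ℝ (trans x₀ x₁) y v = toCoord x₁ ((φ[x₀]).symm y) (ofCoord x₀ y v) := by
  have h2 : MDifferentiableAt 𝓘(ℝ, E4) 𝓘(ℝ, E4) (φ[x₀]).symm y :=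
    ((contMDiffOn_extChartAt_symm (n := ∞) x₀ _ hy).contMDiffAt
      ((isOpen_extChartAt_target x₀).mem_nhds hy)).mdifferentiableAt (by simp)
  exact (toCoord_mfderiv hy' h2 v).symm

lemma fderiv_trans_toCoord {x₀ x₁ x : M} (h : x ∈ (φ[x₀]).source) (h' : x ∈ (φ[x₁]).source)
    (v : Tan M x) : fderiv ℝ (trans x₀ x₁) (φ[x₀] x) (toCoord x₀ x v) = toCoord x₁ x v := by
  obtain ⟨y, hy, rfl⟩ : ∃ y ∈ (φ[x₀]).target, (φ[x₀]).symm y = x :=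
    ⟨φ[x₀] x, (φ[x₀]).map_source h, (φ[x₀]).left_inv h⟩
  rw [(φ[x₀]).right_inv hy, fderiv_trans hy h', ofCoord_toCoord hy]

lemma surjective_fderiv_trans {x₀ x₁ x : M} (h : x ∈ (φ[x₀]).source) (h' : x ∈ (φ[x₁]).source) :
    Function.Surjective (fderiv ℝ (trans x₀ x₁) (φ[x₀] x)) := by
  intro v
  obtain ⟨w, rfl⟩ := exists_toCoord_eq h' v
  exact ⟨toCoord x₀ x w, fderiv_trans_toCoord h h' w⟩

/-- The `i`-th coordinate. -/
def coordProj (i : Fin 4) : E4 →L[ℝ] ℝ := EuclideanSpace.proj i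

@[simp] lemma coordProj_apply (i : Fin 4) (v : E4) : coordProj i v = v i := rfl

namespace SemiRiemannianMetric

variable {q : ℕ} (g : SemiRiemannianMetric M q)

/-- The metric in a chart, as a field of bilinear forms. -/
def coordMetric (x₀ : M) (y : E4) : E4 →L[ℝ] E4 →L[ℝ] ℝ :=
  ∑ i, ∑ j, g.gram x₀ y i j •
    (coordProj i).smulRight
      (coordProj j)

/-- The Christoffel symbols in a chart, as a field of bilinear maps. -/
def coordChristoffel (x₀ : M) (y : E4) : E4 →L[ℝ] E4 →L[ℝ] E4 :=
  ∑ i, ∑ j, (coordProj i).smulRight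
      ((coordProj j).smulRight
        (WithLp.toLp 2 fun k ↦ g.christoffel x₀ y k i j : E4))

lemma coordMetric_apply (x₀ : M) (y u v : E4) :
    g.coordMetric x₀ y u v = ∑ i, ∑ j, g.gram x₀ y i j * (u i * v j) := by
  simp [coordMetric]

lemma coordChristoffel_apply (x₀ : M) (y u v : E4) :
    g.coordChristoffel x₀ y u v = g.christoffelVec x₀ y u v := by
  ext k
  simp only [coordChristoffel, christoffelVec, sum_apply,
    ContinuousLinearMap.smulRight_apply, coordProj_apply, smul_apply, WithLp.ofLp_sum,
    WithLp.ofLp_smul, Finset.sum_apply, Pi.smul_apply, smul_eq_mul]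
  refine Finset.sum_congr rfl fun i _ ↦ Finset.sum_congr rfl fun j _ ↦ ?_
  ring

lemma sum_smul_stdVec (u : E4) : u = ∑ i, u i • stdVec i := by
  ext k
  simp [stdVec, Finset.sum_apply, Pi.single_apply]

lemma inner_ofCoord (x₀ : M) (y u v : E4) :
    g.inner ((φ[x₀]).symm y) (ofCoord x₀ y u) (ofCoord x₀ y v) = g.coordMetric x₀ y u v := by
  rw [coordMetric_apply]
  conv_lhs => rw [sum_smul_stdVec u, sum_smul_stdVec v]
  simp only [map_sum, map_smul, sum_apply, smul_apply, smul_eq_mul, gram, Matrix.of_apply]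
  rw [Finset.sum_comm]
  refine Finset.sum_congr rfl fun i _ ↦ ?_
  rw [Finset.mul_sum]
  refine Finset.sum_congr rfl fun j _ ↦ ?_
  ring

lemma inner_eq_coordMetric {x₀ x : M} (h : x ∈ (φ[x₀]).source) (v w : Tan M x) :
    g.inner x v w = g.coordMetric x₀ (φ[x₀] x) (toCoord x₀ x v) (toCoord x₀ x w) := by
  obtain ⟨y, hy, rfl⟩ : ∃ y ∈ (φ[x₀]).target, (φ[x₀]).symm y = x :=
    ⟨φ[x₀] x, (φ[x₀]).map_source h, (φ[x₀]).left_inv h⟩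
  rw [(φ[x₀]).right_inv hy, ← g.inner_ofCoord, ofCoord_toCoord hy, ofCoord_toCoord hy]

lemma contMDiffAt_ofCoord {x₀ : M} {y : E4} (hy : y ∈ (φ[x₀]).target) (v : E4) :
    ContMDiffAt 𝓘(ℝ, E4) 𝓘(ℝ, E4).tangent ∞
      (fun z ↦ (⟨(φ[x₀]).symm z, ofCoord x₀ z v⟩ : TangentBundle 𝓘(ℝ, E4) M)) y := by
  rw [contMDiffAt_tangentBundle_iff (x₀ := x₀) ((φ[x₀]).map_target hy)]
  refine ⟨(contMDiffOn_extChartAt_symm x₀ _ hy).contMDiffAt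
    ((isOpen_extChartAt_target x₀).mem_nhds hy), ?_⟩
  refine (contDiffAt_const (c := v)).congr_of_eventuallyEq ?_
  filter_upwards [(isOpen_extChartAt_target x₀).mem_nhds hy] with z hz
  exact toCoord_ofCoord hz v

lemma contDiffAt_gram {x₀ : M} {y : E4} (hy : y ∈ (φ[x₀]).target) (i j : Fin 4) :
    ContDiffAt ℝ ∞ (fun z ↦ g.gram x₀ z i j) y := by
  rw [← contMDiffAt_iff_contDiffAt]
  have : ContMDiffAt 𝓘(ℝ, E4) (𝓘(ℝ, E4).prod 𝓘(ℝ, ℝ)) ∞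
      (fun z ↦ Bundle.TotalSpace.mk' ℝ (E := Bundle.Trivial M ℝ) ((φ[x₀]).symm z)
        (g.inner ((φ[x₀]).symm z) (ofCoord x₀ z (stdVec i)) (ofCoord x₀ z (stdVec j)))) y := by
    apply ContMDiffAt.clm_bundle_apply₂ (F₁ := E4) (F₂ := E4)
    · exact ContMDiffAt.comp y g.contMDiff.contMDiffAt
        ((contMDiffOn_extChartAt_symm x₀ _ hy).contMDiffAt
          ((isOpen_extChartAt_target x₀).mem_nhds hy))
    · exact contMDiffAt_ofCoord hy _
    · exact contMDiffAt_ofCoord hy _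
  rw [Bundle.contMDiffAt_totalSpace] at this
  exact this.2

end SemiRiemannianMetric

end Charts

/-! ### Smoothness of determinants and inverse matrices -/

lemma contDiffAt_det {E : Type*} [NormedAddCommGroup E] [NormedSpace ℝ E] {n : Type*} [Fintype n]
    [DecidableEq n] {A : E → Matrix n n ℝ} {y : E}
    (h : ∀ i j, ContDiffAt ℝ ∞ (fun z ↦ A z i j) y) : ContDiffAt ℝ ∞ (fun z ↦ (A z).det) y := by
  simp only [Matrix.det_apply]
  refine ContDiffAt.sum fun σ _ ↦ ContDiffAt.const_smul _ ?_
  exact contDiffAt_prod fun i _ ↦ h _ _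

/-- By Cramer's rule the entries are quotients of determinants. -/
lemma contDiffAt_matrix_inv {E : Type*} [NormedAddCommGroup E] [NormedSpace ℝ E] {n : Type*}
    [Fintype n] [DecidableEq n] {A : E → Matrix n n ℝ} {y : E}
    (h : ∀ i j, ContDiffAt ℝ ∞ (fun z ↦ A z i j) y) (hd : (A y).det ≠ 0) (i j : n) :
    ContDiffAt ℝ ∞ (fun z ↦ (A z)⁻¹ i j) y := by
  simp only [Matrix.inv_def, Ring.inverse_eq_inv', Matrix.smul_apply, smul_eq_mul,
    Matrix.adjugate_apply]
  refine ((contDiffAt_det h).inv hd).mul (contDiffAt_det fun k l ↦ ?_)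
  by_cases hk : k = j
  · subst hk
    simp only [Matrix.updateRow_self]
    exact contDiffAt_const
  · simp only [Matrix.updateRow_ne hk]
    exact h k l

/-! ### Christoffel symbols in a chart -/

section Charts

variable {M : Type*} [TopologicalSpace M] [ChartedSpace E4 M] [IsManifold 𝓘(ℝ, E4) ∞ M]

local notation "φ[" x "]" => extChartAt 𝓘(ℝ, E4) x

namespace SemiRiemannianMetric

variable {q : ℕ} (g : SemiRiemannianMetric M q)

lemma gram_symm (x₀ : M) (y : E4) (i j : Fin 4) : g.gram x₀ y i j = g.gram x₀ y j i := by
  simp only [gram, Matrix.of_apply]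
  exact g.symm _ _ _

lemma inner_nondegenerate (x : M) (v : Tan M x) (h : ∀ w, g.inner x v w = 0) : v = 0 := by
  obtain ⟨b, hb⟩ := g.index x
  rw [← b.sum_repr v]
  refine Finset.sum_eq_zero fun i _ ↦ ?_
  have h1 := h (b i)
  rw [← b.sum_repr v] at h1
  simp only [map_sum, map_smul, sum_apply, smul_apply, hb, smul_eq_mul, mul_ite, mul_zero,
    Finset.sum_ite_eq', Finset.mem_univ, if_true] at h1
  have : b.repr v i = 0 := by
    split_ifs at h1 <;> simpa using h1
  rw [this, zero_smul]

lemma coordMetric_nondegenerate {x₀ : M} {y : E4} (hy : y ∈ (φ[x₀]).target) (u : E4)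
    (h : ∀ v, g.coordMetric x₀ y u v = 0) : u = 0 := by
  have h1 : ofCoord x₀ y u = 0 := by
    refine g.inner_nondegenerate _ _ fun w ↦ ?_
    rw [← ofCoord_toCoord hy w, g.inner_ofCoord]
    exact h _
  rw [← toCoord_ofCoord hy u, h1, map_zero]

lemma det_gram_ne_zero {x₀ : M} {y : E4} (hy : y ∈ (φ[x₀]).target) : (g.gram x₀ y).det ≠ 0 := by
  intro hdet
  obtain ⟨v, hv, hv0⟩ := Matrix.exists_mulVec_eq_zero_iff.2 hdet
  have : (WithLp.toLp 2 v : E4) = 0 := by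
    refine g.coordMetric_nondegenerate hy _ fun w ↦ ?_
    rw [coordMetric_apply, Finset.sum_comm]
    refine Finset.sum_eq_zero fun j _ ↦ ?_
    have := congrFun hv0 j
    simp only [Matrix.mulVec, dotProduct, Pi.zero_apply] at this
    calc _ = (∑ i, g.gram x₀ y j i * v i) * w j := by
          rw [Finset.sum_mul]
          refine Finset.sum_congr rfl fun i _ ↦ ?_
          rw [g.gram_symm x₀ y i j]; ring
      _ = 0 := by rw [this, zero_mul]
  apply hv
  ext i
  have := congrArg (fun e : E4 ↦ e i) this
  simpa using this

lemma contDiffAt_dGram {x₀ : M} {y : E4} (hy : y ∈ (φ[x₀]).target) (k i j : Fin 4) :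
    ContDiffAt ℝ ∞ (fun z ↦ g.dGram x₀ z k i j) y :=
  contDiffAt_fderiv_apply_const (g.contDiffAt_gram hy i j) _

lemma contDiffAt_christoffel {x₀ : M} {y : E4} (hy : y ∈ (φ[x₀]).target) (k i j : Fin 4) :
    ContDiffAt ℝ ∞ (fun z ↦ g.christoffel x₀ z k i j) y := by
  unfold christoffel
  refine contDiffAt_const.mul (ContDiffAt.sum fun l _ ↦ ?_)
  exact (contDiffAt_matrix_inv (g.contDiffAt_gram hy) (g.det_gram_ne_zero hy) k l).mul
    (((g.contDiffAt_dGram hy _ _ _).add (g.contDiffAt_dGram hy _ _ _)).sub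
      (g.contDiffAt_dGram hy _ _ _))

lemma contDiffAt_coordMetric {x₀ : M} {y : E4} (hy : y ∈ (φ[x₀]).target) :
    ContDiffAt ℝ ∞ (g.coordMetric x₀) y := by
  refine ContDiffOn.contDiffAt (s := (φ[x₀]).target) ?_ ((isOpen_extChartAt_target x₀).mem_nhds hy)
  rw [contDiffOn_clm_apply]
  intro u
  rw [contDiffOn_clm_apply]
  intro v z hz
  simp only [coordMetric_apply]
  exact (ContDiffAt.sum fun i _ ↦ ContDiffAt.sum fun j _ ↦
    (g.contDiffAt_gram hz i j).mul contDiffAt_const).contDiffWithinAt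

lemma contDiffAt_coordChristoffel {x₀ : M} {y : E4} (hy : y ∈ (φ[x₀]).target) :
    ContDiffAt ℝ ∞ (g.coordChristoffel x₀) y := by
  refine ContDiffOn.contDiffAt (s := (φ[x₀]).target) ?_ ((isOpen_extChartAt_target x₀).mem_nhds hy)
  rw [contDiffOn_clm_apply]
  intro u
  rw [contDiffOn_clm_apply]
  intro v z hz
  simp only [coordChristoffel_apply]
  refine ContDiffAt.contDiffWithinAt ?_
  rw [contDiffAt_piLp]
  intro k
  simp only [christoffelVec]
  exact ContDiffAt.sum fun i _ ↦ ContDiffAt.sum fun j _ ↦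
    ((g.contDiffAt_christoffel hz k i j).mul contDiffAt_const).mul contDiffAt_const

lemma dGram_symm (x₀ : M) (y : E4) (k i j : Fin 4) :
    g.dGram x₀ y k i j = g.dGram x₀ y k j i := by
  simp only [dGram, g.gram_symm x₀ _ i j]

lemma christoffel_symm (x₀ : M) (y : E4) (k i j : Fin 4) :
    g.christoffel x₀ y k i j = g.christoffel x₀ y k j i := by
  simp only [christoffel]
  congr 1
  refine Finset.sum_congr rfl fun l _ ↦ ?_
  rw [g.dGram_symm x₀ y l i j]
  ring

/-- Lowering the upper index cancels the inverse Gram matrix and leaves the Christoffel symbol of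
the first kind. -/
lemma sum_gram_mul_christoffel {x₀ : M} {y : E4} (hy : y ∈ (φ[x₀]).target) (i j m : Fin 4) :
    ∑ k, g.gram x₀ y k m * g.christoffel x₀ y k i j =
      (1 / 2) * (g.dGram x₀ y i j m + g.dGram x₀ y j i m - g.dGram x₀ y m i j) := by
  have hinv : g.gram x₀ y * (g.gram x₀ y)⁻¹ = 1 :=
    Matrix.mul_nonsing_inv _ (isUnit_iff_ne_zero.2 (g.det_gram_ne_zero hy))
  have h1 : ∀ l, ∑ k, g.gram x₀ y k m * (g.gram x₀ y)⁻¹ k l = if m = l then 1 else 0 := by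
    intro l
    rw [← Matrix.one_apply, ← hinv, Matrix.mul_apply]
    exact Finset.sum_congr rfl fun k _ ↦ by rw [g.gram_symm]
  calc _ = ∑ l, (∑ k, g.gram x₀ y k m * (g.gram x₀ y)⁻¹ k l) *
        ((1 / 2) * (g.dGram x₀ y i j l + g.dGram x₀ y j i l - g.dGram x₀ y l i j)) := by
        simp only [christoffel, Finset.mul_sum, Finset.sum_mul]
        rw [Finset.sum_comm]
        exact Finset.sum_congr rfl fun l _ ↦ Finset.sum_congr rfl fun k _ ↦ by ring
    _ = _ := by simp [h1]

lemma coordMetric_christoffel {x₀ : M} {y : E4} (hy : y ∈ (φ[x₀]).target) (u v w : E4) :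
    g.coordMetric x₀ y (g.coordChristoffel x₀ y u v) w = ∑ i, ∑ j, ∑ m, u i * v j * w m *
      ((1 / 2) * (g.dGram x₀ y i j m + g.dGram x₀ y j i m - g.dGram x₀ y m i j)) := by
  simp only [← g.sum_gram_mul_christoffel hy, coordMetric_apply, coordChristoffel_apply,
    christoffelVec, Finset.mul_sum, Finset.sum_mul]
  rw [Finset.sum_comm]
  calc _ = ∑ m, ∑ i, ∑ k, ∑ j, g.gram x₀ y k m *
        (g.christoffel x₀ y k i j * u i * v j * w m) :=
        Finset.sum_congr rfl fun m _ ↦ Finset.sum_comm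
    _ = ∑ i, ∑ m, ∑ k, ∑ j, g.gram x₀ y k m *
        (g.christoffel x₀ y k i j * u i * v j * w m) := Finset.sum_comm
    _ = ∑ i, ∑ m, ∑ j, ∑ k, g.gram x₀ y k m *
        (g.christoffel x₀ y k i j * u i * v j * w m) :=
        Finset.sum_congr rfl fun i _ ↦ Finset.sum_congr rfl fun m _ ↦ Finset.sum_comm
    _ = ∑ i, ∑ j, ∑ m, ∑ k, g.gram x₀ y k m *
        (g.christoffel x₀ y k i j * u i * v j * w m) :=
        Finset.sum_congr rfl fun i _ ↦ Finset.sum_comm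
    _ = _ := by
        refine Finset.sum_congr rfl fun i _ ↦ Finset.sum_congr rfl fun j _ ↦
          Finset.sum_congr rfl fun m _ ↦ Finset.sum_congr rfl fun k _ ↦ ?_
        ring

lemma fderiv_coordMetric {x₀ : M} {y : E4} (hy : y ∈ (φ[x₀]).target) (u v w : E4) :
    fderiv ℝ (g.coordMetric x₀) y u v w =
      ∑ i, ∑ j, ∑ m, u i * v j * w m * g.dGram x₀ y i j m := by
  have hd := (g.contDiffAt_coordMetric hy).differentiableAt (n := ∞) (by simp)
  have h1 := fderiv_bilin_comp (B := g.coordMetric x₀) (Y := fun z : E4 ↦ z) (a := fun _ ↦ v)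
    (b := fun _ ↦ w) (p := y) hd differentiableAt_id (differentiableAt_const v)
    (differentiableAt_const w) u
  simp only [fderiv_fun_id, ContinuousLinearMap.id_apply, fderiv_fun_const, Pi.zero_apply,
    zero_apply, map_zero, add_zero] at h1
  rw [← h1]
  simp only [coordMetric_apply]
  have h2 : HasFDerivAt (fun z ↦ ∑ j, ∑ m, g.gram x₀ z j m * (v j * w m))
      (∑ j, ∑ m, (v j * w m) • fderiv ℝ (fun z ↦ g.gram x₀ z j m) y) y :=
    HasFDerivAt.fun_sum fun j _ ↦ HasFDerivAt.fun_sum fun m _ ↦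
      (((g.contDiffAt_gram hy j m).differentiableAt (by simp)).hasFDerivAt.mul_const _)
  rw [h2.fderiv]
  simp only [sum_apply, smul_apply, smul_eq_mul]
  have h3 : ∀ j m, fderiv ℝ (fun z ↦ g.gram x₀ z j m) y u = ∑ i, u i * g.dGram x₀ y i j m := by
    intro j m
    conv_lhs => rw [sum_smul_stdVec u]
    simp only [map_sum, map_smul, smul_eq_mul, dGram]
  simp only [h3, Finset.mul_sum]
  calc _ = ∑ j, ∑ i, ∑ m, v j * w m * (u i * g.dGram x₀ y i j m) :=
        Finset.sum_congr rfl fun j _ ↦ Finset.sum_comm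
    _ = ∑ i, ∑ j, ∑ m, v j * w m * (u i * g.dGram x₀ y i j m) := Finset.sum_comm
    _ = _ := by
        refine Finset.sum_congr rfl fun i _ ↦ Finset.sum_congr rfl fun j _ ↦
          Finset.sum_congr rfl fun m _ ↦ ?_
        ring

/-- The metric and its Christoffel symbols in a chart. -/
theorem coordGeom (x₀ : M) :
    CoordGeom (φ[x₀]).target (g.coordMetric x₀) (g.coordChristoffel x₀) where
  isOpen := isOpen_extChartAt_target x₀
  smooth_gl _ hy := (g.contDiffAt_coordMetric hy).contDiffWithinAt
  smooth_Ch _ hy := (g.contDiffAt_coordChristoffel hy).contDiffWithinAt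
  symm_gl y _ u v := by
    rw [← g.inner_ofCoord, ← g.inner_ofCoord, g.symm]
  nondeg y hy u h := g.coordMetric_nondegenerate hy u h
  symm_Ch y _ u v := by
    rw [coordChristoffel_apply, coordChristoffel_apply]
    ext k
    simp only [christoffelVec]
    rw [Finset.sum_comm]
    refine Finset.sum_congr rfl fun i _ ↦ Finset.sum_congr rfl fun j _ ↦ ?_
    rw [g.christoffel_symm x₀ y k j i]
    ring
  compat y hy u v w := by
    have hs : g.coordMetric x₀ y v (g.coordChristoffel x₀ y u w) =
        g.coordMetric x₀ y (g.coordChristoffel x₀ y u w) v := by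
      rw [← g.inner_ofCoord, ← g.inner_ofCoord, g.symm]
    rw [g.fderiv_coordMetric hy, hs, g.coordMetric_christoffel hy, g.coordMetric_christoffel hy,
      ← Finset.sum_add_distrib]
    refine Finset.sum_congr rfl fun i _ ↦ ?_
    -- Once the last two indices of the second sum are exchanged, the two first-kind symbols add up
    -- to ∂ᵢ g_{jm}, the other derivatives cancelling in pairs.
    rw [Finset.sum_comm (f := fun j m ↦ u i * w j * v m *
      ((1 / 2) * (g.dGram x₀ y i j m + g.dGram x₀ y j i m - g.dGram x₀ y m i j))),
      ← Finset.sum_add_distrib]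
    refine Finset.sum_congr rfl fun j _ ↦ ?_
    rw [← Finset.sum_add_distrib]
    refine Finset.sum_congr rfl fun m _ ↦ ?_
    rw [g.dGram_symm x₀ y i m j]
    ring

end SemiRiemannianMetric

end Charts

/-! ### Constant sectional curvature determines the curvature tensor -/

section ConstantCurvature

variable {E : Type*} [NormedAddCommGroup E] [NormedSpace ℝ E] {A : Set E}
  {gl : E → E →L[ℝ] E →L[ℝ] ℝ} {Ch : E → E →L[ℝ] E →L[ℝ] E}

/-- Along (u + τu', v + τv') the Gram determinant is a quartic in τ whose leading coefficient is the
Gram determinant of (u', v'). One nondegenerate plane therefore makes nondegenerate planes dense on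
such a line. -/
lemma dense_quartic_ne_zero {c₀ c₁ c₂ c₃ c₄ : ℝ} (h : c₄ ≠ 0) :
    Dense {τ : ℝ | c₀ + c₁ * τ + c₂ * τ ^ 2 + c₃ * τ ^ 3 + c₄ * τ ^ 4 ≠ 0} := by
  let p : Polynomial ℝ := Polynomial.C c₀ + Polynomial.C c₁ * Polynomial.X +
    Polynomial.C c₂ * Polynomial.X ^ 2 + Polynomial.C c₃ * Polynomial.X ^ 3 +
    Polynomial.C c₄ * Polynomial.X ^ 4
  have hp : p ≠ 0 := by
    intro h0
    apply h
    have := congrArg (fun r : Polynomial ℝ ↦ r.coeff 4) h0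
    simpa [p, Polynomial.coeff_X, Polynomial.coeff_C] using this
  have hfin := Polynomial.finite_setOfPred_isRoot hp
  have := hfin.countable.dense_compl ℝ
  convert this using 1
  ext τ
  simp [p, Polynomial.IsRoot]

namespace CoordGeom

/-- A tensor field with the symmetries of the curvature tensor is determined by the sectional
curvature. -/
lemma curv_eq_of_sectional (H : CoordGeom A gl Ch) {y : E} (hy : y ∈ A) {G : ℝ}
    (hne : ∃ u v, gl y u u * gl y v v - gl y u v ^ 2 ≠ 0)
    (hG : ∀ u v, gl y u u * gl y v v - gl y u v ^ 2 ≠ 0 →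
      gl y (curv Ch y u v u) v = G * (gl y u u * gl y v v - gl y u v ^ 2)) (u v w : E) :
    curv Ch y u v w = G • (gl y u w • v - gl y v w • u) := by
  have hadd1 : ∀ u u' v w, curv Ch y (u + u') v w = curv Ch y u v w + curv Ch y u' v w := by
    intro u u' v w
    simp only [curv, map_add, add_apply]; abel
  have hadd2 : ∀ u v v' w, curv Ch y u (v + v') w = curv Ch y u v w + curv Ch y u v' w := by
    intro u v v' w
    simp only [curv, map_add, add_apply]; abel
  have hadd3 : ∀ u v w w', curv Ch y u v (w + w') = curv Ch y u v w + curv Ch y u v w' := by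
    intro u v w w'
    simp only [curv, map_add, add_apply]; abel
  have hsy := H.symm_gl y hy
  -- `D` is the difference from the model tensor of curvature `G`; it has all the algebraic
  -- symmetries of a curvature tensor.
  set D : E → E → E → E → ℝ := fun u v w z ↦
    gl y (curv Ch y u v w) z - G * (gl y u w * gl y v z - gl y v w * gl y u z) with hD
  have hQ : ∀ u v, D u v u v = 0 := by
    intro u v
    obtain ⟨u', v', hne⟩ := hne
    -- Sectional curvature is only known on nondegenerate planes, so a degenerate plane is
    -- approximated along a line and `D` vanishes there by continuity.
    have hdense := dense_quartic_ne_zero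
      (c₀ := gl y u u * gl y v v - gl y u v ^ 2)
      (c₁ := 2 * gl y u u' * gl y v v + 2 * gl y u u * gl y v v' -
        2 * gl y u v * (gl y u v' + gl y u' v))
      (c₂ := gl y u u * gl y v' v' + 4 * gl y u u' * gl y v v' + gl y u' u' * gl y v v -
        (gl y u v' + gl y u' v) ^ 2 - 2 * gl y u v * gl y u' v')
      (c₃ := 2 * gl y u u' * gl y v' v' + 2 * gl y u' u' * gl y v v' -
        2 * gl y u' v' * (gl y u v' + gl y u' v))
      (c₄ := gl y u' u' * gl y v' v' - gl y u' v' ^ 2) hne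
    have hcont : Continuous fun τ : ℝ ↦ D (u + τ • u') (v + τ • v') (u + τ • u') (v + τ • v') := by
      simp only [hD, curv]
      fun_prop
    have heq := Continuous.ext_on hdense hcont (continuous_const (y := (0 : ℝ))) ?_
    · simpa using congrFun heq 0
    intro τ hτ
    have h1 := hG (u + τ • u') (v + τ • v') (by
      intro h0
      apply hτ
      rw [← h0]
      simp only [map_add, map_smul, add_apply, smul_apply, smul_eq_mul]
      rw [hsy u' u, hsy v' v]
      ring)
    simp only [hD]
    rw [h1, hsy (v + τ • v') (u + τ • u')]
    ring
  have bia : ∀ u v w z, D u v w z + D v w u z + D w u v z = 0 := by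
    intro u v w z
    have hb := congrArg (fun x ↦ gl y x z) (H.curv_bianchi hy u v w)
    simp only [map_add, add_apply, map_zero, zero_apply] at hb
    simp only [hD]
    rw [hsy w u, hsy v u, hsy w v]
    linarith
  have s12 : ∀ u v w z, D u v w z = -D v u w z := by
    intro u v w z
    simp only [hD]
    rw [curv_antisymm, map_neg, neg_apply]
    ring
  have pair : ∀ u v w z, D u v w z = D w z u v := by
    intro u v w z
    simp only [hD]
    rw [H.gl_curv_pair_symm hy, hsy w u, hsy z v, hsy w v, hsy z u]
    ring
  have a1 : ∀ u u' v w z, D (u + u') v w z = D u v w z + D u' v w z := by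
    intro u u' v w z
    simp only [hD, hadd1, map_add, add_apply]; ring
  have a2 : ∀ u v v' w z, D u (v + v') w z = D u v w z + D u v' w z := by
    intro u v v' w z
    simp only [hD, hadd2, map_add, add_apply]; ring
  have a3 : ∀ u v w w' z, D u v (w + w') z = D u v w z + D u v w' z := by
    intro u v w w' z
    simp only [hD, hadd3, map_add, add_apply]; ring
  have a4 : ∀ u v w z z', D u v w (z + z') = D u v w z + D u v w z' := by
    intro u v w z z'
    simp only [hD, map_add]; ring
  -- Polarization in `v`; pair symmetry identifies the two mixed terms.
  have p1 : ∀ u v w, D u v u w = 0 := by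
    intro u v w
    have h1 := hQ u (v + w)
    rw [a2, a4, a4, hQ, hQ, pair u w u v] at h1
    linarith
  have p2 : ∀ u v x w, D u v x w = -D x v u w := by
    intro u v x w
    have h1 := p1 (u + x) v w
    rw [a1, a3, a3, p1, p1] at h1
    linarith
  -- `D` is now alternating in its first three arguments, so the Bianchi sum equals 3D.
  have hzero : ∀ u v x w, D u v x w = 0 := by
    intro u v x w
    have h1 := bia u v x w
    have h2 := s12 v x u w
    have h3 := p2 u v x w
    have h4 := s12 x u v w
    have h5 := p2 u x v w
    linarith
  refine H.ext_of_gl hy fun z ↦ ?_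
  have := hzero u v w z
  simp only [hD] at this
  simp only [map_smul, map_sub, smul_apply, sub_apply, smul_eq_mul]
  linarith

end CoordGeom

end ConstantCurvature

/-! ### Chart independence of covariant derivatives, and the curvature of a space form -/

section Charts

variable {M : Type*} [TopologicalSpace M] [ChartedSpace E4 M] [IsManifold 𝓘(ℝ, E4) ∞ M]
  {P : Type*} [NormedAddCommGroup P] [NormedSpace ℝ P]

local notation "φ[" x "]" => extChartAt 𝓘(ℝ, E4) x

lemma eventually_mem_source {f : P → M} {p : P} {x₀ : M} (hf : ContinuousAt f p)
    (h : f p ∈ (φ[x₀]).source) : ∀ᶠ q in nhds p, f q ∈ (φ[x₀]).source :=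
  hf.eventually_mem ((isOpen_extChartAt_source x₀).mem_nhds h)

lemma covD_congr {E : Type*} [NormedAddCommGroup E] [NormedSpace ℝ E]
    {Ch : E → E →L[ℝ] E →L[ℝ] E} {Y Y' X X' : P → E} {p : P} (hY : Y =ᶠ[nhds p] Y')
    (hX : X =ᶠ[nhds p] X') (h : P) : covD Ch Y X h p = covD Ch Y' X' h p := by
  rw [covD, covD, hY.fderiv_eq, hX.fderiv_eq, hY.eq_of_nhds, hX.eq_of_nhds]

namespace SemiRiemannianMetric

variable {q : ℕ} (g : SemiRiemannianMetric M q)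

lemma coordMetric_trans {x₀ x₁ : M} {y : E4} (hy : y ∈ (φ[x₀]).target)
    (hy' : (φ[x₀]).symm y ∈ (φ[x₁]).source) (u v : E4) :
    g.coordMetric x₀ y u v = g.coordMetric x₁ (trans x₀ x₁ y) (fderiv ℝ (trans x₀ x₁) y u)
      (fderiv ℝ (trans x₀ x₁) y v) := by
  rw [← g.inner_ofCoord, g.inner_eq_coordMetric hy', fderiv_trans hy hy', fderiv_trans hy hy']
  rfl

lemma eventually_coordMetric_trans {x₀ x₁ x : M} (h : x ∈ (φ[x₀]).source)
    (h' : x ∈ (φ[x₁]).source) : ∀ᶠ z in nhds (φ[x₀] x), ∀ u v,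
      g.coordMetric x₀ z u v = g.coordMetric x₁ (trans x₀ x₁ z) (fderiv ℝ (trans x₀ x₁) z u)
        (fderiv ℝ (trans x₀ x₁) z v) := by
  have h1 : φ[x₀] x ∈ (φ[x₀]).target := (φ[x₀]).map_source h
  have h2 : ∀ᶠ z in nhds (φ[x₀] x), (φ[x₀]).symm z ∈ (φ[x₁]).source := by
    refine ContinuousAt.eventually_mem
      (((continuousOn_extChartAt_symm x₀).continuousAt
        ((isOpen_extChartAt_target x₀).mem_nhds h1))) ?_
    rw [(φ[x₀]).left_inv h]
    exact (isOpen_extChartAt_source x₁).mem_nhds h'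
  filter_upwards [h2, (isOpen_extChartAt_target x₀).mem_nhds h1] with z hz hz' u v
  exact g.coordMetric_trans hz' hz u v

/-- Covariant derivatives of a field along a map, in two charts. -/
lemma covD_trans {f : P → M} {X : ∀ p, Tan M (f p)} {p : P} {x₀ x₁ : M} (hf : ContinuousAt f p)
    (h : f p ∈ (φ[x₀]).source) (h' : f p ∈ (φ[x₁]).source)
    (hY : DifferentiableAt ℝ (fun q ↦ φ[x₀] (f q)) p)
    (hX : DifferentiableAt ℝ (fun q ↦ toCoord x₀ (f q) (X q)) p) (k : P) :
    covD (g.coordChristoffel x₁) (fun q ↦ φ[x₁] (f q)) (fun q ↦ toCoord x₁ (f q) (X q)) k p =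
      fderiv ℝ (trans x₀ x₁) (φ[x₀] (f p))
        (covD (g.coordChristoffel x₀) (fun q ↦ φ[x₀] (f q))
          (fun q ↦ toCoord x₀ (f q) (X q)) k p) := by
  have h1 : φ[x₀] (f p) ∈ (φ[x₀]).target := (φ[x₀]).map_source h
  have hs : (φ[x₀]).symm (φ[x₀] (f p)) ∈ (φ[x₁]).source := by rwa [(φ[x₀]).left_inv h]
  rw [← (g.coordGeom x₀).covD_chart_change (g.coordGeom x₁) (ψ := trans x₀ x₁)
    (Y := fun q ↦ φ[x₀] (f q)) (X := fun q ↦ toCoord x₀ (f q) (X q)) h1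
    (by rw [trans_apply h]; exact (φ[x₁]).map_source h') (contDiffAt_trans h1 hs)
    (surjective_fderiv_trans h h') (g.eventually_coordMetric_trans h h') hY hX]
  refine covD_congr ?_ ?_ k
  · filter_upwards [eventually_mem_source hf h] with q hq
    rw [trans_apply hq]
  · filter_upwards [eventually_mem_source hf h, eventually_mem_source hf h'] with q hq hq'
    rw [fderiv_trans_toCoord hq hq']

lemma toCoord_covDeriv_self (γ : ℝ → M) (X : ∀ s, Tan M (γ s)) (s : ℝ) :
    toCoord (γ s) (γ s) (g.covDeriv γ X s) = covD (g.coordChristoffel (γ s))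
      (fun τ ↦ φ[γ s] (γ τ)) (fun τ ↦ toCoord (γ s) (γ τ) (X τ)) 1 s := by
  rw [covDeriv, toCoord_ofCoordAt, ← coordChristoffel_apply]
  rfl

/-- The covariant derivative along a curve in an arbitrary chart. -/
lemma toCoord_covDeriv {γ : ℝ → M} {X : ∀ s, Tan M (γ s)} {s : ℝ} {x₀ : M}
    (hf : ContinuousAt γ s) (h : γ s ∈ (φ[x₀]).source)
    (hY : DifferentiableAt ℝ (fun τ ↦ φ[x₀] (γ τ)) s)
    (hX : DifferentiableAt ℝ (fun τ ↦ toCoord x₀ (γ τ) (X τ)) s) :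
    toCoord x₀ (γ s) (g.covDeriv γ X s) = covD (g.coordChristoffel x₀)
      (fun τ ↦ φ[x₀] (γ τ)) (fun τ ↦ toCoord x₀ (γ τ) (X τ)) 1 s := by
  -- By definition `covDeriv` uses the chart centred at `γ s`, which moves with `s`. Transfer to a
  -- fixed chart `x₀` is what allows ∇X to be differentiated again.
  have h' := mem_extChartAt_source (I := 𝓘(ℝ, E4)) (γ s)
  have h1 := g.toCoord_covDeriv_self γ X s
  rw [g.covD_trans hf h h' hY hX] at h1
  obtain ⟨w, hw⟩ := exists_toCoord_eq h (covD (g.coordChristoffel x₀)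
    (fun τ ↦ φ[x₀] (γ τ)) (fun τ ↦ toCoord x₀ (γ τ) (X τ)) 1 s)
  rw [← hw, fderiv_trans_toCoord h h'] at h1
  rw [← hw, toCoord_injective h' h1]

lemma curvatureCoord_eq {x₀ : M} {y : E4} (hy : y ∈ (φ[x₀]).target) (u v w : E4) :
    g.curvatureCoord x₀ y u v w = curv (g.coordChristoffel x₀) y u v w := by
  have hd (a b c : E4) : fderiv ℝ (fun z ↦ g.christoffelVec x₀ z b c) y a =
      fderiv ℝ (g.coordChristoffel x₀) y a b c := by
    have h1 := fderiv_bilin_comp (B := g.coordChristoffel x₀) (Y := fun z : E4 ↦ z)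
      (a := fun _ ↦ b) (b := fun _ ↦ c) (p := y) ((g.coordGeom x₀).differentiableAt_Ch hy)
      differentiableAt_id (differentiableAt_const b) (differentiableAt_const c) a
    simp only [fderiv_fun_id, ContinuousLinearMap.id_apply, fderiv_fun_const, Pi.zero_apply,
      zero_apply, map_zero, add_zero] at h1
    simpa only [coordChristoffel_apply] using h1
  simp only [curvatureCoord, curv, hd, coordChristoffel_apply]

/-- The curvature tensor of a space form, at the centre of a chart. -/
lemma IsSpaceForm.curv_eq {g : SemiRiemannianMetric M q} {G : ℝ} (hG : g.IsSpaceForm G) (x : M)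
    (u v w : E4) :
    curv (g.coordChristoffel x) (φ[x] x) u v w =
      G • (g.coordMetric x (φ[x] x) u w • v - g.coordMetric x (φ[x] x) v w • u) := by
  have hx := mem_extChartAt_source (I := 𝓘(ℝ, E4)) x
  have hy := mem_extChartAt_target (I := 𝓘(ℝ, E4)) x
  refine (g.coordGeom x).curv_eq_of_sectional hy ?_ ?_ u v w
  · obtain ⟨b, hb⟩ := g.index x
    refine ⟨toCoord x x (b 0), toCoord x x (b 1), ?_⟩
    rw [← g.inner_eq_coordMetric hx, ← g.inner_eq_coordMetric hx, ← g.inner_eq_coordMetric hx,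
      hb, hb, hb]
    simp only [if_true]
    split_ifs <;> simp_all
  · intro u v huv
    obtain ⟨u, rfl⟩ := exists_toCoord_eq hx u
    obtain ⟨v, rfl⟩ := exists_toCoord_eq hx v
    rw [← g.inner_eq_coordMetric hx, ← g.inner_eq_coordMetric hx, ← g.inner_eq_coordMetric hx]
      at huv ⊢
    have h1 := hG x u v huv
    rw [sectionalCurvature, div_eq_iff huv, g.inner_eq_coordMetric hx (g.curvature x u v u),
      curvature, toCoord_ofCoordAt, g.curvatureCoord_eq hy] at h1
    exact h1

end SemiRiemannianMetric

end Charts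

/-! ### Smooth fields along curves and the product rule -/

section FieldsAlongCurves

variable {M : Type*} [TopologicalSpace M] [ChartedSpace E4 M] [IsManifold 𝓘(ℝ, E4) ∞ M]

local notation "φ[" x "]" => extChartAt 𝓘(ℝ, E4) x

variable {J : Set ℝ} {γ : ℝ → M} {X Z : ∀ s, Tan M (γ s)}

lemma IsSmoothField.contMDiffAt (h : IsSmoothField J γ X) (hJ : IsOpen J) {s : ℝ} (hs : s ∈ J) :
    ContMDiffAt 𝓘(ℝ, ℝ) 𝓘(ℝ, E4).tangent ∞
      (fun s ↦ (⟨γ s, X s⟩ : TangentBundle 𝓘(ℝ, E4) M)) s :=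
  ContMDiffOn.contMDiffAt h (hJ.mem_nhds hs)

lemma IsSmoothField.contMDiffOn_base (h : IsSmoothField J γ X) (hJ : IsOpen J) :
    ContMDiffOn 𝓘(ℝ, ℝ) 𝓘(ℝ, E4) ∞ γ J := fun s hs ↦
  (((contMDiffAt_tangentBundle_iff (x₀ := γ s) (mem_extChartAt_source (γ s))).1
    (h.contMDiffAt hJ hs)).1).contMDiffWithinAt

lemma IsSmoothField.contDiffAt_toCoord (h : IsSmoothField J γ X) (hJ : IsOpen J) {s : ℝ}
    (hs : s ∈ J) {x₀ : M} (hx : γ s ∈ (φ[x₀]).source) :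
    ContDiffAt ℝ ∞ (fun τ ↦ toCoord x₀ (γ τ) (X τ)) s :=
  ((contMDiffAt_tangentBundle_iff hx).1 (h.contMDiffAt hJ hs)).2

lemma contDiffAt_chart (h : ContMDiffOn 𝓘(ℝ, ℝ) 𝓘(ℝ, E4) ∞ γ J) (hJ : IsOpen J) {s : ℝ}
    (hs : s ∈ J) {x₀ : M} (hx : γ s ∈ (φ[x₀]).source) :
    ContDiffAt ℝ ∞ (fun τ ↦ φ[x₀] (γ τ)) s :=
  (contMDiffAt_base_iff (h.contMDiffAt (hJ.mem_nhds hs)).continuousAt hx).1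
    (h.contMDiffAt (hJ.mem_nhds hs))

lemma IsSmoothField.of_toCoord (hγ : ContMDiffOn 𝓘(ℝ, ℝ) 𝓘(ℝ, E4) ∞ γ J) (hJ : IsOpen J)
    (h : ∀ s ∈ J, ContDiffAt ℝ ∞ (fun τ ↦ toCoord (γ s) (γ τ) (X τ)) s) :
    IsSmoothField J γ X := fun s hs ↦
  ((contMDiffAt_tangentBundle_iff (x₀ := γ s) (mem_extChartAt_source (γ s))).2
    ⟨hγ.contMDiffAt (hJ.mem_nhds hs), h s hs⟩).contMDiffWithinAt

lemma isSmoothField_velocity (hγ : ContMDiffOn 𝓘(ℝ, ℝ) 𝓘(ℝ, E4) ∞ γ J) (hJ : IsOpen J) :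
    IsSmoothField J γ (velocity γ) := by
  refine IsSmoothField.of_toCoord hγ hJ fun s hs ↦ ?_
  have hx := mem_extChartAt_source (I := 𝓘(ℝ, E4)) (γ s)
  have hc := (hγ.contMDiffAt (hJ.mem_nhds hs)).continuousAt
  refine (contDiffAt_fderiv_apply_const (contDiffAt_chart hγ hJ hs hx) (1 : ℝ)).congr_of_eventuallyEq
    ?_
  filter_upwards [hJ.mem_nhds hs, eventually_mem_source hc hx] with τ hτ hτ'
  exact toCoord_velocity hτ' ((hγ.contMDiffAt (hJ.mem_nhds hτ)).mdifferentiableAt (by simp))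

lemma IsSmoothField.continuousAt_base (h : IsSmoothField J γ X) (hJ : IsOpen J) {s : ℝ}
    (hs : s ∈ J) : ContinuousAt γ s :=
  ((h.contMDiffOn_base hJ).contMDiffAt (hJ.mem_nhds hs)).continuousAt

namespace SemiRiemannianMetric

variable {q : ℕ} (g : SemiRiemannianMetric M q)

lemma toCoord_covDeriv_of_smooth (hJ : IsOpen J) (hX : IsSmoothField J γ X) {s : ℝ} (hs : s ∈ J)
    {x₀ : M} (hx : γ s ∈ (φ[x₀]).source) :
    toCoord x₀ (γ s) (g.covDeriv γ X s) = covD (g.coordChristoffel x₀)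
      (fun τ ↦ φ[x₀] (γ τ)) (fun τ ↦ toCoord x₀ (γ τ) (X τ)) 1 s :=
  g.toCoord_covDeriv (hX.continuousAt_base hJ hs) hx
    ((contDiffAt_chart (hX.contMDiffOn_base hJ) hJ hs hx).differentiableAt (by simp))
    ((hX.contDiffAt_toCoord hJ hs hx).differentiableAt (by simp))

lemma isSmoothField_covDeriv (hJ : IsOpen J) (hX : IsSmoothField J γ X) :
    IsSmoothField J γ (g.covDeriv γ X) := by
  refine IsSmoothField.of_toCoord (hX.contMDiffOn_base hJ) hJ fun s hs ↦ ?_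
  have hx := mem_extChartAt_source (I := 𝓘(ℝ, E4)) (γ s)
  refine ((g.coordGeom (γ s)).contDiffAt_covD (Y := fun τ ↦ φ[γ s] (γ τ))
    ((φ[γ s]).map_source hx) (contDiffAt_chart (hX.contMDiffOn_base hJ) hJ hs hx)
    (hX.contDiffAt_toCoord hJ hs hx) (1 : ℝ)).congr_of_eventuallyEq ?_
  filter_upwards [hJ.mem_nhds hs, eventually_mem_source (hX.continuousAt_base hJ hs) hx]
    with τ hτ hτ'
  exact g.toCoord_covDeriv_of_smooth hJ hX hτ hτ'

lemma contDiffAt_inner (hJ : IsOpen J) (hX : IsSmoothField J γ X) (hZ : IsSmoothField J γ Z)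
    {s : ℝ} (hs : s ∈ J) : ContDiffAt ℝ ∞ (fun τ ↦ g.inner (γ τ) (X τ) (Z τ)) s := by
  have hx := mem_extChartAt_source (I := 𝓘(ℝ, E4)) (γ s)
  have h1 : ContDiffAt ℝ ∞ (fun τ ↦ g.coordMetric (γ s) (φ[γ s] (γ τ))
      (toCoord (γ s) (γ τ) (X τ)) (toCoord (γ s) (γ τ) (Z τ))) s :=
    ((ContDiffAt.comp s (g := g.coordMetric (γ s)) ((g.coordGeom (γ s)).contDiffAt_gl
      ((φ[γ s]).map_source hx)) (contDiffAt_chart (hX.contMDiffOn_base hJ) hJ hs hx)).clm_apply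
      (hX.contDiffAt_toCoord hJ hs hx)).clm_apply (hZ.contDiffAt_toCoord hJ hs hx)
  refine h1.congr_of_eventuallyEq ?_
  filter_upwards [eventually_mem_source (hX.continuousAt_base hJ hs) hx] with τ hτ'
  exact g.inner_eq_coordMetric hτ' _ _

/-- The product rule for the covariant derivative. -/
lemma hasDerivAt_inner (hJ : IsOpen J) (hX : IsSmoothField J γ X) (hZ : IsSmoothField J γ Z)
    {s : ℝ} (hs : s ∈ J) : HasDerivAt (fun τ ↦ g.inner (γ τ) (X τ) (Z τ))
      (g.inner (γ s) (g.covDeriv γ X s) (Z s) + g.inner (γ s) (X s) (g.covDeriv γ Z s)) s := by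
  have hx := mem_extChartAt_source (I := 𝓘(ℝ, E4)) (γ s)
  have hd := ((g.contDiffAt_inner hJ hX hZ hs).differentiableAt (by simp)).hasDerivAt
  refine hd.congr_deriv ?_
  have h1 : (fun τ ↦ g.inner (γ τ) (X τ) (Z τ)) =ᶠ[nhds s]
      fun τ ↦ g.coordMetric (γ s) (φ[γ s] (γ τ))
        (toCoord (γ s) (γ τ) (X τ)) (toCoord (γ s) (γ τ) (Z τ)) := by
    filter_upwards [eventually_mem_source (hX.continuousAt_base hJ hs) hx] with τ hτ'
    exact g.inner_eq_coordMetric hτ' _ _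
  rw [h1.deriv_eq, ← fderiv_apply_one_eq_deriv,
    (g.coordGeom (γ s)).fderiv_gl_comp (Y := fun τ ↦ φ[γ s] (γ τ)) ((φ[γ s]).map_source hx)
      ((contDiffAt_chart (hX.contMDiffOn_base hJ) hJ hs hx).differentiableAt (by simp))
      ((hX.contDiffAt_toCoord hJ hs hx).differentiableAt (by simp))
      ((hZ.contDiffAt_toCoord hJ hs hx).differentiableAt (by simp)),
    g.inner_eq_coordMetric hx, g.inner_eq_coordMetric hx, toCoord_covDeriv_self,
    toCoord_covDeriv_self]

end SemiRiemannianMetric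

end FieldsAlongCurves

/-! ### Partial derivatives of two-parameter maps -/

section Slices

variable {E : Type*} [NormedAddCommGroup E] [NormedSpace ℝ E]

lemma hasDerivAt_slice_left {Y : ℝ × ℝ → E} {s t : ℝ} (h : DifferentiableAt ℝ Y (s, t)) :
    HasDerivAt (fun u ↦ Y (u, t)) (fderiv ℝ Y (s, t) (1, 0)) s := by
  have h1 : HasDerivAt (fun u : ℝ ↦ (u, t)) ((1 : ℝ), (0 : ℝ)) s :=
    (hasDerivAt_id s).prodMk (hasDerivAt_const s t)
  exact HasFDerivAt.comp_hasDerivAt (f := fun u : ℝ ↦ (u, t)) s h.hasFDerivAt h1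

lemma hasDerivAt_slice_right {Y : ℝ × ℝ → E} {s t : ℝ} (h : DifferentiableAt ℝ Y (s, t)) :
    HasDerivAt (fun u ↦ Y (s, u)) (fderiv ℝ Y (s, t) (0, 1)) t := by
  have h1 : HasDerivAt (fun u : ℝ ↦ (s, u)) ((0 : ℝ), (1 : ℝ)) t :=
    (hasDerivAt_const t s).prodMk (hasDerivAt_id t)
  exact HasFDerivAt.comp_hasDerivAt (f := fun u : ℝ ↦ (s, u)) t h.hasFDerivAt h1

lemma covD_slice_left {Ch : E → E →L[ℝ] E →L[ℝ] E} {Y X : ℝ × ℝ → E} {s t : ℝ}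
    (hY : DifferentiableAt ℝ Y (s, t)) (hX : DifferentiableAt ℝ X (s, t)) :
    covD Ch (fun u ↦ Y (u, t)) (fun u ↦ X (u, t)) (1 : ℝ) s = covD Ch Y X (1, 0) (s, t) := by
  rw [covD, covD, fderiv_apply_one_eq_deriv, fderiv_apply_one_eq_deriv,
    (hasDerivAt_slice_left hY).deriv, (hasDerivAt_slice_left hX).deriv]

lemma covD_slice_right {Ch : E → E →L[ℝ] E →L[ℝ] E} {Y X : ℝ × ℝ → E} {s t : ℝ}
    (hY : DifferentiableAt ℝ Y (s, t)) (hX : DifferentiableAt ℝ X (s, t)) :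
    covD Ch (fun u ↦ Y (s, u)) (fun u ↦ X (s, u)) (1 : ℝ) t = covD Ch Y X (0, 1) (s, t) := by
  rw [covD, covD, fderiv_apply_one_eq_deriv, fderiv_apply_one_eq_deriv,
    (hasDerivAt_slice_right hY).deriv, (hasDerivAt_slice_right hX).deriv]

end Slices

/-! ### Necessary conditions on variation fields -/

section Variations

variable {M : Type*} [TopologicalSpace M] [ChartedSpace E4 M] [IsManifold 𝓘(ℝ, E4) ∞ M]

local notation "φ[" x "]" => extChartAt 𝓘(ℝ, E4) x

variable {q : ℕ} {g : SemiRiemannianMetric M q} {J : Set ℝ} {γ : ℝ → M}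
  {V : ∀ s, Tan M (γ s)} {U : Set (ℝ × ℝ)} {Γ : ℝ × ℝ → M}

lemma contMDiffOn_slice (hU : IsOpen U) (hΓ : ContMDiffOn 𝓘(ℝ, ℝ × ℝ) 𝓘(ℝ, E4) ∞ Γ U) (t : ℝ) :
    ContMDiffOn 𝓘(ℝ, ℝ) 𝓘(ℝ, E4) ∞ (fun s ↦ Γ (s, t)) {s | (s, t) ∈ U} := by
  have h1 : ContMDiff 𝓘(ℝ, ℝ) 𝓘(ℝ, ℝ × ℝ) ∞ (fun s : ℝ ↦ (s, t)) :=
    (contDiff_id.prodMk contDiff_const).contMDiff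
  exact hΓ.comp h1.contMDiffOn (fun s hs ↦ hs)

lemma isOpen_slice (hU : IsOpen U) (t : ℝ) : IsOpen {s | (s, t) ∈ U} :=
  hU.preimage (by fun_prop : Continuous fun s : ℝ ↦ (s, t))

section Family

variable {x₀ : M} {s t : ℝ}

lemma contDiffAt_chart_family (hU : IsOpen U) (hΓ : ContMDiffOn 𝓘(ℝ, ℝ × ℝ) 𝓘(ℝ, E4) ∞ Γ U)
    {p : ℝ × ℝ} (hp : p ∈ U) (hx : Γ p ∈ (φ[x₀]).source) :
    ContDiffAt ℝ ∞ (fun p ↦ φ[x₀] (Γ p)) p :=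
  (contMDiffAt_base_iff (hΓ.contMDiffAt (hU.mem_nhds hp)).continuousAt hx).1
    (hΓ.contMDiffAt (hU.mem_nhds hp))

lemma toCoord_velocity_family (hU : IsOpen U) (hΓ : ContMDiffOn 𝓘(ℝ, ℝ × ℝ) 𝓘(ℝ, E4) ∞ Γ U)
    (hp : (s, t) ∈ U) (hx : Γ (s, t) ∈ (φ[x₀]).source) :
    toCoord x₀ (Γ (s, t)) (velocity (fun s ↦ Γ (s, t)) s) =
      fderiv ℝ (fun p ↦ φ[x₀] (Γ p)) (s, t) (1, 0) := by
  rw [toCoord_velocity hx (((contMDiffOn_slice hU hΓ t).contMDiffAt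
    ((isOpen_slice hU t).mem_nhds hp)).mdifferentiableAt (by simp))]
  exact (hasDerivAt_slice_left
    ((contDiffAt_chart_family hU hΓ hp hx).differentiableAt (by simp))).deriv

lemma toCoord_velocity_family_right (hU : IsOpen U)
    (hΓ : ContMDiffOn 𝓘(ℝ, ℝ × ℝ) 𝓘(ℝ, E4) ∞ Γ U)
    (hp : (s, t) ∈ U) (hx : Γ (s, t) ∈ (φ[x₀]).source) :
    toCoord x₀ (Γ (s, t)) (velocity (fun t ↦ Γ (s, t)) t) =
      fderiv ℝ (fun p ↦ φ[x₀] (Γ p)) (s, t) (0, 1) := by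
  have h1 : ContMDiffAt 𝓘(ℝ, ℝ) 𝓘(ℝ, ℝ × ℝ) ∞ (fun t : ℝ ↦ (s, t)) t :=
    (contDiff_const.prodMk contDiff_id).contMDiff.contMDiffAt
  have h2 : ContMDiffAt 𝓘(ℝ, ℝ) 𝓘(ℝ, E4) ∞ (fun t ↦ Γ (s, t)) t :=
    ContMDiffAt.comp t (hΓ.contMDiffAt (hU.mem_nhds hp)) h1
  rw [toCoord_velocity hx (h2.mdifferentiableAt (by simp))]
  exact (hasDerivAt_slice_right
    ((contDiffAt_chart_family hU hΓ hp hx).differentiableAt (by simp))).deriv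

lemma toCoord_accel_family (g : SemiRiemannianMetric M q) (hU : IsOpen U)
    (hΓ : ContMDiffOn 𝓘(ℝ, ℝ × ℝ) 𝓘(ℝ, E4) ∞ Γ U)
    (hp : (s, t) ∈ U) (hx : Γ (s, t) ∈ (φ[x₀]).source) :
    toCoord x₀ (Γ (s, t)) (g.covDeriv (fun s ↦ Γ (s, t)) (velocity fun s ↦ Γ (s, t)) s) =
      covD (g.coordChristoffel x₀) (fun p ↦ φ[x₀] (Γ p))
        (fun p ↦ fderiv ℝ (fun p ↦ φ[x₀] (Γ p)) p (1, 0)) (1, 0) (s, t) := by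
  have hJ := isOpen_slice hU t
  have hY := contDiffAt_chart_family hU hΓ hp hx
  rw [g.toCoord_covDeriv_of_smooth hJ (isSmoothField_velocity (contMDiffOn_slice hU hΓ t) hJ)
    (show s ∈ {s | (s, t) ∈ U} from hp) hx,
    ← covD_slice_left (hY.differentiableAt (by simp))
      ((contDiffAt_fderiv_apply_const hY _).differentiableAt (by simp))]
  refine covD_congr (Filter.EventuallyEq.refl _ _) ?_ _
  have hc : ContinuousAt (fun s ↦ Γ (s, t)) s :=
    ((contMDiffOn_slice hU hΓ t).contMDiffAt (hJ.mem_nhds hp)).continuousAt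
  filter_upwards [hJ.mem_nhds hp, eventually_mem_source hc hx] with u hu hu'
  exact toCoord_velocity_family hU hΓ hu hu'

end Family

namespace SemiRiemannianMetric

lemma IsVariation.toCoord_field (h : IsVariation J γ V U Γ) {x₀ : M} {s : ℝ} (hs : s ∈ J)
    (hx : γ s ∈ (φ[x₀]).source) :
    toCoord x₀ (γ s) (V s) = fderiv ℝ (fun p ↦ φ[x₀] (Γ p)) (s, 0) (0, 1) := by
  have h1 := congrArg (fun p : TangentBundle 𝓘(ℝ, E4) M ↦ toCoord x₀ p.1 p.2) (h.field s hs)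
  rw [← toCoord_velocity_family_right h.isOpen h.smooth (h.mem s hs) (by rwa [h.start s hs])]
  exact h1.symm

lemma IsVariation.source (h : IsVariation J γ V U Γ) {s : ℝ} (hs : s ∈ J) :
    Γ (s, 0) ∈ (φ[γ s]).source := by
  rw [h.start s hs]; exact mem_extChartAt_source (γ s)

lemma IsVariation.contDiffAt_chart (h : IsVariation J γ V U Γ) {s : ℝ} (hs : s ∈ J) :
    ContDiffAt ℝ ∞ (fun p ↦ φ[γ s] (Γ p)) (s, 0) :=
  contDiffAt_chart_family h.isOpen h.smooth (h.mem s hs) (h.source hs)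

lemma IsVariation.eventually_mem (h : IsVariation J γ V U Γ) {s : ℝ} (hs : s ∈ J) :
    ∀ᶠ p in nhds (s, (0 : ℝ)), p ∈ U ∧ Γ p ∈ (φ[γ s]).source :=
  (h.isOpen.eventually_mem (h.mem s hs)).and (eventually_mem_source
    (h.smooth.contMDiffAt (h.isOpen.mem_nhds (h.mem s hs))).continuousAt (h.source hs))

lemma tendsto_slice_left (s t : ℝ) :
    Filter.Tendsto (fun u : ℝ ↦ (u, t)) (nhds s) (nhds (s, t)) :=
  Continuous.tendsto (by fun_prop : Continuous fun u : ℝ ↦ (u, t)) s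

lemma tendsto_slice_right (s t : ℝ) :
    Filter.Tendsto (fun u : ℝ ↦ (s, u)) (nhds t) (nhds (s, t)) :=
  Continuous.tendsto (by fun_prop : Continuous fun u : ℝ ↦ (s, u)) t

lemma IsVariation.toCoord_covDeriv (g : SemiRiemannianMetric M q) (h : IsVariation J γ V U Γ)
    (hJ : IsOpen J) {s : ℝ} (hs : s ∈ J)
    {W : ∀ s, Tan M (γ s)} {X : ℝ × ℝ → E4} (hX : DifferentiableAt ℝ X (s, 0))
    (hW : ∀ᶠ τ in nhds s, toCoord (γ s) (γ τ) (W τ) = X (τ, 0)) :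
    toCoord (γ s) (γ s) (g.covDeriv γ W s) =
      covD (g.coordChristoffel (γ s)) (fun p ↦ φ[γ s] (Γ p)) X (1, 0) (s, 0) := by
  rw [g.toCoord_covDeriv_self, ← covD_slice_left
    ((h.contDiffAt_chart hs).differentiableAt (by simp)) hX]
  refine covD_congr ?_ hW _
  filter_upwards [hJ.mem_nhds hs] with τ hτ
  rw [h.start τ hτ]

lemma IsVariation.eventually_toCoord_field (h : IsVariation J γ V U Γ) (hJ : IsOpen J)
    {s : ℝ} (hs : s ∈ J) : ∀ᶠ τ in nhds s, toCoord (γ s) (γ τ) (V τ) =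
      fderiv ℝ (fun p ↦ φ[γ s] (Γ p)) (τ, 0) (0, 1) := by
  filter_upwards [hJ.mem_nhds hs, (tendsto_slice_left s 0).eventually (h.eventually_mem hs)]
    with τ hτ hτ'
  exact h.toCoord_field hτ (by rw [← h.start τ hτ]; exact hτ'.2)

lemma IsVariation.toCoord_velocity (h : IsVariation J γ V U Γ) (hJ : IsOpen J)
    {s : ℝ} (hs : s ∈ J) : ∀ᶠ τ in nhds s, toCoord (γ s) (γ τ) (velocity γ τ) =
      fderiv ℝ (fun p ↦ φ[γ s] (Γ p)) (τ, 0) (1, 0) := by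
  filter_upwards [hJ.eventually_mem hs,
    (tendsto_slice_left s 0).eventually (h.eventually_mem hs)] with τ hτ hτ'
  have he : (fun u ↦ Γ (u, 0)) =ᶠ[nhds τ] γ := by
    filter_upwards [hJ.mem_nhds hτ] with u hu
    exact h.start u hu
  have hγ : MDifferentiableAt 𝓘(ℝ, ℝ) 𝓘(ℝ, E4) γ τ :=
    (((contMDiffOn_slice h.isOpen h.smooth 0).contMDiffAt ((isOpen_slice h.isOpen 0).mem_nhds
      (h.mem τ hτ))).mdifferentiableAt (by simp)).congr_of_eventuallyEq he.symm
  rw [NullCurve.toCoord_velocity (by rw [← h.start τ hτ]; exact hτ'.2) hγ,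
    ← (hasDerivAt_slice_left ((contDiffAt_chart_family h.isOpen h.smooth hτ'.1
      hτ'.2).differentiableAt (by simp))).deriv]
  refine Filter.EventuallyEq.deriv_eq ?_
  filter_upwards [he] with u hu
  rw [hu]

/-- Variation fields of variations through null curves satisfy `⟨∇_T V, T⟩ = 0`. -/
lemma IsVariation.inner_covDeriv_velocity (h : IsVariation J γ V U Γ) (hJ : IsOpen J)
    (hnull : ∀ t : ℝ, g.IsNullOn {s | (s, t) ∈ U} (fun s ↦ Γ (s, t))) {s : ℝ} (hs : s ∈ J) :
    g.inner (γ s) (g.covDeriv γ V s) (velocity γ s) = 0 := by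
  have hY := h.contDiffAt_chart hs
  have hYA : φ[γ s] (Γ (s, 0)) ∈ (φ[γ s]).target := (φ[γ s]).map_source (h.source hs)
  have hd1 := (contDiffAt_fderiv_apply_const hY (1, 0)).differentiableAt (by simp)
  have hd2 := (contDiffAt_fderiv_apply_const hY (0, 1)).differentiableAt (by simp)
  have hG := g.coordGeom (γ s)
  have hzero : (fun p : ℝ × ℝ ↦ g.coordMetric (γ s) (φ[γ s] (Γ p))
      (fderiv ℝ (fun p ↦ φ[γ s] (Γ p)) p (1, 0)) (fderiv ℝ (fun p ↦ φ[γ s] (Γ p)) p (1, 0)))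
      =ᶠ[nhds (s, 0)] fun _ ↦ 0 := by
    filter_upwards [h.eventually_mem hs] with p hp
    obtain ⟨u, t⟩ := p
    rw [← toCoord_velocity_family h.isOpen h.smooth hp.1 hp.2, ← g.inner_eq_coordMetric hp.2]
    exact hnull t u hp.1
  -- Differentiating ⟨Γ_s, Γ_s⟩ = 0 in t gives 2⟨∇_t Γ_s, Γ_s⟩ = 0, and ∇_t Γ_s = ∇_s Γ_t because
  -- torsion vanishes.
  have h1 := hG.fderiv_gl_comp (p := (s, (0 : ℝ))) hYA (hY.differentiableAt (by simp)) hd1 hd1 (0, 1)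
  rw [hzero.fderiv_eq, hG.covD_fderiv_comm (Y := fun p ↦ φ[γ s] (Γ p)) hYA hY, ← h.toCoord_covDeriv g hJ hs hd2
    (h.eventually_toCoord_field hJ hs), hG.symm_gl _ hYA (fderiv ℝ _ _ _),
    ← (h.toCoord_velocity hJ hs).self_of_nhds, h.start s hs,
    ← g.inner_eq_coordMetric (mem_extChartAt_source (γ s))] at h1
  simp only [fderiv_fun_const, Pi.zero_apply, zero_apply] at h1
  linarith

/-- The eighth power of η is F²/a⁴, free of roots and absolute values. Its derivative vanishes with
that of η, so F·F' = 0. -/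
lemma hasDerivAt_zero_of_pseudoSpeed {a : ℝ} (ha : 0 < a) {F : ℝ → ℝ} {F' : ℝ}
    (hF : HasDerivAt F F' 0) (hne : F 0 ≠ 0)
    (hη : HasDerivAt (fun t ↦ (1 / Real.sqrt a) * |F t| ^ (1 / 4 : ℝ)) 0 0) : F' = 0 := by
  have h1 := (hη.pow 8)
  have h2 : (fun t ↦ ((1 / Real.sqrt a) * |F t| ^ (1 / 4 : ℝ)) ^ 8) =
      fun t ↦ (1 / a ^ 4) * F t ^ 2 := by
    funext t
    rw [mul_pow, ← Real.rpow_natCast (|F t| ^ (1 / 4 : ℝ)), ← Real.rpow_mul (abs_nonneg _)]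
    have : Real.sqrt a ^ 8 = a ^ 4 := by
      rw [show (8 : ℕ) = 2 * 4 from rfl, pow_mul, Real.sq_sqrt ha.le]
    rw [div_pow, this]
    norm_num
  have h3 : HasDerivAt (fun t ↦ (1 / a ^ 4) * F t ^ 2) 0 0 := by
    rw [← h2]
    exact h1.congr_deriv (by simp)
  have h4 := (hF.pow 2).const_mul (1 / a ^ 4)
  have h5 := h4.unique h3
  have ha4 : (1 / a ^ 4) ≠ 0 := by positivity
  simpa [ha4, hne, ha.ne'] using h5

/-- Variation fields of variations through null curves which preserve the pseudo arc-length to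
first order satisfy `⟨∇_T² V, ∇_T T⟩ = 0`. -/
lemma IsVariation.inner_covDeriv_covDeriv (h : IsVariation J γ V U Γ) (hJ : IsOpen J)
    {G : ℝ} (hG : g.IsSpaceForm G) {a : ℝ} (ha : 0 < a) {s : ℝ} (hs : s ∈ J)
    (hη : HasDerivAt (fun t ↦ g.pseudoSpeed a (fun s' ↦ Γ (s', t)) s) 0 0)
    (hTT : g.inner (γ s) (velocity γ s) (velocity γ s) = 0)
    (hTA : g.inner (γ s) (velocity γ s) (g.covDeriv γ (velocity γ) s) = 0)
    (hAA : g.inner (γ s) (g.covDeriv γ (velocity γ) s) (g.covDeriv γ (velocity γ) s) ≠ 0) :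
    g.inner (γ s) (g.covDeriv γ (g.covDeriv γ V) s) (g.covDeriv γ (velocity γ) s) = 0 := by
  have hY := h.contDiffAt_chart hs
  have hYA : φ[γ s] (Γ (s, 0)) ∈ (φ[γ s]).target := (φ[γ s]).map_source (h.source hs)
  have hx := mem_extChartAt_source (I := 𝓘(ℝ, E4)) (γ s)
  have hGe := g.coordGeom (γ s)
  set Y : ℝ × ℝ → E4 := fun p ↦ φ[γ s] (Γ p) with hYdef
  set Ch := g.coordChristoffel (γ s) with hCh
  have hT := contDiffAt_fderiv_apply_const hY (1, 0)
  have hVs := contDiffAt_fderiv_apply_const hY (0, 1)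
  set A : ℝ × ℝ → E4 := covD Ch Y (fun p ↦ fderiv ℝ Y p (1, 0)) (1, 0) with hA
  have hAs : ContDiffAt ℝ ∞ A (s, 0) := hGe.contDiffAt_covD (Y := Y) hYA hY hT _
  have hAd := hAs.differentiableAt (by simp)
  have hA0 : A (s, 0) = toCoord (γ s) (γ s) (g.covDeriv γ (velocity γ) s) :=
    (h.toCoord_covDeriv g hJ hs (hT.differentiableAt (by simp)) (h.toCoord_velocity hJ hs)).symm
  set F : ℝ × ℝ → ℝ := fun p ↦ g.coordMetric (γ s) (Y p) (A p) (A p) with hF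
  have hFeq : ∀ᶠ t in nhds (0 : ℝ), g.accelSq (fun s' ↦ Γ (s', t)) s = F (s, t) := by
    filter_upwards [(tendsto_slice_right s 0).eventually (h.eventually_mem hs)] with t ht
    rw [accelSq, g.inner_eq_coordMetric ht.2, toCoord_accel_family g h.isOpen h.smooth ht.1 ht.2]
  have hFd : DifferentiableAt ℝ F (s, 0) :=
    differentiableAt_bilin_comp (hGe.differentiableAt_gl hYA) (hY.differentiableAt (by simp))
      hAd hAd
  have hF0 : F (s, 0) ≠ 0 := by
    simp only [hF, hA0, hYdef, h.start s hs]
    rwa [← g.inner_eq_coordMetric hx]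
  have hη' : HasDerivAt (fun t ↦ (1 / Real.sqrt a) * |F (s, t)| ^ (1 / 4 : ℝ)) 0 0 := by
    refine hη.congr_of_eventuallyEq ?_
    filter_upwards [hFeq] with t ht
    rw [pseudoSpeed, ht]
  have h1 := hasDerivAt_zero_of_pseudoSpeed ha (hasDerivAt_slice_right hFd) hF0 hη'
  rw [hF, hGe.fderiv_gl_comp (Y := Y) hYA (hY.differentiableAt (by simp)) hAd hAd,
    hGe.symm_gl _ hYA (A (s, 0)), ← two_mul, mul_eq_zero] at h1
  have h2 := h1.resolve_left two_ne_zero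
  -- ∇_t ∇_s T = ∇_s ∇_t T + R(T, V)T, and `h4` replaces ∇_t T by ∇_s V on a whole neighbourhood so
  -- that it can be differentiated in s.
  have h3 : covD Ch Y A (0, 1) (s, 0) = covD Ch Y
      (covD Ch Y (fun p ↦ fderiv ℝ Y p (1, 0)) (0, 1)) (1, 0) (s, 0) +
      curv Ch (Y (s, 0)) (fderiv ℝ Y (s, 0) (1, 0)) (fderiv ℝ Y (s, 0) (0, 1))
        (fderiv ℝ Y (s, 0) (1, 0)) := hGe.covD_comm (Y := Y) hYA hY hT (1, 0) (0, 1)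
  have h4 : covD Ch Y (fun p ↦ fderiv ℝ Y p (1, 0)) (0, 1) =ᶠ[nhds (s, 0)]
      covD Ch Y (fun p ↦ fderiv ℝ Y p (0, 1)) (1, 0) := by
    filter_upwards [h.eventually_mem hs] with p hp
    exact hGe.covD_fderiv_comm (Y := Y) ((φ[γ s]).map_source hp.2)
      (contDiffAt_chart_family h.isOpen h.smooth hp.1 hp.2) _ _
  have h5 : toCoord (γ s) (γ s) (g.covDeriv γ (g.covDeriv γ V) s) = covD Ch Y
      (covD Ch Y (fun p ↦ fderiv ℝ Y p (0, 1)) (1, 0)) (1, 0) (s, 0) := by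
    refine h.toCoord_covDeriv g hJ hs
      ((hGe.contDiffAt_covD (Y := Y) hYA hY hVs _).differentiableAt (by simp)) ?_
    filter_upwards [hJ.eventually_mem hs, (h.eventually_toCoord_field hJ hs).eventually_nhds,
      (tendsto_slice_left s 0).eventually (h.eventually_mem hs)] with τ hτ hτ' hm
    have hYτ := contDiffAt_chart_family h.isOpen h.smooth hm.1 hm.2
    have hVτ := contDiffAt_fderiv_apply_const hYτ (0, 1)
    have hcγ : ContinuousAt γ τ := by
      have : ContinuousAt (fun u ↦ Γ (u, 0)) τ :=
        ((contMDiffOn_slice h.isOpen h.smooth 0).contMDiffAt ((isOpen_slice h.isOpen 0).mem_nhds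
          (h.mem τ hτ))).continuousAt
      refine this.congr ?_
      filter_upwards [hJ.mem_nhds hτ] with u hu
      exact h.start u hu
    have he : (fun u ↦ φ[γ s] (γ u)) =ᶠ[nhds τ] fun u ↦ Y (u, 0) := by
      filter_upwards [hJ.mem_nhds hτ] with u hu
      simp only [hYdef, h.start u hu]
    have he2 : (fun u ↦ toCoord (γ s) (γ u) (V u)) =ᶠ[nhds τ]
        fun u ↦ fderiv ℝ Y (u, 0) (0, 1) := hτ'
    rw [g.toCoord_covDeriv hcγ (by rw [← h.start τ hτ]; exact hm.2)
      (((hasDerivAt_slice_left (hYτ.differentiableAt (by simp))).differentiableAt).congr_of_eventuallyEq he)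
      (((hasDerivAt_slice_left (hVτ.differentiableAt (by simp))).differentiableAt).congr_of_eventuallyEq he2),
      ← covD_slice_left (hYτ.differentiableAt (by simp)) (hVτ.differentiableAt (by simp))]
    exact covD_congr he he2 _
  have hY0 : Y (s, 0) = φ[γ s] (γ s) := by simp only [hYdef, h.start s hs]
  have hT0 := (h.toCoord_velocity hJ hs).self_of_nhds
  -- The curvature term is G(⟨T,T⟩V − ⟨V,T⟩T). It drops out since ⟨T, T⟩ = 0 and ⟨T, ∇_T T⟩ = 0.
  rw [h3, covD_congr (Filter.EventuallyEq.refl _ _) h4, ← h5, hY0, hG.curv_eq, hA0, ← hT0,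
    ← g.inner_eq_coordMetric hx, hTT] at h2
  simp only [map_add, map_smul, map_sub, add_apply, smul_apply, sub_apply, zero_smul,
    ← g.inner_eq_coordMetric hx, hTA] at h2
  simpa using h2

end SemiRiemannianMetric

end Variations

/-! ### Components in the Cartan frame: admissibility and the antiderivative formulas -/

lemma exists_isAntiderivOn {J : Set ℝ} (hJ : IsOpen J) (hJ' : J.OrdConnected) (hne : J.Nonempty)
    {f : ℝ → ℝ} (hf : ContinuousOn f J) : ∃ w, IsAntiderivOn J w f := by
  obtain ⟨s₀, hs₀⟩ := hne
  refine ⟨fun s ↦ ∫ τ in s₀..s, f τ, fun s hs ↦ ?_⟩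
  exact intervalIntegral.integral_hasDerivAt_right
    ((hf.mono (hJ'.uIcc_subset hs₀ hs)).intervalIntegrable)
    (hf.stronglyMeasurableAtFilter hJ s hs) (hf.continuousAt (hJ.mem_nhds hs))

namespace SemiRiemannianMetric

variable {M : Type*} [TopologicalSpace M] [ChartedSpace E4 M] [IsManifold 𝓘(ℝ, E4) ∞ M]
  {q : ℕ} (g : SemiRiemannianMetric M q)

/-- The expansion of a vector in a pseudo-orthonormal frame. -/
lemma eq_sum_of_frame {ε₁ ε₂ : ℝ} (hε₁ : ε₁ * ε₁ = 1) (hε₂ : ε₂ * ε₂ = 1) {x : M}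
    {T W₁ N W₂ : Tan M x}
    (hTT : g.inner x T T = 0) (hNN : g.inner x N N = 0) (hTN : g.inner x T N = -1)
    (h1T : g.inner x W₁ T = 0) (h1N : g.inner x W₁ N = 0) (h2T : g.inner x W₂ T = 0)
    (h2N : g.inner x W₂ N = 0) (h11 : g.inner x W₁ W₁ = ε₁) (h22 : g.inner x W₂ W₂ = ε₂)
    (h12 : g.inner x W₁ W₂ = 0) (v : Tan M x) :
    v = (-g.inner x v N) • T + (ε₁ * g.inner x v W₁) • W₁ + (-g.inner x v T) • N +
      (ε₂ * g.inner x v W₂) • W₂ := by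
  let e : Fin 4 → Tan M x := ![T, W₁, N, W₂]
  have hNT : g.inner x N T = -1 := by rw [g.symm, hTN]
  have hT1 : g.inner x T W₁ = 0 := by rw [g.symm, h1T]
  have hN1 : g.inner x N W₁ = 0 := by rw [g.symm, h1N]
  have hT2 : g.inner x T W₂ = 0 := by rw [g.symm, h2T]
  have hN2 : g.inner x N W₂ = 0 := by rw [g.symm, h2N]
  have h21 : g.inner x W₂ W₁ = 0 := by rw [g.symm, h12]
  have hε₁' : ε₁ ≠ 0 := left_ne_zero_of_mul_eq_one hε₁
  have hε₂' : ε₂ ≠ 0 := left_ne_zero_of_mul_eq_one hε₂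
  have hli : LinearIndependent ℝ e := by
    rw [Fintype.linearIndependent_iff]
    intro c hc
    simp only [Fin.sum_univ_four, e, Matrix.cons_val] at hc
    have hin : ∀ w, c 0 * g.inner x T w + c 1 * g.inner x W₁ w + c 2 * g.inner x N w +
        c 3 * g.inner x W₂ w = 0 := by
      intro w
      have := congrArg (fun z ↦ g.inner x z w) hc
      simpa only [map_add, map_smul, add_apply, smul_apply, smul_eq_mul, map_zero, zero_apply]
        using this
    have i1 := hin T
    have i2 := hin W₁
    have i3 := hin N
    have i4 := hin W₂
    simp only [hTT, hNN, hTN, hNT, h1T, h1N, h2T, h2N, h11, h22, h12, h21, hT1, hN1, hT2, hN2,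
      mul_zero, add_zero, zero_add, mul_neg, mul_one, neg_eq_zero, mul_eq_zero, hε₁', hε₂',
      or_false] at i1 i2 i3 i4
    intro i
    fin_cases i <;> assumption
  have hcard : Fintype.card (Fin 4) = Module.finrank ℝ (Tan M x) := by
    have : Module.finrank ℝ (Tan M x) = Module.finrank ℝ E4 := rfl
    rw [this]; simp
  have : FiniteDimensional ℝ (Tan M x) := inferInstanceAs (FiniteDimensional ℝ E4)
  have hspan := hli.span_eq_top_of_card_eq_finrank' hcard
  rw [← sub_eq_zero]
  refine g.inner_nondegenerate x _ fun w ↦ ?_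
  have hw : w ∈ Submodule.span ℝ (Set.range e) := hspan ▸ Submodule.mem_top
  induction hw using Submodule.span_induction with
  | mem w hw =>
    obtain ⟨i, rfl⟩ := hw
    fin_cases i <;>
    simp [e, hTT, hNN, hTN, hNT, h1T, h1N, h2T, h2N, h11, h22, h12, h21, hT1, hN1, hT2, hN2] <;>
    first
    | linear_combination (-g.inner x v W₁) * hε₁
    | linear_combination (-g.inner x v W₂) * hε₂
  | zero => exact map_zero _
  | add w w' _ _ h h' => rw [map_add, h, h', add_zero]
  | smul c w _ h => rw [map_smul, h, smul_zero]

namespace CartanFrame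

variable {g} {a ε₁ ε₂ : ℝ} {J : Set ℝ} {γ : ℝ → M} (F : g.CartanFrame a ε₁ ε₂ J γ)

lemma eq_sum (hε₁ : ε₁ * ε₁ = 1) (hε₂ : ε₂ * ε₂ = 1) {s : ℝ} (hs : s ∈ J) (v : Tan M (γ s)) :
    v = (-g.inner (γ s) v (F.N s)) • velocity γ s + (ε₁ * g.inner (γ s) v (F.W₁ s)) • F.W₁ s +
      (-g.inner (γ s) v (velocity γ s)) • F.N s + (ε₂ * g.inner (γ s) v (F.W₂ s)) • F.W₂ s :=
  g.eq_sum_of_frame hε₁ hε₂ (F.T_T s hs) (F.N_N s hs) (F.T_N s hs) (F.W₁_T s hs) (F.W₁_N s hs)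
    (F.W₂_T s hs) (F.W₂_N s hs) (F.W₁_W₁ s hs) (F.W₂_W₂ s hs) (F.W₁_W₂ s hs) v

lemma contDiffAt_fV (hJ : IsOpen J) {V : ∀ s, Tan M (γ s)} (hV : IsSmoothField J γ V) {s : ℝ}
    (hs : s ∈ J) : ContDiffAt ℝ ∞ (F.fV V) s :=
  (g.contDiffAt_inner hJ hV F.smooth_N hs).neg

lemma contDiffAt_hV (hJ : IsOpen J) {V : ∀ s, Tan M (γ s)} (hV : IsSmoothField J γ V) {s : ℝ}
    (hs : s ∈ J) : ContDiffAt ℝ ∞ (F.hV V) s :=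
  contDiffAt_const.mul (g.contDiffAt_inner hJ hV F.smooth_W₁ hs)

lemma contDiffAt_gV (hJ : IsOpen J) {V : ∀ s, Tan M (γ s)} (hV : IsSmoothField J γ V) {s : ℝ}
    (hs : s ∈ J) : ContDiffAt ℝ ∞ (F.gV V) s :=
  (g.contDiffAt_inner hJ hV (isSmoothField_velocity (hV.contMDiffOn_base hJ) hJ) hs).neg

lemma contDiffAt_lV (hJ : IsOpen J) {V : ∀ s, Tan M (γ s)} (hV : IsSmoothField J γ V) {s : ℝ}
    (hs : s ∈ J) : ContDiffAt ℝ ∞ (F.lV V) s :=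
  contDiffAt_const.mul (g.contDiffAt_inner hJ hV F.smooth_W₂ hs)

/-- This and the three lemmas after it combine the product rule with the Cartan equations,
expressing the derivatives of the components of `V` through the components of ∇_T V. -/
lemma hasDerivAt_fV (hJ : IsOpen J) {V : ∀ s, Tan M (γ s)} (hV : IsSmoothField J γ V) {s : ℝ}
    (hs : s ∈ J) :
    HasDerivAt (F.fV V) (-g.inner (γ s) (g.covDeriv γ V s) (F.N s) +
      (F.k₁ s * F.hV V s - F.k₂ s * F.lV V s)) s := by
  have := (g.hasDerivAt_inner hJ hV F.smooth_N hs).neg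
  refine this.congr_deriv ?_
  rw [F.cartan_N s hs, CartanFrame.hV, lV]
  simp only [map_add, map_smul, smul_eq_mul]
  ring

lemma hasDerivAt_hV (hJ : IsOpen J) (hε₁ : ε₁ * ε₁ = 1) {V : ∀ s, Tan M (γ s)}
    (hV : IsSmoothField J γ V) {s : ℝ} (hs : s ∈ J) :
    HasDerivAt (F.hV V) (F.phiV V s + ε₁ * F.k₁ s * F.gV V s - a * F.fV V s) s := by
  have := (g.hasDerivAt_inner hJ hV F.smooth_W₁ hs).const_mul ε₁
  refine this.congr_deriv ?_
  rw [F.cartan_W₁ s hs, phiV, gV, fV]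
  simp only [map_add, map_smul, smul_eq_mul]
  linear_combination (a * g.inner (γ s) (V s) (F.N s)) * hε₁

lemma hasDerivAt_gV (hJ : IsOpen J) (hε₁ : ε₁ * ε₁ = 1) {V : ∀ s, Tan M (γ s)}
    (hV : IsSmoothField J γ V) {s : ℝ} (hs : s ∈ J) :
    HasDerivAt (F.gV V) (-g.inner (γ s) (g.covDeriv γ V s) (velocity γ s) -
      a * ε₁ * F.hV V s) s := by
  have := (g.hasDerivAt_inner hJ hV
    (isSmoothField_velocity (hV.contMDiffOn_base hJ) hJ) hs).neg
  refine this.congr_deriv ?_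
  rw [F.cartan_T s hs, CartanFrame.hV]
  simp only [map_smul, smul_eq_mul]
  linear_combination (a * g.inner (γ s) (V s) (F.W₁ s)) * hε₁

lemma hasDerivAt_lV (hJ : IsOpen J) {V : ∀ s, Tan M (γ s)} (hV : IsSmoothField J γ V) {s : ℝ}
    (hs : s ∈ J) : HasDerivAt (F.lV V) (F.psiV V s - ε₂ * F.k₂ s * F.gV V s) s := by
  have := (g.hasDerivAt_inner hJ hV F.smooth_W₂ hs).const_mul ε₂
  refine this.congr_deriv ?_
  rw [F.cartan_W₂ s hs, psiV, gV]
  simp only [map_smul, smul_eq_mul]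
  ring

/-- The only component of ∇_T² V that is needed enters here, and the last term cancels against the
one in f' when f + φ/a is formed. -/
lemma hasDerivAt_phiV (hJ : IsOpen J) (hε₁ : ε₁ * ε₁ = 1) {V : ∀ s, Tan M (γ s)}
    (hV : IsSmoothField J γ V) {s : ℝ} (hs : s ∈ J) :
    HasDerivAt (F.phiV V) (ε₁ * (g.inner (γ s) (g.covDeriv γ (g.covDeriv γ V) s) (F.W₁ s) -
      F.k₁ s * g.inner (γ s) (g.covDeriv γ V s) (velocity γ s)) +
      a * g.inner (γ s) (g.covDeriv γ V s) (F.N s)) s := by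
  have := (g.hasDerivAt_inner hJ (g.isSmoothField_covDeriv hJ hV) F.smooth_W₁ hs).const_mul ε₁
  refine this.congr_deriv ?_
  rw [F.cartan_W₁ s hs]
  simp only [map_add, map_smul, smul_eq_mul]
  linear_combination (a * g.inner (γ s) (g.covDeriv γ V s) (F.N s)) * hε₁

/-- The differential equations which characterize the vector fields tangent to the space of
pseudo arc-length parametrized null curves. -/
def IsAdmissible (F : g.CartanFrame a ε₁ ε₂ J γ) (V : ∀ s, Tan M (γ s)) : Prop :=
  ∀ s ∈ J, g.inner (γ s) (g.covDeriv γ V s) (velocity γ s) = 0 ∧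
    g.inner (γ s) (g.covDeriv γ (g.covDeriv γ V) s) (F.W₁ s) = 0

/-- Substituting h' = φ + ε₁k₁g − af and g = −ε₁ap into the formula for f cancels the k₁ terms and
leaves ar = af + φ. So the second antiderivative is not arbitrary but determined by `V`. -/
lemma Compatibility.eq_add {F : g.CartanFrame a ε₁ ε₂ J γ} (ha : 0 < a) (hJ : IsOpen J)
    (hε₁ : ε₁ * ε₁ = 1) {V : ∀ s, Tan M (γ s)} (hV : IsSmoothField J γ V) {p r : ℝ → ℝ}
    (h : F.Compatibility V p r) {s : ℝ} (hs : s ∈ J) :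
    r s = F.fV V s + F.phiV V s / a := by
  obtain ⟨-, -, h⟩ := h
  obtain ⟨h1, h2⟩ := h s hs
  rw [(F.hasDerivAt_hV hJ hε₁ hV hs).deriv, h2] at h1
  have ha' := ha.ne'
  field_simp at h1 ⊢
  linear_combination -h1 - (a * F.k₁ s * p s) * hε₁

/-- Comparing the two expressions for g' gives ⟨∇_T V, T⟩ = 0. Then r = f + φ/a has derivative k₁h −
k₂l + (ε₁/a)⟨∇_T² V, W₁⟩, which must equal k₁h − k₂l. -/
lemma Compatibility.isAdmissible {F : g.CartanFrame a ε₁ ε₂ J γ} (ha : 0 < a) (hJ : IsOpen J)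
    (hε₁ : ε₁ * ε₁ = 1) {V : ∀ s, Tan M (γ s)} (hV : IsSmoothField J γ V) {p r : ℝ → ℝ}
    (h : F.Compatibility V p r) : F.IsAdmissible V := by
  intro s hs
  have ha' := ha.ne'
  have hε : ε₁ ≠ 0 := left_ne_zero_of_mul_eq_one hε₁
  have e1 : g.inner (γ s) (g.covDeriv γ V s) (velocity γ s) = 0 := by
    have d1 := F.hasDerivAt_gV hJ hε₁ hV hs
    have d2 : HasDerivAt (F.gV V) (-ε₁ * a * F.hV V s) s :=
      ((h.1 s hs).const_mul _).congr_of_eventuallyEq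
        ((hJ.eventually_mem hs).mono fun τ hτ ↦ (h.2.2 τ hτ).2)
    linear_combination d2.unique d1
  refine ⟨e1, ?_⟩
  have d1 : HasDerivAt r _ s :=
    ((F.hasDerivAt_fV hJ hV hs).add ((F.hasDerivAt_phiV hJ hε₁ hV hs).div_const a)
      ).congr_of_eventuallyEq ((hJ.eventually_mem hs).mono fun τ hτ ↦ h.eq_add ha hJ hε₁ hV hτ)
  have := (h.2.1 s hs).unique d1
  rw [e1] at this
  field_simp at this
  have h0 : ε₁ * g.inner (γ s) (g.covDeriv γ (g.covDeriv γ V) s) (F.W₁ s) = 0 := by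
    linear_combination -this
  exact (mul_eq_zero.1 h0).resolve_left hε

/-- The witnesses are the only possible ones on `J`: p is obtained by solving the formula for g, and
r is the value forced by `Compatibility.eq_add`. -/
lemma IsAdmissible.exists_compatibility {F : g.CartanFrame a ε₁ ε₂ J γ} (ha : 0 < a)
    (hJ : IsOpen J) (hε₁ : ε₁ * ε₁ = 1) {V : ∀ s, Tan M (γ s)} (hV : IsSmoothField J γ V)
    (h : F.IsAdmissible V) :
    F.Compatibility V (fun s ↦ -ε₁ / a * F.gV V s) (fun s ↦ F.fV V s + F.phiV V s / a) := by
  have ha' := ha.ne'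
  refine ⟨fun s hs ↦ ?_, fun s hs ↦ ?_, fun s hs ↦ ⟨?_, ?_⟩⟩
  · refine ((F.hasDerivAt_gV hJ hε₁ hV hs).const_mul _).congr_deriv ?_
    rw [(h s hs).1]
    field_simp
    linear_combination a * F.hV V s * hε₁
  · refine ((F.hasDerivAt_fV hJ hV hs).add
      ((F.hasDerivAt_phiV hJ hε₁ hV hs).div_const a)).congr_deriv ?_
    rw [(h s hs).1, (h s hs).2]
    field_simp
    ring
  · rw [(F.hasDerivAt_hV hJ hε₁ hV hs).deriv]
    field_simp
    ring
  · field_simp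
    linear_combination (-F.gV V s) * hε₁

lemma psiV_eq {F : g.CartanFrame a ε₁ ε₂ J γ} (hJ : IsOpen J)
    {V : ∀ s, Tan M (γ s)} (hV : IsSmoothField J γ V) {p r : ℝ → ℝ}
    (h : F.Compatibility V p r) {s : ℝ} (hs : s ∈ J) :
    F.psiV V s = -(ε₁ * ε₂ * a) * F.k₂ s * p s + deriv (F.lV V) s := by
  rw [(F.hasDerivAt_lV hJ hV hs).deriv, (h.2.2 s hs).2]
  ring

lemma phiV_eq {F : g.CartanFrame a ε₁ ε₂ J γ} (ha : 0 < a) (hJ : IsOpen J)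
    (hε₁ : ε₁ * ε₁ = 1) {V : ∀ s, Tan M (γ s)} (hV : IsSmoothField J γ V) {p r : ℝ → ℝ}
    (h : F.Compatibility V p r) {s : ℝ} (hs : s ∈ J) :
    F.phiV V s = (a / 2) * ((1 / a) * deriv (F.hV V) s + F.k₁ s * p s + r s) := by
  have ha' := ha.ne'
  rw [(F.hasDerivAt_hV hJ hε₁ hV hs).deriv, (h.2.2 s hs).2, h.eq_add ha hJ hε₁ hV hs]
  field_simp
  linear_combination (a * F.k₁ s * p s) * hε₁

end CartanFrame

end SemiRiemannianMetric

/-! ### The frame equations in coordinates -/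

section FrameCoordinates

/-- The coordinates of a point together with four tangent vectors. -/
abbrev FrameE : Type := E4 × (Fin 4 → E4)

/-- The differential equation `y' = ∑ cⱼ eⱼ`, `∇eᵢ = ∑ Kᵢⱼ eⱼ` in coordinates. -/
def frameField (Ch : E4 → E4 →L[ℝ] E4 →L[ℝ] E4) (c : Fin 4 → ℝ) (K : Matrix (Fin 4) (Fin 4) ℝ)
    (p : FrameE) : FrameE :=
  (∑ j, c j • p.2 j, fun i ↦ ∑ j, K i j • p.2 j - Ch p.1 (∑ j, c j • p.2 j) (p.2 i))

lemma hasDerivAt_frameField_iff {Ch : E4 → E4 →L[ℝ] E4 →L[ℝ] E4} {c : Fin 4 → ℝ}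
    {K : Matrix (Fin 4) (Fin 4) ℝ} {u : ℝ → FrameE} {s : ℝ} :
    HasDerivAt u (frameField Ch c K (u s)) s ↔
      HasDerivAt (fun τ ↦ (u τ).1) (∑ j, c j • (u s).2 j) s ∧
      ∀ i, DifferentiableAt ℝ (fun τ ↦ (u τ).2 i) s ∧
        covD Ch (fun τ ↦ (u τ).1) (fun τ ↦ (u τ).2 i) (1 : ℝ) s = ∑ j, K i j • (u s).2 j := by
  constructor
  · intro h
    have h1 : HasDerivAt (fun τ ↦ (u τ).1) (∑ j, c j • (u s).2 j) s := h.fst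
    have h2 := hasDerivAt_pi.1 (h.snd)
    refine ⟨h1, fun i ↦ ⟨(h2 i).differentiableAt, ?_⟩⟩
    rw [covD, fderiv_apply_one_eq_deriv, fderiv_apply_one_eq_deriv, (h2 i).deriv, h1.deriv]
    simp [frameField]
  · rintro ⟨h1, h2⟩
    refine h1.prodMk (hasDerivAt_pi.2 fun i ↦ ?_)
    obtain ⟨h3, h4⟩ := h2 i
    refine h3.hasDerivAt.congr_deriv ?_
    rw [covD, fderiv_apply_one_eq_deriv, fderiv_apply_one_eq_deriv, h1.deriv] at h4
    rw [← h4]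
    simp

lemma contDiffAt_frameField {P : Type*} [NormedAddCommGroup P] [NormedSpace ℝ P] {A : Set E4}
    {gl : E4 → E4 →L[ℝ] E4 →L[ℝ] ℝ} {Ch : E4 → E4 →L[ℝ] E4 →L[ℝ] E4} (H : CoordGeom A gl Ch)
    (c : Fin 4 → ℝ) {K : P → Matrix (Fin 4) (Fin 4) ℝ} {u : P → FrameE} {p : P}
    (hA : (u p).1 ∈ A) (hK : ∀ i j, ContDiffAt ℝ ∞ (fun p ↦ K p i j) p)
    (hu : ContDiffAt ℝ ∞ u p) : ContDiffAt ℝ ∞ (fun p ↦ frameField Ch c (K p) (u p)) p := by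
  have hu2 : ∀ i, ContDiffAt ℝ ∞ (fun p ↦ (u p).2 i) p := contDiffAt_pi.1 hu.snd
  have hv : ContDiffAt ℝ ∞ (fun p ↦ ∑ j, c j • (u p).2 j) p :=
    ContDiffAt.sum fun j _ ↦ (contDiffAt_const (c := c j)).smul (hu2 j)
  refine hv.prodMk (contDiffAt_pi.2 fun i ↦ ?_)
  refine (ContDiffAt.sum fun j _ ↦ (hK i j).smul (hu2 j)).sub ?_
  exact (((H.contDiffAt_Ch hA).comp p hu.fst).clm_apply hv).clm_apply (hu2 i)

end FrameCoordinates

/-! ### Curves of frames on the manifold and their uniqueness -/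

section Frames

variable {M : Type*} [TopologicalSpace M] [ChartedSpace E4 M]

local notation "φ[" x "]" => extChartAt 𝓘(ℝ, E4) x

variable (M) in
/-- A point of `M` together with four tangent vectors. -/
def FrameM : Type _ := Σ x : M, Fin 4 → Tan M x

/-- The coordinates of a frame. -/
def frameCoord (x₀ : M) (X : FrameM M) : FrameE := (φ[x₀] X.1, fun i ↦ toCoord x₀ X.1 (X.2 i))

/-- The frame with given coordinates. -/
def frameOfCoord (x₀ : M) (p : FrameE) : FrameM M :=
  ⟨(φ[x₀]).symm p.1, fun i ↦ ofCoord x₀ p.1 (p.2 i)⟩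

variable [IsManifold 𝓘(ℝ, E4) ∞ M]

lemma frameCoord_frameOfCoord {x₀ : M} {p : FrameE} (hp : p.1 ∈ (φ[x₀]).target) :
    frameCoord x₀ (frameOfCoord x₀ p) = p :=
  Prod.ext ((φ[x₀]).right_inv hp) (funext fun i ↦ toCoord_ofCoord hp (p.2 i))

lemma frameCoord_injOn {x₀ : M} {X Y : FrameM M} (hX : X.1 ∈ (φ[x₀]).source)
    (hY : Y.1 ∈ (φ[x₀]).source) (h : frameCoord x₀ X = frameCoord x₀ Y) : X = Y := by
  obtain ⟨x, v⟩ := X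
  obtain ⟨y, w⟩ := Y
  have h1 : x = y := (φ[x₀]).injOn hX hY (congrArg Prod.fst h)
  subst h1
  have h2 : v = w := funext fun i ↦ toCoord_injective hX (congrFun (congrArg Prod.snd h) i)
  rw [h2]

lemma frameOfCoord_frameCoord {x₀ : M} {X : FrameM M} (hX : X.1 ∈ (φ[x₀]).source) :
    frameOfCoord x₀ (frameCoord x₀ X) = X := by
  have h1 : (frameCoord x₀ X).1 ∈ (φ[x₀]).target := (φ[x₀]).map_source hX
  exact frameCoord_injOn ((φ[x₀]).map_target h1) hX (frameCoord_frameOfCoord h1)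

variable {P : Type*} [NormedAddCommGroup P] [NormedSpace ℝ P]

/-- Smoothness of a map into the space of frames. -/
structure IsSmoothFrameAt (Z : P → FrameM M) (p : P) : Prop where
  continuousAt : ContinuousAt (fun q ↦ (Z q).1) p
  contDiffAt : ∀ x₀, (Z p).1 ∈ (φ[x₀]).source → ContDiffAt ℝ ∞ (fun q ↦ frameCoord x₀ (Z q)) p

lemma frameCoord_trans {x₀ x₁ : M} {X : FrameM M} (h : X.1 ∈ (φ[x₀]).source)
    (h' : X.1 ∈ (φ[x₁]).source) :
    frameCoord x₁ X = (trans x₀ x₁ (frameCoord x₀ X).1,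
      fun i ↦ fderiv ℝ (trans x₀ x₁) (frameCoord x₀ X).1 ((frameCoord x₀ X).2 i)) :=
  Prod.ext (trans_apply h).symm (funext fun i ↦ (fderiv_trans_toCoord h h' (X.2 i)).symm)

lemma IsSmoothFrameAt.of_chart {Z : P → FrameM M} {p : P} {x₀ : M}
    (hc : ContinuousAt (fun q ↦ (Z q).1) p) (h : (Z p).1 ∈ (φ[x₀]).source)
    (hZ : ContDiffAt ℝ ∞ (fun q ↦ frameCoord x₀ (Z q)) p) : IsSmoothFrameAt Z p := by
  refine ⟨hc, fun x₁ h' ↦ ?_⟩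
  have hev : (fun q ↦ frameCoord x₁ (Z q)) =ᶠ[nhds p]
      fun q ↦ (trans x₀ x₁ (frameCoord x₀ (Z q)).1,
        fun i ↦ fderiv ℝ (trans x₀ x₁) (frameCoord x₀ (Z q)).1 ((frameCoord x₀ (Z q)).2 i)) := by
    filter_upwards [eventually_mem_source hc h, eventually_mem_source hc h'] with q hq hq'
    exact frameCoord_trans hq hq'
  refine ContDiffAt.congr_of_eventuallyEq ?_ hev
  have hs : (φ[x₀]).symm (frameCoord x₀ (Z p)).1 ∈ (φ[x₁]).source := by
    rw [frameCoord, (φ[x₀]).left_inv h]; exact h'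
  have ht : ContDiffAt ℝ ∞ (trans x₀ x₁) (frameCoord x₀ (Z p)).1 :=
    contDiffAt_trans ((φ[x₀]).map_source h) hs
  have hZ2 : ∀ i, ContDiffAt ℝ ∞ (fun q ↦ (frameCoord x₀ (Z q)).2 i) p := contDiffAt_pi.1 hZ.snd
  refine ContDiffAt.prodMk (ContDiffAt.comp p (g := trans x₀ x₁) ht hZ.fst) ?_
  refine contDiffAt_pi.2 fun i ↦ ?_
  exact (ContDiffAt.comp p (g := fderiv ℝ (trans x₀ x₁)) (ht.fderiv_right (m := ∞) (by simp))
    hZ.fst).clm_apply (hZ2 i)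

lemma IsSmoothFrameAt.congr {Z Z' : P → FrameM M} {p : P} (h : IsSmoothFrameAt Z p)
    (he : Z' =ᶠ[nhds p] Z) : IsSmoothFrameAt Z' p := by
  refine ⟨h.continuousAt.congr (he.symm.fun_comp Sigma.fst), fun x₀ hx ↦ ?_⟩
  rw [he.eq_of_nhds] at hx
  exact (h.contDiffAt x₀ hx).congr_of_eventuallyEq (he.fun_comp (frameCoord x₀))

lemma isSmoothFrameAt_frameOfCoord {u : P → FrameE} {p : P} {x₀ : M}
    (h : (u p).1 ∈ (φ[x₀]).target) (hu : ContDiffAt ℝ ∞ u p) :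
    IsSmoothFrameAt (fun q ↦ frameOfCoord x₀ (u q)) p := by
  have hc : ContinuousAt (fun q ↦ (φ[x₀]).symm (u q).1) p :=
    ContinuousAt.comp (f := fun q ↦ (u q).1) (((continuousOn_extChartAt_symm x₀).continuousAt
      ((isOpen_extChartAt_target x₀).mem_nhds h))) hu.continuousAt.fst
  refine IsSmoothFrameAt.of_chart (x₀ := x₀) hc ((φ[x₀]).map_target h) ?_
  refine hu.congr_of_eventuallyEq ?_
  filter_upwards [hu.continuousAt.fst.eventually_mem ((isOpen_extChartAt_target x₀).mem_nhds h)]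
    with q hq
  exact frameCoord_frameOfCoord hq

lemma IsSmoothFrameAt.comp {Q : Type*} [NormedAddCommGroup Q] [NormedSpace ℝ Q]
    {Z : P → FrameM M} {f : Q → P} {y : Q} (h : IsSmoothFrameAt Z (f y))
    (hf : ContDiffAt ℝ ∞ f y) : IsSmoothFrameAt (fun y ↦ Z (f y)) y :=
  ⟨ContinuousAt.comp (f := f) (g := fun q ↦ (Z q).1) h.continuousAt hf.continuousAt,
    fun x₀ hx ↦ ContDiffAt.comp y (g := fun q ↦ frameCoord x₀ (Z q)) (h.contDiffAt x₀ hx) hf⟩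

namespace SemiRiemannianMetric

variable {q : ℕ} (g : SemiRiemannianMetric M q)

/-- The curve `X` of frames satisfies `y' = ∑ cⱼ eⱼ`, `∇eᵢ = ∑ Kᵢⱼ eⱼ` at `s`. -/
structure IsFrameSol (c : Fin 4 → ℝ) (K : Matrix (Fin 4) (Fin 4) ℝ) (X : ℝ → FrameM M)
    (s : ℝ) : Prop where
  continuousAt : ContinuousAt (fun τ ↦ (X τ).1) s
  hasDerivAt : ∀ x₀, (X s).1 ∈ (φ[x₀]).source → HasDerivAt (fun τ ↦ frameCoord x₀ (X τ))
    (frameField (g.coordChristoffel x₀) c K (frameCoord x₀ (X s))) s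

variable {g} {c : Fin 4 → ℝ} {K : Matrix (Fin 4) (Fin 4) ℝ} {X X' : ℝ → FrameM M} {s : ℝ}

/-- The frame equations are tensorial: the velocity transforms by the differential of the chart
change, and so does the covariant derivative by `covD_trans`. Solutions produced in one chart thus
solve the equations in every chart. -/
lemma IsFrameSol.of_chart {x₀ : M} (hc : ContinuousAt (fun τ ↦ (X τ).1) s)
    (h : (X s).1 ∈ (φ[x₀]).source) (hX : HasDerivAt (fun τ ↦ frameCoord x₀ (X τ))
      (frameField (g.coordChristoffel x₀) c K (frameCoord x₀ (X s))) s) :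
    g.IsFrameSol c K X s := by
  refine ⟨hc, fun x₁ h' ↦ ?_⟩
  obtain ⟨h1, h2⟩ := hasDerivAt_frameField_iff.1 hX
  have hs : (φ[x₀]).symm (frameCoord x₀ (X s)).1 ∈ (φ[x₁]).source := by
    rw [frameCoord, (φ[x₀]).left_inv h]; exact h'
  have ht : ContDiffAt ℝ ∞ (trans x₀ x₁) (frameCoord x₀ (X s)).1 :=
    contDiffAt_trans ((φ[x₀]).map_source h) hs
  have hev : (fun τ ↦ frameCoord x₁ (X τ)) =ᶠ[nhds s]
      fun τ ↦ (trans x₀ x₁ (frameCoord x₀ (X τ)).1,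
        fun i ↦ fderiv ℝ (trans x₀ x₁) (frameCoord x₀ (X τ)).1 ((frameCoord x₀ (X τ)).2 i)) := by
    filter_upwards [eventually_mem_source hc h, eventually_mem_source hc h'] with q hq hq'
    exact frameCoord_trans hq hq'
  have hsum : ∀ d : Fin 4 → ℝ, ∑ j, d j • (frameCoord x₁ (X s)).2 j =
      fderiv ℝ (trans x₀ x₁) (frameCoord x₀ (X s)).1 (∑ j, d j • (frameCoord x₀ (X s)).2 j) := by
    intro d
    rw [map_sum, frameCoord_trans h h']
    simp only [map_smul]
  rw [hasDerivAt_frameField_iff]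
  refine ⟨?_, fun i ↦ ⟨?_, ?_⟩⟩
  · rw [hsum]
    have := (ht.differentiableAt (by simp)).hasFDerivAt.comp_hasDerivAt s h1
    exact this.congr_of_eventuallyEq (hev.fun_comp Prod.fst)
  · refine DifferentiableAt.congr_of_eventuallyEq ?_ (hev.fun_comp fun z ↦ z.2 i)
    exact (DifferentiableAt.comp s (g := fderiv ℝ (trans x₀ x₁))
      ((ht.fderiv_right (m := ∞) (by simp)).differentiableAt (by simp))
      h1.differentiableAt).clm_apply (h2 i).1
  · rw [hsum, ← (h2 i).2]
    exact g.covD_trans (f := fun τ ↦ (X τ).1) (X := fun τ ↦ (X τ).2 i) hc h h'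
      h1.differentiableAt (h2 i).1 (1 : ℝ)

lemma IsFrameSol.congr (h : g.IsFrameSol c K X s) (he : X' =ᶠ[nhds s] X) :
    g.IsFrameSol c K X' s := by
  refine ⟨h.continuousAt.congr (he.symm.fun_comp Sigma.fst), fun x₀ hx ↦ ?_⟩
  rw [he.eq_of_nhds] at hx ⊢
  exact (h.hasDerivAt x₀ hx).congr_of_eventuallyEq (he.fun_comp (frameCoord x₀))

lemma IsFrameSol.eventuallyEq {K : ℝ → Matrix (Fin 4) (Fin 4) ℝ}
    (hK : ∀ i j, ContDiffAt ℝ ∞ (fun τ ↦ K τ i j) s)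
    (hX : ∀ᶠ τ in nhds s, g.IsFrameSol c (K τ) X τ)
    (hX' : ∀ᶠ τ in nhds s, g.IsFrameSol c (K τ) X' τ) (h : X s = X' s) : X =ᶠ[nhds s] X' := by
  have hx := mem_extChartAt_source (I := 𝓘(ℝ, E4)) (X s).1
  have hx' : (X' s).1 ∈ (φ[(X s).1]).source := by rw [← h]; exact hx
  have e1 := eventually_mem_source hX.self_of_nhds.continuousAt hx
  have e2 := eventually_mem_source hX'.self_of_nhds.continuousAt hx'
  have key := ode_eventuallyEq (s := s) (x := fun τ ↦ frameCoord (X s).1 (X τ))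
    (y := fun τ ↦ frameCoord (X s).1 (X' τ))
    (f := fun z : ℝ × FrameE ↦ frameField (g.coordChristoffel (X s).1) c (K z.1) z.2) ?_ ?_ ?_ ?_
  · filter_upwards [e1, e2, key] with τ h1 h2 h3
    exact frameCoord_injOn h1 h2 h3
  · refine ContDiffAt.of_le (contDiffAt_frameField (g.coordGeom (X s).1) c
      (K := fun z : ℝ × FrameE ↦ K z.1) (u := fun z : ℝ × FrameE ↦ z.2)
      ((φ[(X s).1]).map_source hx) (fun i j ↦ ?_) contDiffAt_snd) (by simp)
    exact ContDiffAt.comp (s, frameCoord (X s).1 (X s)) (g := fun τ ↦ K τ i j) (hK i j)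
      contDiffAt_fst
  · filter_upwards [e1, hX] with τ h1 h2
    exact h2.hasDerivAt _ h1
  · filter_upwards [e2, hX'] with τ h1 h2
    exact h2.hasDerivAt _ h1
  · exact congrArg (frameCoord (X s).1) h

lemma IsFrameSol.eqOn [T2Space M] {K : ℝ → Matrix (Fin 4) (Fin 4) ℝ} {I : Set ℝ} (hI : IsOpen I)
    (hI' : IsPreconnected I) (hK : ∀ s ∈ I, ∀ i j, ContDiffAt ℝ ∞ (fun τ ↦ K τ i j) s)
    (hX : ∀ s ∈ I, g.IsFrameSol c (K s) X s) (hX' : ∀ s ∈ I, g.IsFrameSol c (K s) X' s)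
    {s₀ : ℝ} (hs₀ : s₀ ∈ I) (h : X s₀ = X' s₀) : Set.EqOn X X' I := by
  have hloc : ∀ s ∈ I, X s = X' s → X =ᶠ[nhds s] X' := fun s hs h ↦
    IsFrameSol.eventuallyEq (hK s hs) ((hI.eventually_mem hs).mono hX)
      ((hI.eventually_mem hs).mono hX') h
  have key : I ⊆ {s | X =ᶠ[nhds s] X'} := by
    refine hI'.subset_of_closure_inter_subset isOpen_setOfPred_eventually_nhds
      ⟨s₀, hs₀, hloc s₀ hs₀ h⟩ ?_
    rintro s ⟨hcl, hs⟩
    refine hloc s hs ?_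
    -- At a limit point the base points coincide because `M` is Hausdorff; then both frames lie in
    -- one chart and their coordinates coincide by continuity.
    have hfr : ∃ᶠ τ in nhds s, X τ = X' τ :=
      (mem_closure_iff_frequently.1 hcl).mono fun τ hτ ↦ hτ.eq_of_nhds
    have hb : (X s).1 = (X' s).1 :=
      tendsto_nhds_unique_of_frequently_eq (hX s hs).continuousAt (hX' s hs).continuousAt
        (hfr.mono fun τ hτ ↦ congrArg Sigma.fst hτ)
    have hx := mem_extChartAt_source (I := 𝓘(ℝ, E4)) (X s).1
    have hx' : (X' s).1 ∈ (φ[(X s).1]).source := by rw [← hb]; exact hx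
    exact frameCoord_injOn hx hx' (tendsto_nhds_unique_of_frequently_eq
      ((hX s hs).hasDerivAt _ hx).continuousAt ((hX' s hs).hasDerivAt _ hx').continuousAt
        (hfr.mono fun τ hτ ↦ congrArg (frameCoord _) hτ))
  exact fun s hs ↦ (key hs).eq_of_nhds

end SemiRiemannianMetric

end Frames

/-! ### Existence of smooth families of frames -/

section FrameFlow

variable {M : Type*} [TopologicalSpace M] [ChartedSpace E4 M] [IsManifold 𝓘(ℝ, E4) ∞ M]

local notation "φ[" x "]" => extChartAt 𝓘(ℝ, E4) x

namespace SemiRiemannianMetric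

variable {q : ℕ} {g : SemiRiemannianMetric M q} {c : Fin 4 → ℝ} {J : Set ℝ}
  {K : ℝ × ℝ → Matrix (Fin 4) (Fin 4) ℝ} {X : ℝ → FrameM M}

/-- Solutions with constant coefficients and given initial value. -/
lemma exists_isFrameSol (g : SemiRiemannianMetric M q) (c : Fin 4 → ℝ)
    (K : Matrix (Fin 4) (Fin 4) ℝ) (X₀ : FrameM M) :
    ∃ ε > 0, ∃ X : ℝ → FrameM M, X 0 = X₀ ∧
      ∀ t ∈ Set.Ioo (-ε) ε, g.IsFrameSol c K X t ∧ IsSmoothFrameAt X t := by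
  have hx := mem_extChartAt_source (I := 𝓘(ℝ, E4)) X₀.1
  set x₀ := X₀.1
  have hΩ : IsOpen {z : ℝ × ℝ × FrameE | z.2.2.1 ∈ (φ[x₀]).target} :=
    (isOpen_extChartAt_target x₀).preimage (by fun_prop : Continuous fun z : ℝ × ℝ × FrameE ↦ z.2.2.1)
  obtain ⟨ε, hε, Φ, hΦ⟩ := exists_local_flow_param (z₀ := (0, 0, frameCoord x₀ X₀))
    (f := fun z : ℝ × ℝ × FrameE ↦ frameField (g.coordChristoffel x₀) c K z.2.2) hΩ
    (fun z hz ↦ (contDiffAt_frameField (g.coordGeom x₀) c (K := fun _ ↦ K)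
      (u := fun z : ℝ × ℝ × FrameE ↦ z.2.2) hz
      (fun i j ↦ contDiffAt_const) contDiffAt_snd.snd).contDiffWithinAt)
    ((φ[x₀]).map_source hx)
  obtain ⟨h0, h1⟩ := hΦ _ (Metric.mem_ball_self hε)
  set z₀ : ℝ × ℝ × FrameE := (0, 0, frameCoord x₀ X₀)
  refine ⟨ε, hε, fun t ↦ frameOfCoord x₀ (Φ (z₀, t)), ?_, fun t ht ↦ ?_⟩
  · simp only [h0]
    exact frameOfCoord_frameCoord hx
  · obtain ⟨h2, h3, h4⟩ := h1 t ht
    have h5 : ContDiffAt ℝ ∞ (fun t ↦ Φ (z₀, t)) t :=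
      ContDiffAt.comp t h2 (contDiffAt_const.prodMk contDiffAt_id)
    have h6 := isSmoothFrameAt_frameOfCoord (u := fun t ↦ Φ (z₀, t)) h3 h5
    refine ⟨IsFrameSol.of_chart (x₀ := x₀) h6.continuousAt ((φ[x₀]).map_target h3) ?_, h6⟩
    rw [frameCoord_frameOfCoord h3]
    refine h4.congr_of_eventuallyEq ?_
    filter_upwards [h5.continuousAt.fst.eventually_mem
      ((isOpen_extChartAt_target x₀).mem_nhds h3)] with τ hτ
    exact frameCoord_frameOfCoord hτ

/-- Smooth families of solutions near a given solution with prescribed initial values. -/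
lemma exists_local_family (hJ : IsOpen J)
    (hK : ∀ s ∈ J, ∀ t i j, ContDiffAt ℝ ∞ (fun p ↦ K p i j) (s, t))
    (hX : ∀ s ∈ J, g.IsFrameSol c (K (s, 0)) X s) {s₁ : ℝ} (hs₁ : s₁ ∈ J) :
    ∃ δ > 0, Set.Ioo (s₁ - δ) (s₁ + δ) ⊆ J ∧ ∀ s₂ ∈ Set.Ioo (s₁ - δ) (s₁ + δ),
      ∀ X₂ : ℝ → FrameM M, X₂ 0 = X s₂ → (∀ᶠ t in nhds 0, IsSmoothFrameAt X₂ t) →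
      ∃ Y : ℝ × ℝ → FrameM M, ∀ᶠ t in nhds 0, Y (s₂, t) = X₂ t ∧
        ∀ s ∈ Set.Ioo (s₁ - δ) (s₁ + δ), IsSmoothFrameAt Y (s, t) ∧
          g.IsFrameSol c (K (s, t)) (fun s ↦ Y (s, t)) s := by
  have hx := mem_extChartAt_source (I := 𝓘(ℝ, E4)) (X s₁).1
  set x₀ := (X s₁).1
  have hΩ : IsOpen {z : ℝ × ℝ × FrameE | z.1 ∈ J ∧ z.2.2.1 ∈ (φ[x₀]).target} :=
    (hJ.preimage (by fun_prop : Continuous fun z : ℝ × ℝ × FrameE ↦ z.1)).inter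
    ((isOpen_extChartAt_target x₀).preimage
      (by fun_prop : Continuous fun z : ℝ × ℝ × FrameE ↦ z.2.2.1))
  obtain ⟨ε, hε, Φ, hΦ⟩ := exists_local_flow_param (z₀ := (s₁, 0, frameCoord x₀ (X s₁)))
    (f := fun z : ℝ × ℝ × FrameE ↦ frameField (g.coordChristoffel x₀) c (K (z.1, z.2.1)) z.2.2) hΩ
    (fun z hz ↦ (contDiffAt_frameField (g.coordGeom x₀) c
      (K := fun z : ℝ × ℝ × FrameE ↦ K (z.1, z.2.1))
      (u := fun z : ℝ × ℝ × FrameE ↦ z.2.2) hz.2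
      (fun i j ↦ ContDiffAt.comp z (g := fun p ↦ K p i j)
        (f := fun z : ℝ × ℝ × FrameE ↦ (z.1, z.2.1)) (hK z.1 hz.1 z.2.1 i j)
        (contDiffAt_fst.prodMk contDiffAt_snd.fst)) contDiffAt_snd.snd).contDiffWithinAt)
    ⟨hs₁, (φ[x₀]).map_source hx⟩
  have hc : ContinuousAt (fun s ↦ (s, (0 : ℝ), frameCoord x₀ (X s))) s₁ :=
    continuousAt_id.prodMk (continuousAt_const.prodMk
      ((hX s₁ hs₁).hasDerivAt x₀ hx).continuousAt)
  have hev : ∀ᶠ s in nhds s₁, s ∈ J ∧ (X s).1 ∈ (φ[x₀]).source ∧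
      (s, (0 : ℝ), frameCoord x₀ (X s)) ∈ Metric.ball (s₁, (0 : ℝ), frameCoord x₀ (X s₁)) ε :=
    (hJ.eventually_mem hs₁).and ((eventually_mem_source (hX s₁ hs₁).continuousAt hx).and
      (hc.eventually_mem (Metric.ball_mem_nhds _ hε)))
  obtain ⟨δ₀, hδ₀, hb⟩ := Metric.eventually_nhds_iff_ball.1 hev
  rw [Real.ball_eq_Ioo] at hb
  set z₀ : ℝ × ℝ × FrameE := (s₁, 0, frameCoord x₀ (X s₁))
  -- The bound δ ≤ ε/2 ensures |s − s₂| < ε for any two points of the interval, so a flow started at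
  -- any `s₂` covers all of it.
  have hδ1 := min_le_left δ₀ (ε / 2)
  have hδ2 := min_le_right δ₀ (ε / 2)
  have hsub : Set.Ioo (s₁ - min δ₀ (ε / 2)) (s₁ + min δ₀ (ε / 2)) ⊆
      Set.Ioo (s₁ - δ₀) (s₁ + δ₀) := Set.Ioo_subset_Ioo (by linarith) (by linarith)
  refine ⟨min δ₀ (ε / 2), lt_min hδ₀ (by linarith), fun s hs ↦ (hb s (hsub hs)).1, ?_⟩
  intro s₂ hs₂ X₂ hX₂ hsm
  obtain ⟨-, hm2, hb2⟩ := hb s₂ (hsub hs₂)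
  -- For each t the flow runs for time s − s₂ from the prescribed frame `X₂ t` at `s₂`. Keeping `s₂`
  -- free inside the interval is what allows continuation from a nearby point.
  refine ⟨fun p ↦ frameOfCoord x₀ (Φ ((s₂, p.2, frameCoord x₀ (X₂ p.2)), p.1 - s₂)), ?_⟩
  rw [← hX₂] at hm2 hb2
  have hc2 : ContinuousAt (fun t ↦ (s₂, t, frameCoord x₀ (X₂ t))) 0 :=
    continuousAt_const.prodMk (continuousAt_id.prodMk
      (hsm.self_of_nhds.contDiffAt x₀ hm2).continuousAt)
  filter_upwards [hsm, eventually_mem_source hsm.self_of_nhds.continuousAt hm2,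
    hc2.eventually_mem (Metric.isOpen_ball.mem_nhds hb2)] with t ht1 ht2 ht3
  obtain ⟨h0, h1⟩ := hΦ _ ht3
  refine ⟨?_, fun s hs ↦ ?_⟩
  · simp only [sub_self, h0]
    exact frameOfCoord_frameCoord ht2
  have hτ : s - s₂ ∈ Set.Ioo (-ε) ε :=
    ⟨by linarith [hs.1, hs₂.2], by linarith [hs.2, hs₂.1]⟩
  obtain ⟨h2, h3, h4⟩ := h1 _ hτ
  simp only [Set.mem_ofPred_eq, add_sub_cancel] at h3 h4
  have h5 : ContDiffAt ℝ ∞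
      (fun p : ℝ × ℝ ↦ Φ ((s₂, p.2, frameCoord x₀ (X₂ p.2)), p.1 - s₂)) (s, t) := by
    refine ContDiffAt.comp (s, t) (g := Φ)
      (f := fun p : ℝ × ℝ ↦ ((s₂, p.2, frameCoord x₀ (X₂ p.2)), p.1 - s₂)) h2 ?_
    refine (contDiffAt_const.prodMk (contDiffAt_snd.prodMk ?_)).prodMk
      (contDiffAt_fst.sub contDiffAt_const)
    exact ContDiffAt.comp (s, t) (g := fun t ↦ frameCoord x₀ (X₂ t)) (f := Prod.snd)
      (ht1.contDiffAt x₀ ht2) contDiffAt_snd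
  have h6 := isSmoothFrameAt_frameOfCoord
    (u := fun p : ℝ × ℝ ↦ Φ ((s₂, p.2, frameCoord x₀ (X₂ p.2)), p.1 - s₂)) h3.2 h5
  have h7 := h6.comp (f := fun s : ℝ ↦ (s, t)) (y := s) (contDiffAt_id.prodMk contDiffAt_const)
  refine ⟨h6, IsFrameSol.of_chart (x₀ := x₀) h7.continuousAt ((φ[x₀]).map_target h3.2) ?_⟩
  rw [frameCoord_frameOfCoord h3.2]
  have h8 : HasDerivAt (fun s ↦ Φ ((s₂, t, frameCoord x₀ (X₂ t)), s - s₂)) _ s :=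
    h4.comp_sub_const s s₂
  refine h8.congr_of_eventuallyEq ?_
  filter_upwards [h8.continuousAt.fst.eventually_mem
      ((isOpen_extChartAt_target x₀).mem_nhds h3.2)] with τ hτ
  exact frameCoord_frameOfCoord hτ

/-- `X'` is a solution for the parameter `t` on an interval which contains `s₀` and `s`. -/
def IsFrameSolThrough (g : SemiRiemannianMetric M q) (c : Fin 4 → ℝ)
    (K : ℝ × ℝ → Matrix (Fin 4) (Fin 4) ℝ) (J : Set ℝ) (s₀ : ℝ) (X₀ : FrameM M) (t : ℝ)
    (I : Set ℝ) (X' : ℝ → FrameM M) : Prop :=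
  IsOpen I ∧ I.OrdConnected ∧ I ⊆ J ∧ s₀ ∈ I ∧ X' s₀ = X₀ ∧
    ∀ s ∈ I, g.IsFrameSol c (K (s, t)) X' s

lemma contDiffAt_slice {K : ℝ × ℝ → Matrix (Fin 4) (Fin 4) ℝ} {s t : ℝ} {i j : Fin 4}
    (hK : ContDiffAt ℝ ∞ (fun p ↦ K p i j) (s, t)) :
    ContDiffAt ℝ ∞ (fun τ ↦ K (τ, t) i j) s :=
  ContDiffAt.comp s (g := fun p ↦ K p i j) (f := fun τ ↦ (τ, t)) hK
    (contDiffAt_id.prodMk contDiffAt_const)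

lemma IsFrameSolThrough.eqOn [T2Space M]
    (hK : ∀ s ∈ J, ∀ t i j, ContDiffAt ℝ ∞ (fun p ↦ K p i j) (s, t)) {s₀ t : ℝ}
    {X₀ : FrameM M} {I I' : Set ℝ} {X' X'' : ℝ → FrameM M}
    (h : g.IsFrameSolThrough c K J s₀ X₀ t I X') (h' : g.IsFrameSolThrough c K J s₀ X₀ t I' X'') :
    Set.EqOn X' X'' (I ∩ I') := by
  obtain ⟨h1, h2, h3, h4, h5, h6⟩ := h
  obtain ⟨h1', h2', h3', h4', h5', h6'⟩ := h'
  exact IsFrameSol.eqOn (h1.inter h1') (h2.inter h2').isPreconnected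
    (fun s hs i j ↦ contDiffAt_slice (hK s (h3 hs.1) t i j))
    (fun s hs ↦ h6 s hs.1) (fun s hs ↦ h6' s hs.2) ⟨h4, h4'⟩ (h5.trans h5'.symm)

/-- Two solutions agreeing at one common point agree on the whole overlap, so they glue. This is the
continuation step. -/
lemma IsFrameSolThrough.union [T2Space M]
    (hK : ∀ s ∈ J, ∀ t i j, ContDiffAt ℝ ∞ (fun p ↦ K p i j) (s, t)) {s₀ t : ℝ}
    {X₀ : FrameM M} {I I' : Set ℝ} {X' X'' : ℝ → FrameM M}
    (h : g.IsFrameSolThrough c K J s₀ X₀ t I X') (h1' : IsOpen I') (h2' : I'.OrdConnected)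
    (h3' : I' ⊆ J) (h6' : ∀ s ∈ I', g.IsFrameSol c (K (s, t)) X'' s) {s₂ : ℝ} (hs : s₂ ∈ I)
    (hs' : s₂ ∈ I') (heq : X' s₂ = X'' s₂) :
    ∃ X''', g.IsFrameSolThrough c K J s₀ X₀ t (I ∪ I') X''' ∧ Set.EqOn X''' X'' I' := by
  classical
  obtain ⟨h1, h2, h3, h4, h5, h6⟩ := h
  have he : Set.EqOn X' X'' (I ∩ I') :=
    IsFrameSol.eqOn (h1.inter h1') (h2.inter h2').isPreconnected
    (fun s hs i j ↦ contDiffAt_slice (hK s (h3 hs.1) t i j))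
    (fun s hs ↦ h6 s hs.1) (fun s hs ↦ h6' s hs.2) ⟨hs, hs'⟩ heq
  have e1 : ∀ s ∈ I, (fun s ↦ if s ∈ I then X' s else X'' s) s = X' s := fun s hs ↦ if_pos hs
  have e2 : ∀ s ∈ I', (fun s ↦ if s ∈ I then X' s else X'' s) s = X'' s := by
    intro s hs
    by_cases hI : s ∈ I
    · exact (if_pos hI).trans (he ⟨hI, hs⟩)
    · exact if_neg hI
  refine ⟨fun s ↦ if s ∈ I then X' s else X'' s, ⟨h1.union h1', ?_, Set.union_subset h3 h3',
    Or.inl h4, (e1 s₀ h4).trans h5, ?_⟩, e2⟩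
  · exact (IsPreconnected.union s₂ hs hs' h2.isPreconnected h2'.isPreconnected).ordConnected
  · rintro s (hs | hs)
    · exact (h6 s hs).congr ((h1.eventually_mem hs).mono e1)
    · exact (h6' s hs).congr ((h1'.eventually_mem hs).mono e2)

/-- Extension of a one-parameter family of initial values to a smooth family of solutions, near a
given solution. -/
theorem exists_frame_family [T2Space M] (hJ : IsOpen J) (hJ' : J.OrdConnected)
    (hK : ∀ s ∈ J, ∀ t i j, ContDiffAt ℝ ∞ (fun p ↦ K p i j) (s, t))
    (hX : ∀ s ∈ J, g.IsFrameSol c (K (s, 0)) X s) {s₀ : ℝ} (hs₀ : s₀ ∈ J)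
    {X₀ : ℝ → FrameM M} (h0 : X₀ 0 = X s₀) (hsm : ∀ᶠ t in nhds 0, IsSmoothFrameAt X₀ t) :
    ∃ (U : Set (ℝ × ℝ)) (Z : ℝ × ℝ → FrameM M), IsOpen U ∧ (∀ s ∈ J, (s, (0 : ℝ)) ∈ U) ∧
      (∀ s ∈ J, Z (s, 0) = X s) ∧ (∀ᶠ t in nhds 0, Z (s₀, t) = X₀ t) ∧
      ∀ p ∈ U, IsSmoothFrameAt Z p ∧
        ∃ I, p.1 ∈ I ∧ g.IsFrameSolThrough c K J s₀ (X₀ p.2) p.2 I fun s ↦ Z (s, p.2) := by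
  classical
  -- `D (s, t)` says that the solution for the parameter t, started at `s₀` from `X₀ t`, reaches s.
  -- By uniqueness the chosen solutions patch to one map `Z`.
  let D : ℝ × ℝ → Prop := fun p ↦ ∃ I X', p.1 ∈ I ∧ g.IsFrameSolThrough c K J s₀ (X₀ p.2) p.2 I X'
  let Z : ℝ × ℝ → FrameM M := fun p ↦
    if h : D p then h.choose_spec.choose p.1 else X s₀
  have hZ : ∀ {t I X'}, g.IsFrameSolThrough c K J s₀ (X₀ t) t I X' → ∀ s ∈ I, D (s, t) ∧
      Z (s, t) = X' s := by
    intro t I X' h s hs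
    have hD : D (s, t) := ⟨I, X', hs, h⟩
    refine ⟨hD, ?_⟩
    obtain ⟨h1, h2⟩ := hD.choose_spec.choose_spec
    simp only [Z, hD, dif_pos]
    exact h2.eqOn hK h ⟨h1, hs⟩
  -- `J` need not be compact, so no common t-interval is available. Instead the set of s with `Z`
  -- defined and smooth near (s, 0) is shown to be open and relatively closed in `J`.
  let Good : ℝ → Prop := fun s ↦ ∀ᶠ p in nhds (s, (0 : ℝ)), D p ∧ IsSmoothFrameAt Z p
  have hZ0 : ∀ s ∈ J, Z (s, 0) = X s := fun s hs ↦
    (hZ ⟨hJ, hJ', subset_rfl, hs₀, h0.symm, hX⟩ s hs).2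
  have hgood : ∀ {s₁ δ : ℝ} {Y : ℝ × ℝ → FrameM M}, (∀ᶠ t in nhds 0,
      ∀ s ∈ Set.Ioo (s₁ - δ) (s₁ + δ), IsSmoothFrameAt Y (s, t) ∧ D (s, t) ∧ Z (s, t) = Y (s, t)) →
      ∀ s ∈ Set.Ioo (s₁ - δ) (s₁ + δ), Good s := by
    intro s₁ δ Y h s hs
    have h1 : ∀ᶠ p : ℝ × ℝ in nhds (s, (0 : ℝ)), IsSmoothFrameAt Y p ∧ D p ∧ Z p = Y p := by
      rw [nhds_prod_eq]
      filter_upwards [Filter.Eventually.prod_mk (isOpen_Ioo.eventually_mem hs) h] with p hp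
      exact hp.2 p.1 hp.1
    filter_upwards [h1, h1.eventually_nhds] with p hp hp'
    exact ⟨hp.2.1, hp.1.congr (hp'.mono fun z hz ↦ hz.2.2)⟩
  have hstart : Good s₀ ∧ ∀ᶠ t in nhds 0, Z (s₀, t) = X₀ t := by
    obtain ⟨δ, hδ, hsub, hloc⟩ := exists_local_family hJ hK hX hs₀
    have hm : s₀ ∈ Set.Ioo (s₀ - δ) (s₀ + δ) := ⟨by linarith, by linarith⟩
    obtain ⟨Y, hY⟩ := hloc s₀ hm X₀ h0 hsm
    have key : ∀ᶠ t in nhds 0, g.IsFrameSolThrough c K J s₀ (X₀ t) t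
        (Set.Ioo (s₀ - δ) (s₀ + δ)) (fun s ↦ Y (s, t)) := by
      filter_upwards [hY] with t ht
      exact ⟨isOpen_Ioo, Set.ordConnected_Ioo, hsub, hm, ht.1, fun s hs ↦ (ht.2 s hs).2⟩
    refine ⟨hgood (s₁ := s₀) (δ := δ) (Y := Y) ?_ s₀ hm, ?_⟩
    · filter_upwards [hY, key] with t ht hk s hs
      exact ⟨(ht.2 s hs).1, hZ hk s hs⟩
    · filter_upwards [hY, key] with t ht hk
      rw [(hZ hk s₀ hm).2, ht.1]
  -- A good point `s₂` close to `s₁` supplies smooth initial data t ↦ Z(s₂, t). The local family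
  -- around `s₁` started there glues with the solutions already reaching `s₂`.
  have hstep : ∀ s₁ ∈ J, s₁ ∈ closure {s | Good s} → Good s₁ := by
    intro s₁ hs₁ hcl
    obtain ⟨δ, hδ, hsub, hloc⟩ := exists_local_family hJ hK hX hs₁
    have hm : s₁ ∈ Set.Ioo (s₁ - δ) (s₁ + δ) := ⟨by linarith, by linarith⟩
    obtain ⟨s₂, hs₂, hg⟩ := mem_closure_iff.1 hcl _ isOpen_Ioo hm
    have hev : ∀ᶠ t in nhds 0, D (s₂, t) ∧ IsSmoothFrameAt Z (s₂, t) :=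
      (tendsto_slice_right s₂ 0).eventually hg
    obtain ⟨Y, hY⟩ := hloc s₂ hs₂ (fun t ↦ Z (s₂, t)) (hZ0 s₂ (hsub hs₂))
      (hev.mono fun t ht ↦ ht.2.comp (f := fun t : ℝ ↦ (s₂, t))
        (contDiffAt_const.prodMk contDiffAt_id))
    refine hgood (s₁ := s₁) (δ := δ) (Y := Y) ?_ s₁ hm
    filter_upwards [hY, hev] with t ht ht' s hs
    obtain ⟨⟨I, X', hI, hsol⟩, -⟩ := ht'
    have he : X' s₂ = Y (s₂, t) := by rw [ht.1, (hZ hsol s₂ hI).2]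
    obtain ⟨X'', hs1, hs2⟩ := hsol.union (X'' := fun s ↦ Y (s, t)) hK isOpen_Ioo
      Set.ordConnected_Ioo hsub (fun s hs ↦ (ht.2 s hs).2) hI hs₂ he
    obtain ⟨hD, hE⟩ := hZ hs1 s (Or.inr hs)
    exact ⟨(ht.2 s hs).1, hD, hE.trans (hs2 hs)⟩
  have hall : J ⊆ {s | Good s} := by
    refine hJ'.isPreconnected.subset_of_closure_inter_subset ?_ ⟨s₀, hs₀, hstart.1⟩
      fun s hs ↦ hstep s hs.2 hs.1
    rw [isOpen_iff_mem_nhds]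
    exact fun s hs ↦ (tendsto_slice_left s 0).eventually (Filter.Eventually.eventually_nhds hs)
  -- The domain is the interior of the set where `Z` is a genuine smooth solution.
  refine ⟨{p | ∀ᶠ p' in nhds p, D p' ∧ IsSmoothFrameAt Z p'}, Z,
    isOpen_setOfPred_eventually_nhds, fun s hs ↦ hall hs, hZ0, hstart.2, fun p hp ↦ ?_⟩
  obtain ⟨⟨I, X', hI, hsol⟩, hsmooth⟩ := hp.self_of_nhds
  refine ⟨hsmooth, I, hI, ?_⟩
  obtain ⟨h1, h2, h3, h4, h5, h6⟩ := id hsol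
  exact ⟨h1, h2, h3, h4, ((hZ hsol s₀ h4).2).trans h5, fun s hs ↦ (h6 s hs).congr
    ((h1.eventually_mem hs).mono fun τ hτ ↦ (hZ hsol τ hτ).2)⟩

end SemiRiemannianMetric

end FrameFlow

/-! ### Defect equations for the t-derivative of a family of frames -/

section CoordinateVariation

variable {E P : Type*} [NormedAddCommGroup E] [NormedSpace ℝ E] [NormedAddCommGroup P]
  [NormedSpace ℝ P] {Ch : E → E →L[ℝ] E →L[ℝ] E}

lemma covD_sub {Y X X' : P → E} {p : P} (hX : DifferentiableAt ℝ X p)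
    (hX' : DifferentiableAt ℝ X' p) (h : P) :
    covD Ch Y (fun q ↦ X q - X' q) h p = covD Ch Y X h p - covD Ch Y X' h p := by
  simp only [covD]
  rw [fderiv_fun_sub hX hX', sub_apply, map_sub]
  abel

lemma differentiableAt_sum_smul {n : ℕ} {f : Fin n → P → ℝ} {X : Fin n → P → E} {p : P}
    (hf : ∀ k, DifferentiableAt ℝ (f k) p) (hX : ∀ k, DifferentiableAt ℝ (X k) p) :
    DifferentiableAt ℝ (fun q ↦ ∑ k, f k q • X k q) p :=
  DifferentiableAt.fun_sum fun k _ ↦ (hf k).fun_smul (hX k)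

lemma covD_sum_smul {n : ℕ} {Y : P → E} {f : Fin n → P → ℝ} {X : Fin n → P → E} {p : P}
    (hf : ∀ k, DifferentiableAt ℝ (f k) p) (hX : ∀ k, DifferentiableAt ℝ (X k) p) (h : P) :
    covD Ch Y (fun q ↦ ∑ k, f k q • X k q) h p =
      ∑ k, (fderiv ℝ (f k) p h • X k p + f k p • covD Ch Y (X k) h p) := by
  have h1 : fderiv ℝ (fun q ↦ ∑ k, f k q • X k q) p h =
      ∑ k, (f k p • fderiv ℝ (X k) p h + fderiv ℝ (f k) p h • X k p) := by
    rw [fderiv_fun_sum fun k _ ↦ (hf k).fun_smul (hX k), sum_apply]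
    refine Finset.sum_congr rfl fun k _ ↦ ?_
    rw [fderiv_fun_smul (hf k) (hX k)]
    simp
  simp only [covD, h1, map_sum, map_smul, smul_add]
  rw [← Finset.sum_add_distrib]
  refine Finset.sum_congr rfl fun k _ ↦ ?_
  abel

variable {A : Set E} {gl : E → E →L[ℝ] E →L[ℝ] ℝ} {Y : ℝ × ℝ → E} {e : Fin 4 → ℝ × ℝ → E}
  {K : ℝ × ℝ → Matrix (Fin 4) (Fin 4) ℝ} {v : Fin 4 → ℝ → ℝ} {Ω : ℝ → Matrix (Fin 4) (Fin 4) ℝ}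
  {v' : Fin 4 → ℝ} {Ω' L : Matrix (Fin 4) (Fin 4) ℝ} {s t : ℝ}

lemma fderiv_comp_fst {f : ℝ → ℝ} {f' : ℝ} (hf : HasDerivAt f f' s) :
    DifferentiableAt ℝ (fun p : ℝ × ℝ ↦ f p.1) (s, t) ∧
      fderiv ℝ (fun p : ℝ × ℝ ↦ f p.1) (s, t) (1, 0) = f' := by
  have h1 : HasFDerivAt (fun p : ℝ × ℝ ↦ f p.1) _ (s, t) :=
    HasFDerivAt.comp (s, t) (f := Prod.fst) hf.hasFDerivAt hasFDerivAt_fst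
  refine ⟨h1.differentiableAt, ?_⟩
  rw [h1.fderiv]
  simp

namespace CoordGeom

/-- The propagation of the defect of the variation field of a family of frames. -/
lemma covD_defect (H : CoordGeom A gl Ch) (hA : Y (s, t) ∈ A)
    (hY : ContDiffAt ℝ ∞ Y (s, t)) (he : ∀ i, ContDiffAt ℝ ∞ (e i) (s, t))
    (hYs : (fun p ↦ fderiv ℝ Y p (1, 0)) =ᶠ[nhds (s, t)] e 0)
    (hes : ∀ i, covD Ch Y (e i) (1, 0) =ᶠ[nhds (s, t)] fun p ↦ ∑ j, K p i j • e j p)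
    (hv : ∀ j, HasDerivAt (v j) (v' j) s)
    (hv' : ∀ j, v' j = Ω s 0 j - ∑ k, v k s * K (s, t) k j) :
    covD Ch Y (fun p ↦ fderiv ℝ Y p (0, 1) - ∑ k, v k p.1 • e k p) (1, 0) (s, t) =
      covD Ch Y (e 0) (0, 1) (s, t) - ∑ k, Ω s 0 k • e k (s, t) := by
  have hed : ∀ i, DifferentiableAt ℝ (e i) (s, t) := fun i ↦ (he i).differentiableAt (by simp)
  have hvd : ∀ k, DifferentiableAt ℝ (fun p : ℝ × ℝ ↦ v k p.1) (s, t) :=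
    fun k ↦ (fderiv_comp_fst (hv k)).1
  rw [covD_sub ((contDiffAt_fderiv_apply_const hY _).differentiableAt (by simp))
    (differentiableAt_sum_smul hvd hed), covD_sum_smul hvd hed,
    H.covD_fderiv_comm (Y := Y) hA hY, covD_congr (Filter.EventuallyEq.refl _ _) hYs]
  congr 1
  simp only [(fderiv_comp_fst (hv _)).2, hv', (hes _).self_of_nhds]
  simp only [Fin.sum_univ_four]
  module

/-- Write D = Y_t − Σ vₖeₖ and Dᵢ = ∇_t eᵢ − Σ Ωᵢₖeₖ. Commuting ∇_s with ∇_t produces R(Y_t, e₀)eᵢ,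
which is algebraic by `hG`. The equation `hΩ'` for Ω' is exactly what cancels every inhomogeneous
term, leaving ∇_s Dᵢ = Σ KᵢⱼDⱼ + G(⟨D, eᵢ⟩e₀ − η₀ᵢD). -/
lemma covD_covD_defect (H : CoordGeom A gl Ch) (hA : Y (s, t) ∈ A)
    (hY : ContDiffAt ℝ ∞ Y (s, t)) (he : ∀ i, ContDiffAt ℝ ∞ (e i) (s, t))
    (hYs : (fun p ↦ fderiv ℝ Y p (1, 0)) =ᶠ[nhds (s, t)] e 0)
    (hes : ∀ i, covD Ch Y (e i) (1, 0) =ᶠ[nhds (s, t)] fun p ↦ ∑ j, K p i j • e j p)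
    (hK : ∀ i j, DifferentiableAt ℝ (fun p ↦ K p i j) (s, t))
    (hL : ∀ i j, fderiv ℝ (fun p ↦ K p i j) (s, t) (0, 1) = L i j)
    (hΩ : ∀ i j, HasDerivAt (fun τ ↦ Ω τ i j) (Ω' i j) s) {G : ℝ}
    (hG : ∀ u v w, curv Ch (Y (s, t)) u v w =
      G • (gl (Y (s, t)) u w • v - gl (Y (s, t)) v w • u)) {η : Matrix (Fin 4) (Fin 4) ℝ}
    (hη : ∀ i j, gl (Y (s, t)) (e i (s, t)) (e j (s, t)) = η i j)
    (hΩ' : ∀ i j, Ω' i j = L i j - ∑ k, Ω s i k * K (s, t) k j + ∑ k, K (s, t) i k * Ω s k j -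
      G * (η 0 i * v j s - if j = 0 then ∑ k, v k s * η k i else 0)) (i : Fin 4) :
    covD Ch Y (fun p ↦ covD Ch Y (e i) (0, 1) p - ∑ k, Ω p.1 i k • e k p) (1, 0) (s, t) =
      ∑ j, K (s, t) i j • (covD Ch Y (e j) (0, 1) (s, t) - ∑ k, Ω s j k • e k (s, t)) +
      G • (gl (Y (s, t)) (fderiv ℝ Y (s, t) (0, 1) - ∑ k, v k s • e k (s, t)) (e i (s, t)) •
        e 0 (s, t) - η 0 i • (fderiv ℝ Y (s, t) (0, 1) - ∑ k, v k s • e k (s, t))) := by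
  have hed : ∀ i, DifferentiableAt ℝ (e i) (s, t) := fun i ↦ (he i).differentiableAt (by simp)
  have hΩd : ∀ k, DifferentiableAt ℝ (fun p : ℝ × ℝ ↦ Ω p.1 i k) (s, t) :=
    fun k ↦ (fderiv_comp_fst (hΩ i k)).1
  have h1 : covD Ch Y (fun p ↦ covD Ch Y (e i) (0, 1) p) (1, 0) (s, t) =
      covD Ch Y (covD Ch Y (e i) (1, 0)) (0, 1) (s, t) +
        curv Ch (Y (s, t)) (fderiv ℝ Y (s, t) (0, 1)) (fderiv ℝ Y (s, t) (1, 0)) (e i (s, t)) :=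
    H.covD_comm (Y := Y) hA hY (he i) (0, 1) (1, 0)
  have hYs' : fderiv ℝ Y (s, t) (1, 0) = e 0 (s, t) := hYs.self_of_nhds
  rw [covD_sub ((H.contDiffAt_covD (Y := Y) hA hY (he i) _).differentiableAt (by simp))
    (differentiableAt_sum_smul hΩd hed), covD_sum_smul hΩd hed, h1,
    covD_congr (Filter.EventuallyEq.refl _ _) (hes i), covD_sum_smul (hK i) hed, hG, hYs']
  simp only [(fderiv_comp_fst (hΩ _ _)).2, hΩ', (hes _).self_of_nhds, hL, hη, map_sub, map_sum,
    map_smul, sub_apply, sum_apply, smul_apply, smul_eq_mul]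
  simp only [Fin.sum_univ_four, Fin.isValue, if_true, Fin.reduceEq, if_false]
  module

end CoordGeom

end CoordinateVariation

/-! ### Velocity and Gram matrix of solutions -/

section FrameGeometry

variable {M : Type*} [TopologicalSpace M] [ChartedSpace E4 M] [IsManifold 𝓘(ℝ, E4) ∞ M]

local notation "φ[" x "]" => extChartAt 𝓘(ℝ, E4) x

lemma IsSmoothFrameAt.contMDiffAt {P : Type*} [NormedAddCommGroup P] [NormedSpace ℝ P]
    {Z : P → FrameM M} {p : P} (h : IsSmoothFrameAt Z p) :
    ContMDiffAt 𝓘(ℝ, P) 𝓘(ℝ, E4) ∞ (fun q ↦ (Z q).1) p :=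
  have hx := mem_extChartAt_source (I := 𝓘(ℝ, E4)) (Z p).1
  (contMDiffAt_base_iff h.continuousAt hx).2 (h.contDiffAt _ hx).fst

namespace SemiRiemannianMetric

variable {q : ℕ} {g : SemiRiemannianMetric M q} {c : Fin 4 → ℝ}
  {K : Matrix (Fin 4) (Fin 4) ℝ} {X : ℝ → FrameM M} {s : ℝ}

lemma IsFrameSol.velocity_eq (h : g.IsFrameSol c K X s)
    (hX : MDifferentiableAt 𝓘(ℝ, ℝ) 𝓘(ℝ, E4) (fun τ ↦ (X τ).1) s) :
    velocity (fun τ ↦ (X τ).1) s = ∑ j, c j • (X s).2 j := by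
  have hx := mem_extChartAt_source (I := 𝓘(ℝ, E4)) (X s).1
  refine toCoord_injective hx ?_
  rw [toCoord_velocity (γ := fun τ ↦ (X τ).1) hx hX, map_sum]
  simp only [map_smul]
  exact (hasDerivAt_frameField_iff.1 (h.hasDerivAt _ hx)).1.deriv

lemma IsFrameSol.covDeriv_eq (h : g.IsFrameSol c K X s) (i : Fin 4) :
    g.covDeriv (fun τ ↦ (X τ).1) (fun τ ↦ (X τ).2 i) s = ∑ j, K i j • (X s).2 j := by
  have hx := mem_extChartAt_source (I := 𝓘(ℝ, E4)) (X s).1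
  refine toCoord_injective hx ?_
  rw [g.toCoord_covDeriv_self (fun τ ↦ (X τ).1), map_sum]
  simp only [map_smul]
  exact ((hasDerivAt_frameField_iff.1 (h.hasDerivAt _ hx)).2 i).2

lemma IsFrameSol.hasDerivAt_inner (h : g.IsFrameSol c K X s) (i j : Fin 4) :
    HasDerivAt (fun τ ↦ g.inner (X τ).1 ((X τ).2 i) ((X τ).2 j))
      (∑ k, K i k * g.inner (X s).1 ((X s).2 k) ((X s).2 j) +
        ∑ k, K j k * g.inner (X s).1 ((X s).2 i) ((X s).2 k)) s := by
  have hx := mem_extChartAt_source (I := 𝓘(ℝ, E4)) (X s).1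
  obtain ⟨h1, h2⟩ := hasDerivAt_frameField_iff.1 (h.hasDerivAt _ hx)
  have hA : (frameCoord (X s).1 (X s)).1 ∈ (φ[(X s).1]).target := (φ[(X s).1]).map_source hx
  have hGe := g.coordGeom (X s).1
  have hev : (fun τ ↦ g.inner (X τ).1 ((X τ).2 i) ((X τ).2 j)) =ᶠ[nhds s]
      fun τ ↦ g.coordMetric (X s).1 (frameCoord (X s).1 (X τ)).1
        ((frameCoord (X s).1 (X τ)).2 i) ((frameCoord (X s).1 (X τ)).2 j) := by
    filter_upwards [eventually_mem_source h.continuousAt hx] with τ hτ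
    exact g.inner_eq_coordMetric hτ _ _
  refine HasDerivAt.congr_of_eventuallyEq ?_ hev
  have hd := (differentiableAt_bilin_comp (Y := fun τ ↦ (frameCoord (X s).1 (X τ)).1)
    (hGe.differentiableAt_gl hA) h1.differentiableAt
    (h2 i).1 (h2 j).1).hasDerivAt
  refine hd.congr_deriv ?_
  rw [← fderiv_apply_one_eq_deriv, hGe.fderiv_gl_comp (Y := fun τ ↦ (frameCoord (X s).1 (X τ)).1)
    hA h1.differentiableAt (h2 i).1 (h2 j).1, (h2 i).2, (h2 j).2]
  simp only [map_sum, map_smul, sum_apply, smul_apply, smul_eq_mul, g.inner_eq_coordMetric hx]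
  rfl

/-- Solutions with skew coefficient matrices have a constant Gram matrix. -/
lemma IsFrameSolThrough.inner_eq {K : ℝ × ℝ → Matrix (Fin 4) (Fin 4) ℝ} {J I : Set ℝ} {s₀ t : ℝ}
    {X₀ : FrameM M} (h : g.IsFrameSolThrough c K J s₀ X₀ t I X)
    (hK : ∀ s ∈ J, ∀ t i j, ContDiffAt ℝ ∞ (fun p ↦ K p i j) (s, t))
    {η : Matrix (Fin 4) (Fin 4) ℝ} (hη : ∀ s ∈ J, K (s, t) * η + η * (K (s, t))ᵀ = 0)
    (h0 : ∀ i j, g.inner X₀.1 (X₀.2 i) (X₀.2 j) = η i j) {s : ℝ} (hs : s ∈ I) (i j : Fin 4) :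
    g.inner (X s).1 ((X s).2 i) ((X s).2 j) = η i j := by
  obtain ⟨h1, h2, h3, h4, rfl, h6⟩ := h
  -- The Gram matrix solves the linear equation B' = KB + BKᵀ, of which the constant η is a solution
  -- by skewness of `K`.
  have key := ode_eqOn (I := I) h1 h2.isPreconnected (s₀ := s₀)
    (f := fun z : ℝ × (Fin 4 → Fin 4 → ℝ) ↦ fun i j ↦
      ∑ k, K (z.1, t) i k * z.2 k j + ∑ k, K (z.1, t) j k * z.2 i k)
    (x := fun τ i j ↦ g.inner (X τ).1 ((X τ).2 i) ((X τ).2 j)) (y := fun _ i j ↦ η i j)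
    ?_ ?_ ?_ h4 ?_
  · exact congrFun (congrFun (key hs) i) j
  · intro τ hτ
    have hKτ : ∀ i j, ContDiffAt ℝ 1 (fun z : ℝ × (Fin 4 → Fin 4 → ℝ) ↦ K (z.1, t) i j)
        (τ, fun i j ↦ g.inner (X τ).1 ((X τ).2 i) ((X τ).2 j)) := fun i j ↦
      ContDiffAt.of_le (ContDiffAt.comp (τ, _) (g := fun τ ↦ K (τ, t) i j)
        (contDiffAt_slice (hK τ (h3 hτ) t i j)) contDiffAt_fst) (by simp)
    refine contDiffAt_pi.2 fun i ↦ contDiffAt_pi.2 fun j ↦ ?_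
    refine (ContDiffAt.sum fun k _ ↦ (hKτ i k).mul ?_).add
      (ContDiffAt.sum fun k _ ↦ (hKτ j k).mul ?_) <;> fun_prop
  · intro τ hτ
    exact hasDerivAt_pi.2 fun i ↦ hasDerivAt_pi.2 fun j ↦ (h6 τ hτ).hasDerivAt_inner i j
  · intro τ hτ
    refine hasDerivAt_pi.2 fun i ↦ hasDerivAt_pi.2 fun j ↦ ?_
    refine (hasDerivAt_const τ (η i j)).congr_deriv ?_
    have := congrFun (congrFun (hη τ (h3 hτ)) i) j
    rw [Matrix.add_apply, Matrix.mul_apply, Matrix.mul_apply] at this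
    simp only [Matrix.transpose_apply, Matrix.zero_apply] at this
    rw [← this]
    congr 1
    exact Finset.sum_congr rfl fun k _ ↦ mul_comm _ _
  · funext i j
    exact h0 i j

end SemiRiemannianMetric

end FrameGeometry

/-! ### Identification of the variation field of a family of frames -/

section FrameVariation

variable {M : Type*} [TopologicalSpace M] [ChartedSpace E4 M] [IsManifold 𝓘(ℝ, E4) ∞ M]

local notation "φ[" x "]" => extChartAt 𝓘(ℝ, E4) x

variable {Z : ℝ × ℝ → FrameM M} {x₀ : M} {s t : ℝ}

lemma IsSmoothFrameAt.slice_right (h : IsSmoothFrameAt Z (s, t)) :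
    IsSmoothFrameAt (fun t ↦ Z (s, t)) t :=
  h.comp (f := fun t : ℝ ↦ (s, t)) (contDiffAt_const.prodMk contDiffAt_id)

lemma IsSmoothFrameAt.slice_left (h : IsSmoothFrameAt Z (s, t)) :
    IsSmoothFrameAt (fun s ↦ Z (s, t)) s :=
  h.comp (f := fun s : ℝ ↦ (s, t)) (contDiffAt_id.prodMk contDiffAt_const)

lemma IsSmoothFrameAt.contDiffAt_vec (h : IsSmoothFrameAt Z (s, t))
    (hx : (Z (s, t)).1 ∈ (φ[x₀]).source) (i : Fin 4) :
    ContDiffAt ℝ ∞ (fun p ↦ (frameCoord x₀ (Z p)).2 i) (s, t) :=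
  (contDiffAt_pi (𝕜 := ℝ) (F' := fun _ : Fin 4 ↦ E4)).1 (h.contDiffAt x₀ hx).snd i

lemma IsSmoothFrameAt.toCoord_velocity (h : IsSmoothFrameAt Z (s, t))
    (hx : (Z (s, t)).1 ∈ (φ[x₀]).source) :
    toCoord x₀ (Z (s, t)).1 (velocity (fun t ↦ (Z (s, t)).1) t) =
      fderiv ℝ (fun p ↦ (frameCoord x₀ (Z p)).1) (s, t) (0, 1) := by
  rw [NullCurve.toCoord_velocity (γ := fun t ↦ (Z (s, t)).1) hx
    (h.slice_right.contMDiffAt.mdifferentiableAt (by simp))]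
  exact (hasDerivAt_slice_right (((h.contDiffAt x₀ hx).fst).differentiableAt (by simp))).deriv

namespace SemiRiemannianMetric

variable {q : ℕ} {g : SemiRiemannianMetric M q}

lemma toCoord_covDeriv_frame (g : SemiRiemannianMetric M q) (h : IsSmoothFrameAt Z (s, t))
    (hx : (Z (s, t)).1 ∈ (φ[x₀]).source) (i : Fin 4) :
    toCoord x₀ (Z (s, t)).1 (g.covDeriv (fun t ↦ (Z (s, t)).1) (fun t ↦ (Z (s, t)).2 i) t) =
      covD (g.coordChristoffel x₀) (fun p ↦ (frameCoord x₀ (Z p)).1)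
        (fun p ↦ (frameCoord x₀ (Z p)).2 i) (0, 1) (s, t) := by
  have h1 : DifferentiableAt ℝ (fun p ↦ (frameCoord x₀ (Z p)).1) (s, t) :=
    ((h.contDiffAt x₀ hx).fst).differentiableAt (by simp)
  have h2 := (h.contDiffAt_vec hx i).differentiableAt (by simp)
  rw [← covD_slice_right h1 h2]
  exact g.toCoord_covDeriv (γ := fun t ↦ (Z (s, t)).1) (X := fun t ↦ (Z (s, t)).2 i)
    h.slice_right.continuousAt hx (hasDerivAt_slice_right h1).differentiableAt
    (hasDerivAt_slice_right h2).differentiableAt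

variable {K : ℝ × ℝ → Matrix (Fin 4) (Fin 4) ℝ} {v : Fin 4 → ℝ → ℝ}
  {Ω L : ℝ → Matrix (Fin 4) (Fin 4) ℝ} {η : Matrix (Fin 4) (Fin 4) ℝ} {G : ℝ} {J : Set ℝ}

/-- The propagation of the defect of the variation field, in components. -/
lemma hasDerivAt_inner_defect (hG : g.IsSpaceForm G)
    (hZ : ∀ᶠ p in nhds (s, (0 : ℝ)), IsSmoothFrameAt Z p ∧
      g.IsFrameSol (Pi.single 0 1) (K p) (fun s ↦ Z (s, p.2)) p.1)
    (hK : ∀ i j, DifferentiableAt ℝ (fun p ↦ K p i j) (s, 0))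
    (hL : ∀ i j, fderiv ℝ (fun p ↦ K p i j) (s, 0) (0, 1) = L s i j)
    (hη : ∀ i j, g.inner (Z (s, 0)).1 ((Z (s, 0)).2 i) ((Z (s, 0)).2 j) = η i j)
    (hv : ∀ j, HasDerivAt (v j) (Ω s 0 j - ∑ k, v k s * K (s, 0) k j) s)
    (hΩ : ∀ i j, HasDerivAt (fun τ ↦ Ω τ i j)
      (L s i j - ∑ k, Ω s i k * K (s, 0) k j + ∑ k, K (s, 0) i k * Ω s k j -
        G * (η 0 i * v j s - if j = 0 then ∑ k, v k s * η k i else 0)) s)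
    {x : ℝ → Fin 4 → ℝ} {y : ℝ → Fin 4 → Fin 4 → ℝ}
    (hx : x = fun s j ↦ g.inner (Z (s, 0)).1 (velocity (fun t ↦ (Z (s, t)).1) 0 -
      ∑ k, v k s • (Z (s, 0)).2 k) ((Z (s, 0)).2 j))
    (hy : y = fun s i j ↦ g.inner (Z (s, 0)).1
      (g.covDeriv (fun t ↦ (Z (s, t)).1) (fun t ↦ (Z (s, t)).2 i) 0 -
        ∑ k, Ω s i k • (Z (s, 0)).2 k) ((Z (s, 0)).2 j)) :
    (∀ j, HasDerivAt (fun s ↦ x s j) (y s 0 j + ∑ k, K (s, 0) j k * x s k) s) ∧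
    ∀ i j, HasDerivAt (fun s ↦ y s i j) (∑ k, K (s, 0) i k * y s k j +
      G * (x s i * η 0 j - η 0 i * x s j) + ∑ k, K (s, 0) j k * y s i k) s := by
  have hx0 := mem_extChartAt_source (I := 𝓘(ℝ, E4)) (Z (s, 0)).1
  set x₀ := (Z (s, 0)).1 with hx₀
  have hGe := g.coordGeom x₀
  set Ch := g.coordChristoffel x₀
  set gl := g.coordMetric x₀
  set Y : ℝ × ℝ → E4 := fun p ↦ (frameCoord x₀ (Z p)).1 with hYdef
  set e : Fin 4 → ℝ × ℝ → E4 := fun i p ↦ (frameCoord x₀ (Z p)).2 i with hedef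
  have hs0 := hZ.self_of_nhds.1
  have hY : ContDiffAt ℝ ∞ Y (s, 0) := (hs0.contDiffAt x₀ hx0).fst
  have he : ∀ i, ContDiffAt ℝ ∞ (e i) (s, 0) := hs0.contDiffAt_vec hx0
  have hA : Y (s, 0) ∈ (φ[x₀]).target := (φ[x₀]).map_source hx0
  have hev : ∀ᶠ p in nhds (s, (0 : ℝ)), (IsSmoothFrameAt Z p ∧
      g.IsFrameSol (Pi.single 0 1) (K p) (fun s ↦ Z (s, p.2)) p.1) ∧
      (Z p).1 ∈ (φ[x₀]).source := hZ.and (eventually_mem_source hs0.continuousAt hx0)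
  have hYs : (fun p ↦ fderiv ℝ Y p (1, 0)) =ᶠ[nhds (s, 0)] e 0 := by
    filter_upwards [hev] with p hp
    obtain ⟨⟨h1, h2⟩, h3⟩ := hp
    have h4 := (hasDerivAt_frameField_iff.1 (h2.hasDerivAt x₀ h3)).1
    have h5 : HasDerivAt (fun u ↦ Y (u, p.2)) (fderiv ℝ Y p (1, 0)) p.1 :=
      hasDerivAt_slice_left (((h1.contDiffAt x₀ h3).fst).differentiableAt (by simp))
    rw [h5.unique h4]
    simp [Pi.single_apply, hedef]
  have hes : ∀ i, covD Ch Y (e i) (1, 0) =ᶠ[nhds (s, 0)] fun p ↦ ∑ j, K p i j • e j p := by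
    intro i
    filter_upwards [hev] with p hp
    obtain ⟨⟨h1, h2⟩, h3⟩ := hp
    have h4 := ((hasDerivAt_frameField_iff.1 (h2.hasDerivAt x₀ h3)).2 i).2
    exact (covD_slice_left (Y := Y) (X := e i)
      (((h1.contDiffAt x₀ h3).fst).differentiableAt (by simp))
      ((h1.contDiffAt_vec h3 i).differentiableAt (by simp))).symm.trans h4
  have hηc : ∀ i j, gl (Y (s, 0)) (e i (s, 0)) (e j (s, 0)) = η i j := fun i j ↦ by
    rw [← hη, g.inner_eq_coordMetric hx0]; rfl
  have hcurv : ∀ u v w, curv Ch (Y (s, 0)) u v w =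
      G • (gl (Y (s, 0)) u w • v - gl (Y (s, 0)) v w • u) := hG.curv_eq x₀
  have hed : ∀ i, DifferentiableAt ℝ (e i) (s, 0) := fun i ↦ (he i).differentiableAt (by simp)
  have hYd := hY.differentiableAt (by simp)
  have hvd : ∀ k, DifferentiableAt ℝ (fun p : ℝ × ℝ ↦ v k p.1) (s, 0) :=
    fun k ↦ (fderiv_comp_fst (hv k)).1
  have hΩd : ∀ i k, DifferentiableAt ℝ (fun p : ℝ × ℝ ↦ Ω p.1 i k) (s, 0) :=
    fun i k ↦ (fderiv_comp_fst (hΩ i k)).1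
  have hDd : DifferentiableAt ℝ (fun p ↦ fderiv ℝ Y p (0, 1) - ∑ k, v k p.1 • e k p) (s, 0) :=
    ((contDiffAt_fderiv_apply_const hY _).differentiableAt (by simp)).fun_sub
      (differentiableAt_sum_smul hvd hed)
  have hDDd : ∀ i, DifferentiableAt ℝ
      (fun p ↦ covD Ch Y (e i) (0, 1) p - ∑ k, Ω p.1 i k • e k p) (s, 0) := fun i ↦
    ((hGe.contDiffAt_covD (Y := Y) hA hY (he i) _).differentiableAt (by simp)).fun_sub
      (differentiableAt_sum_smul (hΩd i) hed)
  have h1 := hGe.covD_defect (Y := Y) hA hY he hYs hes hv (fun j ↦ rfl)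
  have h2 := hGe.covD_covD_defect (Y := Y) hA hY he hYs hes hK hL hΩ hcurv hηc (fun i j ↦ rfl)
  have hxc : ∀ᶠ τ in nhds s, ∀ j, x τ j = gl (Y (τ, 0))
      (fderiv ℝ Y (τ, 0) (0, 1) - ∑ k, v k τ • e k (τ, 0)) (e j (τ, 0)) := by
    filter_upwards [(tendsto_slice_left s 0).eventually hev] with τ hτ j
    rw [hx, ← hτ.1.1.toCoord_velocity hτ.2]
    refine (g.inner_eq_coordMetric hτ.2 _ _).trans ?_
    rw [map_sub (toCoord x₀ _), map_sum (toCoord x₀ _)]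
    simp only [map_smul (toCoord x₀ _)]
    rfl
  have hyc : ∀ᶠ τ in nhds s, ∀ i j, y τ i j = gl (Y (τ, 0))
      (covD Ch Y (e i) (0, 1) (τ, 0) - ∑ k, Ω τ i k • e k (τ, 0)) (e j (τ, 0)) := by
    filter_upwards [(tendsto_slice_left s 0).eventually hev] with τ hτ i j
    rw [hy, ← g.toCoord_covDeriv_frame hτ.1.1 hτ.2]
    refine (g.inner_eq_coordMetric hτ.2 _ _).trans ?_
    rw [map_sub (toCoord x₀ _), map_sum (toCoord x₀ _)]
    simp only [map_smul (toCoord x₀ _)]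
    rfl
  have hxs := hxc.self_of_nhds
  have hys := hyc.self_of_nhds
  constructor
  · intro j
    have h3 := hasDerivAt_slice_left (differentiableAt_bilin_comp (hGe.differentiableAt_gl hA)
      hYd hDd (hed j))
    refine (h3.congr_of_eventuallyEq (hxc.mono fun τ hτ ↦ hτ j)).congr_deriv ?_
    rw [hGe.fderiv_gl_comp (Y := Y) hA hYd hDd (hed j), h1, (hes j).self_of_nhds, hys]
    simp only [map_sum, map_smul, smul_eq_mul, hxs]
  · intro i j
    have h3 := hasDerivAt_slice_left (differentiableAt_bilin_comp (hGe.differentiableAt_gl hA)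
      hYd (hDDd i) (hed j))
    refine (h3.congr_of_eventuallyEq (hyc.mono fun τ hτ ↦ hτ i j)).congr_deriv ?_
    rw [hGe.fderiv_gl_comp (Y := Y) hA hYd (hDDd i) (hed j), h2, (hes j).self_of_nhds]
    rw [map_add, add_apply, map_sum (gl (Y (s, 0))), sum_apply, map_smul, smul_apply, map_sub,
      sub_apply, map_smul, map_smul, smul_apply, smul_apply, hηc]
    simp only [map_smul, map_sum, smul_apply, smul_eq_mul, hxs, hys]

/-- The variation field of a family of frames. -/
theorem velocity_frame_family (hG : g.IsSpaceForm G) (hJ : IsOpen J) (hJ' : J.OrdConnected)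
    (hZ : ∀ s ∈ J, ∀ᶠ p in nhds (s, (0 : ℝ)), IsSmoothFrameAt Z p ∧
      g.IsFrameSol (Pi.single 0 1) (K p) (fun s ↦ Z (s, p.2)) p.1)
    (hK : ∀ s ∈ J, ∀ i j, ContDiffAt ℝ ∞ (fun p ↦ K p i j) (s, 0))
    (hL : ∀ s ∈ J, ∀ i j, fderiv ℝ (fun p ↦ K p i j) (s, 0) (0, 1) = L s i j)
    (hη : ∀ s ∈ J, ∀ i j, g.inner (Z (s, 0)).1 ((Z (s, 0)).2 i) ((Z (s, 0)).2 j) = η i j)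
    (hspan : ∀ s ∈ J, ∀ w, (∀ j, g.inner (Z (s, 0)).1 w ((Z (s, 0)).2 j) = 0) → w = 0)
    (hv : ∀ s ∈ J, ∀ j, HasDerivAt (v j) (Ω s 0 j - ∑ k, v k s * K (s, 0) k j) s)
    (hΩ : ∀ s ∈ J, ∀ i j, HasDerivAt (fun τ ↦ Ω τ i j)
      (L s i j - ∑ k, Ω s i k * K (s, 0) k j + ∑ k, K (s, 0) i k * Ω s k j -
        G * (η 0 i * v j s - if j = 0 then ∑ k, v k s * η k i else 0)) s)
    {s₀ : ℝ} (hs₀ : s₀ ∈ J) (h0 : g.IsFrameSol (fun j ↦ v j s₀) (Ω s₀) (fun t ↦ Z (s₀, t)) 0)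
    {s : ℝ} (hs : s ∈ J) :
    velocity (fun t ↦ (Z (s, t)).1) 0 = ∑ k, v k s • (Z (s, 0)).2 k := by
  set x : ℝ → Fin 4 → ℝ := fun s j ↦ g.inner (Z (s, 0)).1 (velocity (fun t ↦ (Z (s, t)).1) 0 -
    ∑ k, v k s • (Z (s, 0)).2 k) ((Z (s, 0)).2 j) with hx
  set y : ℝ → Fin 4 → Fin 4 → ℝ := fun s i j ↦ g.inner (Z (s, 0)).1
      (g.covDeriv (fun t ↦ (Z (s, t)).1) (fun t ↦ (Z (s, t)).2 i) 0 -
        ∑ k, Ω s i k • (Z (s, 0)).2 k) ((Z (s, 0)).2 j) with hy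
  have hd : ∀ s ∈ J, _ := fun s hs ↦ hasDerivAt_inner_defect (x := x) (y := y) hG (hZ s hs)
    (fun i j ↦ (hK s hs i j).differentiableAt (by simp)) (hL s hs) (hη s hs) (hv s hs)
    (hΩ s hs) hx hy
  -- Paired with the frame, the defects become real functions satisfying a homogeneous linear system
  -- on `J`. They vanish at `s₀`, hence everywhere.
  have key := ode_eqOn (E := (Fin 4 → ℝ) × (Fin 4 → Fin 4 → ℝ)) hJ hJ'.isPreconnected
    (s₀ := s₀) (x := fun s ↦ (x s, y s)) (y := fun _ ↦ 0)
    (f := fun z ↦ (fun j ↦ z.2.2 0 j + ∑ k, K (z.1, 0) j k * z.2.1 k, fun i j ↦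
      ∑ k, K (z.1, 0) i k * z.2.2 k j + G * (z.2.1 i * η 0 j - η 0 i * z.2.1 j) +
        ∑ k, K (z.1, 0) j k * z.2.2 i k)) ?_ ?_ ?_ hs₀ ?_
  · have hxs : x s = 0 := congrArg Prod.fst (key hs)
    rw [← sub_eq_zero]
    exact hspan s hs _ fun j ↦ congrFun hxs j
  · intro τ hτ
    have hKτ : ∀ i j, ContDiffAt ℝ 1 (fun z : ℝ × ((Fin 4 → ℝ) × (Fin 4 → Fin 4 → ℝ)) ↦
        K (z.1, 0) i j) (τ, (x τ, y τ)) := fun i j ↦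
      ContDiffAt.of_le (ContDiffAt.comp (τ, _) (g := fun τ ↦ K (τ, 0) i j)
        (contDiffAt_slice (hK τ hτ i j)) contDiffAt_fst) (by simp)
    refine ContDiffAt.prodMk ?_ ?_
    · refine contDiffAt_pi.2 fun j ↦ ?_
      refine ContDiffAt.add (by fun_prop) (ContDiffAt.sum fun k _ ↦ (hKτ j k).mul ?_)
      fun_prop
    · refine contDiffAt_pi.2 fun i ↦ contDiffAt_pi.2 fun j ↦ ?_
      refine ((ContDiffAt.sum fun k _ ↦ (hKτ i k).mul ?_).add ?_).add
        (ContDiffAt.sum fun k _ ↦ (hKτ j k).mul ?_) <;> fun_prop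
  · intro τ hτ
    exact (hasDerivAt_pi.2 fun j ↦ (hd τ hτ).1 j).prodMk
      (hasDerivAt_pi.2 fun i ↦ hasDerivAt_pi.2 fun j ↦ (hd τ hτ).2 i j)
  · intro τ hτ
    refine (hasDerivAt_const τ _).congr_deriv ?_
    ext <;> simp
  -- At `s₀` the family moves in t by the frame equation with coefficients v(s₀) and Ω(s₀), so both
  -- defects are zero there.
  · have e1 := h0.velocity_eq
      ((hZ s₀ hs₀).self_of_nhds.1.slice_right.contMDiffAt.mdifferentiableAt (by simp))
    have e2 := h0.covDeriv_eq
    refine Prod.ext (funext fun j ↦ ?_) (funext fun i ↦ funext fun j ↦ ?_)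
    · simp only [hx, e1, sub_self, map_zero]
      rfl
    · simp only [hy, e2, sub_self, map_zero]
      rfl

end SemiRiemannianMetric

end FrameVariation

/-! ### Infinitesimal isometries of a Gram matrix -/

section SkewMatrices

variable {n : Type*} [Fintype n] {η : Matrix n n ℝ}

/-- `A` is an infinitesimal isometry of the Gram matrix `η`. -/
def IsSkewFor (η A : Matrix n n ℝ) : Prop := A * η + η * Aᵀ = 0

lemma IsSkewFor.add {A B : Matrix n n ℝ} (hA : IsSkewFor η A) (hB : IsSkewFor η B) :
    IsSkewFor η (A + B) := by
  rw [IsSkewFor, Matrix.transpose_add, add_mul, mul_add, add_add_add_comm, hA, hB, add_zero]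

lemma IsSkewFor.smul {A : Matrix n n ℝ} (hA : IsSkewFor η A) (t : ℝ) : IsSkewFor η (t • A) := by
  rw [IsSkewFor, Matrix.transpose_smul, Matrix.smul_mul, Matrix.mul_smul, ← smul_add, hA, smul_zero]

/-- Infinitesimal isometries form a Lie algebra; moving η across each factor changes a sign, and
twice restores it. -/
lemma IsSkewFor.commutator {A B : Matrix n n ℝ} (hA : IsSkewFor η A) (hB : IsSkewFor η B) :
    IsSkewFor η (A * B - B * A) := by
  have hA' : A * η = -(η * Aᵀ) := eq_neg_of_add_eq_zero_left hA
  have hB' : B * η = -(η * Bᵀ) := eq_neg_of_add_eq_zero_left hB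
  have e1 : A * B * η = η * (Aᵀ * Bᵀ) := by
    rw [Matrix.mul_assoc, hB', Matrix.mul_neg, ← Matrix.mul_assoc, hA', Matrix.neg_mul, neg_neg,
      Matrix.mul_assoc]
  have e2 : B * A * η = η * (Bᵀ * Aᵀ) := by
    rw [Matrix.mul_assoc, hA', Matrix.mul_neg, ← Matrix.mul_assoc, hB', Matrix.neg_mul, neg_neg,
      Matrix.mul_assoc]
  rw [IsSkewFor, Matrix.sub_mul, e1, e2, Matrix.transpose_sub, Matrix.transpose_mul,
    Matrix.transpose_mul, Matrix.mul_sub]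
  abel

lemma isSkewFor_iff {A : Matrix n n ℝ} :
    IsSkewFor η A ↔ ∀ i j, ∑ k, A i k * η k j + ∑ k, η i k * A j k = 0 := by
  rw [IsSkewFor, ← Matrix.ext_iff]
  simp [Matrix.mul_apply]

lemma IsSkewFor.deriv {A : ℝ → Matrix n n ℝ} {A' : Matrix n n ℝ} {s : ℝ}
    (hA : ∀ τ, IsSkewFor η (A τ)) (h : ∀ i j, HasDerivAt (fun τ ↦ A τ i j) (A' i j) s) :
    IsSkewFor η A' := by
  rw [isSkewFor_iff]
  intro i j
  have h1 : HasDerivAt (fun τ ↦ ∑ k, A τ i k * η k j + ∑ k, η i k * A τ j k)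
      (∑ k, A' i k * η k j + ∑ k, η i k * A' j k) s :=
    (HasDerivAt.fun_sum fun k _ ↦ (h i k).mul_const _).add
      (HasDerivAt.fun_sum fun k _ ↦ (h j k).const_mul _)
  have h2 : (fun τ ↦ ∑ k, A τ i k * η k j + ∑ k, η i k * A τ j k) = fun _ ↦ 0 :=
    funext fun τ ↦ isSkewFor_iff.1 (hA τ) i j
  rw [h2] at h1
  exact h1.unique (hasDerivAt_const s 0)

end SkewMatrices

/-! ### Matrices attached to a Cartan frame -/

section CartanMatrices

/-- The Gram matrix of a Cartan frame. -/
def cartanGram (ε₁ ε₂ : ℝ) : Matrix (Fin 4) (Fin 4) ℝ :=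
  !![0, 0, -1, 0; 0, ε₁, 0, 0; -1, 0, 0, 0; 0, 0, 0, ε₂]

/-- The coefficients of the Cartan equations. -/
def cartanMatrix (a ε₁ ε₂ k₁ k₂ : ℝ) : Matrix (Fin 4) (Fin 4) ℝ :=
  !![0, a, 0, 0; -k₁, 0, a * ε₁, 0; 0, -(ε₁ * k₁), 0, ε₂ * k₂; k₂, 0, 0, 0]

/-- The infinitesimal rotation of a Cartan frame. -/
def rotationMatrix (ε₁ ε₂ α β δ o p : ℝ) : Matrix (Fin 4) (Fin 4) ℝ :=
  !![α, β, 0, δ; o, 0, ε₁ * β, p; 0, ε₁ * o, -α, 0; 0, -(ε₁ * ε₂ * p), ε₂ * δ, 0]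

/-- The contribution of the curvature to the evolution of a moving frame. -/
def curvatureMatrix (G : ℝ) (η : Matrix (Fin 4) (Fin 4) ℝ) (v : Fin 4 → ℝ) :
    Matrix (Fin 4) (Fin 4) ℝ :=
  Matrix.of fun i j ↦ G * (η 0 i * v j - if j = 0 then ∑ k, v k * η k i else 0)

variable {a ε₁ ε₂ : ℝ}

lemma isSkewFor_cartanMatrix (hε₁ : ε₁ * ε₁ = 1) (hε₂ : ε₂ * ε₂ = 1) (k₁ k₂ : ℝ) :
    IsSkewFor (cartanGram ε₁ ε₂) (cartanMatrix a ε₁ ε₂ k₁ k₂) := by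
  rw [isSkewFor_iff]
  intro i j
  fin_cases i <;> fin_cases j <;>
    simp [cartanGram, cartanMatrix, Fin.sum_univ_four] <;>
    first
    | ring1
    | linear_combination k₁ * hε₁
    | linear_combination (-k₁) * hε₁
    | linear_combination k₂ * hε₂

lemma isSkewFor_rotationMatrix (hε₁ : ε₁ * ε₁ = 1) (hε₂ : ε₂ * ε₂ = 1) (α β δ o p : ℝ) :
    IsSkewFor (cartanGram ε₁ ε₂) (rotationMatrix ε₁ ε₂ α β δ o p) := by
  rw [isSkewFor_iff]
  intro i j
  fin_cases i <;> fin_cases j <;>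
    simp [cartanGram, rotationMatrix, Fin.sum_univ_four] <;>
    first
    | ring1
    | linear_combination o * hε₁
    | linear_combination (-o) * hε₁
    | linear_combination (-p * ε₂) * hε₁

lemma isSkewFor_curvatureMatrix (G : ℝ) (v : Fin 4 → ℝ) :
    IsSkewFor (cartanGram ε₁ ε₂) (curvatureMatrix G (cartanGram ε₁ ε₂) v) := by
  rw [isSkewFor_iff]
  intro i j
  fin_cases i <;> fin_cases j <;>
    simp [cartanGram, curvatureMatrix, Fin.sum_univ_four] <;> ring1

end CartanMatrices

/-! ### Infinitesimal rotation of the Cartan frame and variation of its coefficients -/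

namespace SemiRiemannianMetric

variable {M : Type*} [TopologicalSpace M] [ChartedSpace E4 M] [IsManifold 𝓘(ℝ, E4) ∞ M]

variable {q : ℕ} {g : SemiRiemannianMetric M q}

lemma covDeriv_congr {γ : ℝ → M} {X X' : ∀ s, Tan M (γ s)} {s : ℝ}
    (h : ∀ᶠ τ in nhds s, X τ = X' τ) : g.covDeriv γ X s = g.covDeriv γ X' s := by
  have h1 : (fun τ ↦ toCoord (γ s) (γ τ) (X τ)) =ᶠ[nhds s]
      fun τ ↦ toCoord (γ s) (γ τ) (X' τ) := by
    filter_upwards [h] with τ hτ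
    rw [hτ]
  rw [covDeriv, covDeriv, h1.deriv_eq, h.self_of_nhds]

lemma isFrameSol_of_fields {c : Fin 4 → ℝ} {K : Matrix (Fin 4) (Fin 4) ℝ} {J : Set ℝ} {γ : ℝ → M}
    {X : Fin 4 → ∀ s, Tan M (γ s)} (hJ : IsOpen J) (hX : ∀ i, IsSmoothField J γ (X i)) {s : ℝ}
    (hs : s ∈ J) (hc : velocity γ s = ∑ j, c j • X j s)
    (hK : ∀ i, g.covDeriv γ (X i) s = ∑ j, K i j • X j s) :
    g.IsFrameSol c K (fun s ↦ (⟨γ s, fun i ↦ X i s⟩ : FrameM M)) s := by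
  have hx := mem_extChartAt_source (I := 𝓘(ℝ, E4)) (γ s)
  have hγ := (hX 0).contMDiffOn_base hJ
  refine IsFrameSol.of_chart (x₀ := γ s) ((hX 0).continuousAt_base hJ hs) hx ?_
  refine hasDerivAt_frameField_iff.2 ⟨?_, fun i ↦ ⟨?_, ?_⟩⟩
  · have h1 := ((contDiffAt_chart hγ hJ hs hx).differentiableAt (by simp)).hasDerivAt
    refine h1.congr_deriv ?_
    rw [← toCoord_velocity hx ((hγ.contMDiffAt (hJ.mem_nhds hs)).mdifferentiableAt (by simp)), hc,
      map_sum]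
    simp only [map_smul]
    rfl
  · exact ((hX i).contDiffAt_toCoord hJ hs hx).differentiableAt (by simp)
  · have h1 := g.toCoord_covDeriv_self γ (X i) s
    rw [hK, map_sum] at h1
    simp only [map_smul] at h1
    exact h1.symm

namespace CartanFrame

variable {a ε₁ ε₂ : ℝ} {J : Set ℝ} {γ : ℝ → M} (F : g.CartanFrame a ε₁ ε₂ J γ)

/-- The vectors of the frame. -/
def vec (i : Fin 4) (s : ℝ) : Tan M (γ s) := ![velocity γ s, F.W₁ s, F.N s, F.W₂ s] i

/-- A Cartan frame as a curve of frames. -/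
def frame (s : ℝ) : FrameM M := ⟨γ s, fun i ↦ F.vec i s⟩

/-- The components of a vector field. -/
def comp (V : ∀ s, Tan M (γ s)) (i : Fin 4) : ℝ → ℝ := ![F.fV V, F.hV V, F.gV V, F.lV V] i

lemma inner_vec {s : ℝ} (hs : s ∈ J) (i j : Fin 4) :
    g.inner (γ s) (F.vec i s) (F.vec j s) = cartanGram ε₁ ε₂ i j := by
  have h1 := g.symm (γ s)
  fin_cases i <;> fin_cases j <;>
  simp [vec, cartanGram, F.T_T s hs, F.N_N s hs, F.T_N s hs, F.W₁_T s hs, F.W₁_N s hs,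
    F.W₂_T s hs, F.W₂_N s hs, F.W₁_W₁ s hs, F.W₂_W₂ s hs, F.W₁_W₂ s hs,
    h1 (F.N s) (velocity γ s), h1 (velocity γ s) (F.W₁ s), h1 (velocity γ s) (F.W₂ s),
    h1 (F.N s) (F.W₁ s), h1 (F.N s) (F.W₂ s), h1 (F.W₂ s) (F.W₁ s)]

lemma isSmoothField_vec (hJ : IsOpen J) (i : Fin 4) : IsSmoothField J γ (F.vec i) := by
  fin_cases i
  · exact isSmoothField_velocity (F.smooth_N.contMDiffOn_base hJ) hJ
  · exact F.smooth_W₁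
  · exact F.smooth_N
  · exact F.smooth_W₂

lemma isFrameSol (hJ : IsOpen J) {s : ℝ} (hs : s ∈ J) :
    g.IsFrameSol (Pi.single 0 1) (cartanMatrix a ε₁ ε₂ (F.k₁ s) (F.k₂ s)) F.frame s := by
  refine isFrameSol_of_fields (X := F.vec) hJ (F.isSmoothField_vec hJ) hs ?_ fun i ↦ ?_
  · simp [Pi.single_apply, vec]
  · fin_cases i
    · refine (F.cartan_T s hs).trans ?_
      simp [Fin.sum_univ_four, vec, cartanMatrix]
    · refine (F.cartan_W₁ s hs).trans ?_
      simp [Fin.sum_univ_four, vec, cartanMatrix]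
    · refine (F.cartan_N s hs).trans ?_
      simp [Fin.sum_univ_four, vec, cartanMatrix]
    · refine (F.cartan_W₂ s hs).trans ?_
      simp [Fin.sum_univ_four, vec, cartanMatrix]

lemma eq_sum_comp (hε₁ : ε₁ * ε₁ = 1) (hε₂ : ε₂ * ε₂ = 1) {s : ℝ} (hs : s ∈ J)
    (V : ∀ s, Tan M (γ s)) : V s = ∑ k, F.comp V k s • F.vec k s := by
  refine (F.eq_sum hε₁ hε₂ hs (V s)).trans ?_
  simp [Fin.sum_univ_four, comp, vec, fV, gV, hV, lV]

lemma eq_zero_of_inner (hε₁ : ε₁ * ε₁ = 1) (hε₂ : ε₂ * ε₂ = 1) {s : ℝ} (hs : s ∈ J)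
    {w : Tan M (γ s)} (hw : ∀ j, g.inner (γ s) w (F.vec j s) = 0) : w = 0 := by
  have h0 : g.inner (γ s) w (velocity γ s) = 0 := hw 0
  have h1 : g.inner (γ s) w (F.W₁ s) = 0 := hw 1
  have h2 : g.inner (γ s) w (F.N s) = 0 := hw 2
  have h3 : g.inner (γ s) w (F.W₂ s) = 0 := hw 3
  rw [F.eq_sum hε₁ hε₂ hs w, h0, h1, h2, h3]
  simp

/-- The `T`-component `-⟨∇_T V, N⟩` of `∇_T V`. -/
def derivT (V : ∀ s, Tan M (γ s)) (s : ℝ) : ℝ := -g.inner (γ s) (g.covDeriv γ V s) (F.N s)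

/-- The infinitesimal rotation of the Cartan frame along a variation with variation field `V`. -/
def rotation (G : ℝ) (V : ∀ s, Tan M (γ s)) (s : ℝ) : Matrix (Fin 4) (Fin 4) ℝ :=
  rotationMatrix ε₁ ε₂ (F.derivT V s) (F.phiV V s) (F.psiV V s)
    ((deriv (F.derivT V) s - F.k₁ s * F.phiV V s + F.k₂ s * F.psiV V s + G * F.gV V s) / a)
    (deriv (F.psiV V) s / a)

/-- The variation of the coefficients of the Cartan equations. -/
def cartanVariation (G : ℝ) (V : ∀ s, Tan M (γ s)) (s : ℝ) : Matrix (Fin 4) (Fin 4) ℝ :=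
  Matrix.of (fun i j ↦ deriv (fun τ ↦ F.rotation G V τ i j) s) +
    (F.rotation G V s * cartanMatrix a ε₁ ε₂ (F.k₁ s) (F.k₂ s) -
      cartanMatrix a ε₁ ε₂ (F.k₁ s) (F.k₂ s) * F.rotation G V s) +
    curvatureMatrix G (cartanGram ε₁ ε₂) (fun k ↦ F.comp V k s)

lemma contDiffAt_deriv {f : ℝ → ℝ} {s : ℝ} (hf : ContDiffAt ℝ ∞ f s) :
    ContDiffAt ℝ ∞ (deriv f) s :=
  contDiffAt_fderiv_apply_const hf (1 : ℝ)

variable {V : ∀ s, Tan M (γ s)} {s : ℝ}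

lemma contDiffAt_comp (hJ : IsOpen J) (hV : IsSmoothField J γ V) (hs : s ∈ J) (i : Fin 4) :
    ContDiffAt ℝ ∞ (F.comp V i) s := by
  fin_cases i
  · exact F.contDiffAt_fV hJ hV hs
  · exact F.contDiffAt_hV hJ hV hs
  · exact F.contDiffAt_gV hJ hV hs
  · exact F.contDiffAt_lV hJ hV hs

lemma contDiffAt_rotation (hJ : IsOpen J) (hV : IsSmoothField J γ V) (hs : s ∈ J) (G : ℝ)
    (i j : Fin 4) : ContDiffAt ℝ ∞ (fun τ ↦ F.rotation G V τ i j) s := by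
  have hα : ContDiffAt ℝ ∞ (F.derivT V) s := F.contDiffAt_fV hJ (g.isSmoothField_covDeriv hJ hV) hs
  have hβ : ContDiffAt ℝ ∞ (F.phiV V) s := F.contDiffAt_hV hJ (g.isSmoothField_covDeriv hJ hV) hs
  have hδ : ContDiffAt ℝ ∞ (F.psiV V) s := F.contDiffAt_lV hJ (g.isSmoothField_covDeriv hJ hV) hs
  have hk₁ : ContDiffAt ℝ ∞ F.k₁ s := F.smooth_k₁.contDiffAt (hJ.mem_nhds hs)
  have hk₂ : ContDiffAt ℝ ∞ F.k₂ s := F.smooth_k₂.contDiffAt (hJ.mem_nhds hs)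
  have hg := F.contDiffAt_gV hJ hV hs
  have ho : ContDiffAt ℝ ∞ (fun s ↦ (deriv (F.derivT V) s - F.k₁ s * F.phiV V s +
      F.k₂ s * F.psiV V s + G * F.gV V s) / a) s :=
    ((((contDiffAt_deriv hα).sub (hk₁.mul hβ)).add (hk₂.mul hδ)).add
      (contDiffAt_const.mul hg)).div_const a
  have hp : ContDiffAt ℝ ∞ (fun s ↦ deriv (F.psiV V) s / a) s := (contDiffAt_deriv hδ).div_const a
  have h0 : ContDiffAt ℝ ∞ (fun _ : ℝ ↦ (0 : ℝ)) s := contDiffAt_const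
  have hmul : ∀ (c : ℝ) {f : ℝ → ℝ}, ContDiffAt ℝ ∞ f s → ContDiffAt ℝ ∞ (fun s ↦ c * f s) s :=
    fun c f hf ↦ contDiffAt_const.mul hf
  fin_cases i <;> fin_cases j
  exacts [hα, hβ, h0, hδ, ho, h0, hmul ε₁ hβ, hp, h0, hmul ε₁ ho, hα.neg, h0, h0,
    (hmul (ε₁ * ε₂) hp).neg, hmul ε₂ hδ, h0]

lemma contDiffAt_cartanMatrix (hJ : IsOpen J) (hs : s ∈ J) (i j : Fin 4) :
    ContDiffAt ℝ ∞ (fun τ ↦ cartanMatrix a ε₁ ε₂ (F.k₁ τ) (F.k₂ τ) i j) s := by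
  have hk₁ : ContDiffAt ℝ ∞ F.k₁ s := F.smooth_k₁.contDiffAt (hJ.mem_nhds hs)
  have hk₂ : ContDiffAt ℝ ∞ F.k₂ s := F.smooth_k₂.contDiffAt (hJ.mem_nhds hs)
  have hc : ∀ c : ℝ, ContDiffAt ℝ ∞ (fun _ : ℝ ↦ c) s := fun c ↦ contDiffAt_const
  have hmul : ∀ (c : ℝ) {f : ℝ → ℝ}, ContDiffAt ℝ ∞ f s → ContDiffAt ℝ ∞ (fun s ↦ c * f s) s :=
    fun c f hf ↦ contDiffAt_const.mul hf
  fin_cases i <;> fin_cases j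
  exacts [hc 0, hc a, hc 0, hc 0, hk₁.neg, hc 0, hc (a * ε₁), hc 0, hc 0, (hmul ε₁ hk₁).neg, hc 0,
    hmul ε₂ hk₂, hk₂, hc 0, hc 0, hc 0]

lemma contDiffAt_cartanVariation (hJ : IsOpen J) (hV : IsSmoothField J γ V) (hs : s ∈ J) (G : ℝ)
    (i j : Fin 4) : ContDiffAt ℝ ∞ (fun τ ↦ F.cartanVariation G V τ i j) s := by
  have hΩ := F.contDiffAt_rotation hJ hV hs G
  have hK := F.contDiffAt_cartanMatrix hJ hs
  have hv := F.contDiffAt_comp hJ hV hs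
  simp only [cartanVariation, curvatureMatrix, Matrix.add_apply, Matrix.sub_apply,
    Matrix.mul_apply, Matrix.of_apply]
  refine ((contDiffAt_deriv (hΩ i j)).add ((ContDiffAt.sum fun k _ ↦ (hΩ i k).mul (hK k j)).sub
    (ContDiffAt.sum fun k _ ↦ (hK i k).mul (hΩ k j)))).add (contDiffAt_const.mul
      ((contDiffAt_const.mul (hv j)).sub ?_))
  split_ifs
  · exact ContDiffAt.sum fun k _ ↦ (hv k).mul contDiffAt_const
  · exact contDiffAt_const

/-- This is the integrability condition demanded by `covD_covD_defect`; it holds because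
`cartanVariation` is defined by solving it for L. -/
lemma hasDerivAt_rotation (hJ : IsOpen J) (hV : IsSmoothField J γ V) (hs : s ∈ J) (G : ℝ)
    (i j : Fin 4) : HasDerivAt (fun τ ↦ F.rotation G V τ i j) (F.cartanVariation G V s i j -
      ∑ k, F.rotation G V s i k * cartanMatrix a ε₁ ε₂ (F.k₁ s) (F.k₂ s) k j +
      ∑ k, cartanMatrix a ε₁ ε₂ (F.k₁ s) (F.k₂ s) i k * F.rotation G V s k j -
      G * (cartanGram ε₁ ε₂ 0 i * F.comp V j s -
        if j = 0 then ∑ k, F.comp V k s * cartanGram ε₁ ε₂ k i else 0)) s := by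
  refine ((F.contDiffAt_rotation hJ hV hs G i j).differentiableAt
    (by simp)).hasDerivAt.congr_deriv ?_
  simp only [cartanVariation, curvatureMatrix, Matrix.add_apply, Matrix.sub_apply,
    Matrix.mul_apply, Matrix.of_apply]
  ring

/-- The three summands are the derivative of a skew family, a commutator of skew matrices and the
curvature matrix, each of them skew. Hence C + tL preserves the Gram matrix for all t. -/
lemma isSkewFor_cartanVariation (hε₁ : ε₁ * ε₁ = 1) (hε₂ : ε₂ * ε₂ = 1) (hJ : IsOpen J)
    (hV : IsSmoothField J γ V) (hs : s ∈ J) (G : ℝ) :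
    IsSkewFor (cartanGram ε₁ ε₂) (F.cartanVariation G V s) := by
  refine (IsSkewFor.add ?_ (IsSkewFor.commutator (isSkewFor_rotationMatrix hε₁ hε₂ _ _ _ _ _)
    (isSkewFor_cartanMatrix hε₁ hε₂ _ _))).add (isSkewFor_curvatureMatrix G _)
  exact IsSkewFor.deriv (A := F.rotation G V)
    (fun τ ↦ isSkewFor_rotationMatrix hε₁ hε₂ _ _ _ _ _) fun i j ↦
    ((F.contDiffAt_rotation hJ hV hs G i j).differentiableAt (by simp)).hasDerivAt

variable {F}

/-- The first row of the rotation consists of the components of ∇_T V. Its N-entry is set to 0 in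
`rotationMatrix`, which is correct because ⟨∇_T V, T⟩ = 0. -/
lemma IsAdmissible.hasDerivAt_comp (h : F.IsAdmissible V) (hε₁ : ε₁ * ε₁ = 1)
    (hJ : IsOpen J) (hV : IsSmoothField J γ V) (hs : s ∈ J) (G : ℝ) (j : Fin 4) :
    HasDerivAt (F.comp V j) (F.rotation G V s 0 j - ∑ k, F.comp V k s *
      cartanMatrix a ε₁ ε₂ (F.k₁ s) (F.k₂ s) k j) s := by
  fin_cases j
  · refine (F.hasDerivAt_fV hJ hV hs).congr_deriv ?_
    simp [rotation, rotationMatrix, cartanMatrix, comp, Fin.sum_univ_four, derivT]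
    ring
  · refine (F.hasDerivAt_hV hJ hε₁ hV hs).congr_deriv ?_
    simp [rotation, rotationMatrix, cartanMatrix, comp, Fin.sum_univ_four]
    ring
  · refine (F.hasDerivAt_gV hJ hε₁ hV hs).congr_deriv ?_
    rw [(h s hs).1]
    simp [rotation, rotationMatrix, cartanMatrix, comp, Fin.sum_univ_four]
    ring
  · refine (F.hasDerivAt_lV hJ hV hs).congr_deriv ?_
    simp [rotation, rotationMatrix, cartanMatrix, comp, Fin.sum_univ_four]
    ring

/-- The first Cartan equation must not change. Entries 0 and 3 vanish because they define the two
free entries of `rotation` (hence the divisions by `a`), and entry 2 by the skew shape of the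
rotation. Entry 1 is φ' − a⟨∇_T V, N⟩, which vanishes by admissibility. -/
lemma IsAdmissible.cartanVariation_zero (h : F.IsAdmissible V) (ha : 0 < a) (hε₁ : ε₁ * ε₁ = 1)
    (hJ : IsOpen J) (hV : IsSmoothField J γ V) (hs : s ∈ J) (G : ℝ) (j : Fin 4) :
    F.cartanVariation G V s 0 j = 0 := by
  have ha' := ha.ne'
  have hφ := (F.hasDerivAt_phiV hJ hε₁ hV hs).deriv
  rw [(h s hs).1, (h s hs).2] at hφ
  have hexp : ∀ j, F.cartanVariation G V s 0 j = deriv (fun τ ↦ F.rotation G V τ 0 j) s +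
      (∑ k, F.rotation G V s 0 k * cartanMatrix a ε₁ ε₂ (F.k₁ s) (F.k₂ s) k j -
        ∑ k, cartanMatrix a ε₁ ε₂ (F.k₁ s) (F.k₂ s) 0 k * F.rotation G V s k j) +
      G * (cartanGram ε₁ ε₂ 0 0 * F.comp V j s -
        if j = 0 then ∑ k, F.comp V k s * cartanGram ε₁ ε₂ k 0 else 0) := by
    intro j
    simp only [cartanVariation, curvatureMatrix, Matrix.add_apply, Matrix.sub_apply,
      Matrix.mul_apply, Matrix.of_apply]
  have d0 : deriv (fun τ ↦ F.rotation G V τ 0 0) s = deriv (F.derivT V) s := rfl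
  have d1 : deriv (fun τ ↦ F.rotation G V τ 0 1) s = deriv (F.phiV V) s := rfl
  have d2 : deriv (fun τ ↦ F.rotation G V τ 0 2) s = 0 := deriv_const s 0
  have d3 : deriv (fun τ ↦ F.rotation G V τ 0 3) s = deriv (F.psiV V) s := rfl
  have e0 : F.cartanVariation G V s 0 0 = 0 := by
    rw [hexp, d0]
    simp [rotation, rotationMatrix, cartanMatrix, comp, cartanGram, Fin.sum_univ_four]
    field_simp
    ring
  have e1 : F.cartanVariation G V s 0 1 = 0 := by
    rw [hexp, d1, hφ]
    simp [rotation, rotationMatrix, cartanMatrix, comp, cartanGram, Fin.sum_univ_four, derivT]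
    ring
  have e2 : F.cartanVariation G V s 0 2 = 0 := by
    rw [hexp, d2]
    simp [rotation, rotationMatrix, cartanMatrix, comp, cartanGram, Fin.sum_univ_four]
    ring
  have e3 : F.cartanVariation G V s 0 3 = 0 := by
    rw [hexp, d3]
    simp [rotation, rotationMatrix, cartanMatrix, comp, cartanGram, Fin.sum_univ_four]
    field_simp
    ring
  fin_cases j <;> assumption

end CartanFrame

end SemiRiemannianMetric

/-! ### From admissible fields to variations inside Λ, and back -/

namespace SemiRiemannianMetric

variable {M : Type*} [TopologicalSpace M] [ChartedSpace E4 M] [IsManifold 𝓘(ℝ, E4) ∞ M]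
  {q : ℕ} {g : SemiRiemannianMetric M q}

lemma pseudoSpeed_eq_one {a ε : ℝ} (ha : 0 < a) (hε : ε * ε = 1) {γ : ℝ → M} {s : ℝ}
    (h : g.accelSq γ s = a ^ 2 * ε) : g.pseudoSpeed a γ s = 1 := by
  have h1 : |ε| = 1 := by
    rcases mul_self_eq_one_iff.1 hε with rfl | rfl <;> simp
  have h2 : (a ^ 2) ^ (1 / 4 : ℝ) = Real.sqrt a := by
    rw [Real.sqrt_eq_rpow, ← Real.rpow_natCast, ← Real.rpow_mul ha.le]
    norm_num
  rw [pseudoSpeed, h, abs_mul, h1, mul_one, abs_of_pos (by positivity), h2]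
  exact one_div_mul_cancel (Real.sqrt_pos.2 ha).ne'

/-- Families of frames with the Gram matrix of a Cartan frame and the first Cartan equation consist
of frames of null curves which are parametrized by the pseudo arc-length. -/
lemma isPseudoArcNullCurve_of_frames {a ε₁ ε₂ : ℝ} (ha : 0 < a) (hε₁ : ε₁ * ε₁ = 1) {I : Set ℝ}
    (hI : IsOpen I) {X : ℝ → FrameM M} {K : ℝ → Matrix (Fin 4) (Fin 4) ℝ}
    (hX : ∀ s ∈ I, IsSmoothFrameAt X s) (hsol : ∀ s ∈ I, g.IsFrameSol (Pi.single 0 1) (K s) X s)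
    (hK : ∀ s ∈ I, K s 0 = ![0, a, 0, 0])
    (hη : ∀ s ∈ I, ∀ i j, g.inner (X s).1 ((X s).2 i) ((X s).2 j) = cartanGram ε₁ ε₂ i j) :
    g.IsPseudoArcNullCurve a I (fun s ↦ (X s).1) := by
  have hv : ∀ s ∈ I, velocity (fun s ↦ (X s).1) s = (X s).2 0 := by
    intro s hs
    rw [(hsol s hs).velocity_eq ((hX s hs).contMDiffAt.mdifferentiableAt (by simp))]
    simp [Pi.single_apply]
  refine ⟨fun s hs ↦ (hX s hs).contMDiffAt.contMDiffWithinAt, fun s hs ↦ ?_, fun s hs ↦ ?_⟩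
  · rw [hv s hs]
    exact (hη s hs 0 0).trans rfl
  · refine pseudoSpeed_eq_one ha hε₁ ?_
    rw [accelSq, covDeriv_congr (X' := fun s ↦ (X s).2 0) ((hI.eventually_mem hs).mono hv),
      (hsol s hs).covDeriv_eq 0, hK s hs]
    have h11 : g.inner (X s).1 ((X s).2 1) ((X s).2 1) = ε₁ := (hη s hs 1 1).trans rfl
    simp [Fin.sum_univ_four, h11]
    ring

namespace CartanFrame

variable {a ε₁ ε₂ : ℝ} {J : Set ℝ} {γ : ℝ → M} {F : g.CartanFrame a ε₁ ε₂ J γ}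
  {V : ∀ s, Tan M (γ s)}

/-- Admissible vector fields are variation fields. -/
theorem IsAdmissible.isTangentToLambda [T2Space M] (h : F.IsAdmissible V) {G : ℝ}
    (hG : g.IsSpaceForm G) (ha : 0 < a) (hε₁ : ε₁ * ε₁ = 1) (hε₂ : ε₂ * ε₂ = 1)
    (hJ : IsOpen J) (hJ' : J.OrdConnected) (hJne : J.Nonempty) (hV : IsSmoothField J γ V) :
    g.IsTangentToLambda a J γ V := by
  obtain ⟨s₀, hs₀⟩ := hJne
  set C : ℝ → Matrix (Fin 4) (Fin 4) ℝ := fun s ↦ cartanMatrix a ε₁ ε₂ (F.k₁ s) (F.k₂ s) with hC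
  set L := F.cartanVariation G V with hL
  set η := cartanGram ε₁ ε₂ with hη
  -- A deformation affine in t suffices: skewness and the prescribed first row are linear
  -- conditions, so they hold for all t and not just to first order.
  set K : ℝ × ℝ → Matrix (Fin 4) (Fin 4) ℝ := fun p ↦ C p.1 + p.2 • L p.1 with hK
  have hK0 : ∀ s, K (s, 0) = C s := fun s ↦ by simp [hK]
  have hKs : ∀ s ∈ J, ∀ t i j, ContDiffAt ℝ ∞ (fun p ↦ K p i j) (s, t) := by
    intro s hs t i j
    have h1 : ContDiffAt ℝ ∞ (fun p : ℝ × ℝ ↦ C p.1 i j) (s, t) :=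
      ContDiffAt.comp (s, t) (g := fun τ ↦ C τ i j) (f := Prod.fst)
        (F.contDiffAt_cartanMatrix hJ hs i j) contDiffAt_fst
    have h2 : ContDiffAt ℝ ∞ (fun p : ℝ × ℝ ↦ L p.1 i j) (s, t) :=
      ContDiffAt.comp (s, t) (g := fun τ ↦ L τ i j) (f := Prod.fst)
        (F.contDiffAt_cartanVariation hJ hV hs G i j) contDiffAt_fst
    exact h1.add (contDiffAt_snd.mul h2)
  have hKskew : ∀ s ∈ J, ∀ t, IsSkewFor η (K (s, t)) := fun s hs t ↦
    (isSkewFor_cartanMatrix hε₁ hε₂ _ _).add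
      ((F.isSkewFor_cartanVariation hε₁ hε₂ hJ hV hs G).smul t)
  have hKL : ∀ s ∈ J, ∀ i j, fderiv ℝ (fun p ↦ K p i j) (s, 0) (0, 1) = L s i j := by
    intro s hs i j
    have h1 := hasDerivAt_slice_right ((hKs s hs 0 i j).differentiableAt (by simp))
    refine h1.unique ?_
    have h2 := ((hasDerivAt_id (0 : ℝ)).mul_const (L s i j)).const_add (C s i j)
    rw [one_mul] at h2
    exact h2
  have hKrow : ∀ s ∈ J, ∀ t, K (s, t) 0 = ![0, a, 0, 0] := by
    intro s hs t
    funext j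
    have h1 : K (s, t) 0 j = C s 0 j + t * L s 0 j := rfl
    rw [h1, hL, h.cartanVariation_zero ha hε₁ hJ hV hs G, mul_zero, add_zero]
    fin_cases j <;> rfl
  have hX : ∀ s ∈ J, g.IsFrameSol (Pi.single 0 1) (K (s, 0)) F.frame s := fun s hs ↦ by
    rw [hK0]
    exact F.isFrameSol hJ hs
  -- The transverse curve of frames at `s₀` has initial velocity V(s₀) and rotates by Ω(s₀). Its
  -- skew coefficient matrix keeps the Gram matrix constant, and it makes the defects vanish at
  -- `s₀`.
  obtain ⟨ε, hε, X₀, hX₀, hsol₀⟩ := exists_isFrameSol g (fun j ↦ F.comp V j s₀)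
    (F.rotation G V s₀) (F.frame s₀)
  have hm0 : (0 : ℝ) ∈ Set.Ioo (-ε) ε := ⟨by linarith, hε⟩
  have hη₀ : ∀ t ∈ Set.Ioo (-ε) ε, ∀ i j,
      g.inner (X₀ t).1 ((X₀ t).2 i) ((X₀ t).2 j) = η i j := by
    intro t ht i j
    have h1 : g.IsFrameSolThrough (fun j ↦ F.comp V j s₀) (fun _ ↦ F.rotation G V s₀)
        Set.univ 0 (F.frame s₀) 0 (Set.Ioo (-ε) ε) X₀ :=
      ⟨isOpen_Ioo, Set.ordConnected_Ioo, Set.subset_univ _, hm0, hX₀, fun s hs ↦ (hsol₀ s hs).1⟩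
    exact h1.inner_eq (fun _ _ _ _ _ ↦ contDiffAt_const)
      (fun _ _ ↦ isSkewFor_rotationMatrix hε₁ hε₂ _ _ _ _ _) (fun i j ↦ F.inner_vec hs₀ i j) ht i j
  obtain ⟨U, Z, hU, hJU, hZ0, hZs₀, hZ⟩ := exists_frame_family hJ hJ' hKs hX hs₀ hX₀
    ((isOpen_Ioo.eventually_mem hm0).mono fun t ht ↦ (hsol₀ t ht).2)
  have hZsol : ∀ p ∈ U, g.IsFrameSol (Pi.single 0 1) (K p) (fun s ↦ Z (s, p.2)) p.1 := by
    intro p hp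
    obtain ⟨-, I, hI, -, -, -, -, -, h6⟩ := hZ p hp
    exact h6 p.1 hI
  have hZη : ∀ p ∈ U, p.2 ∈ Set.Ioo (-ε) ε → p.1 ∈ J ∧ ∀ i j,
      g.inner (Z p).1 ((Z p).2 i) ((Z p).2 j) = η i j := by
    intro p hp ht
    obtain ⟨-, I, hI, hthr⟩ := hZ p hp
    exact ⟨hthr.2.2.1 hI, fun i j ↦ hthr.inner_eq hKs (fun s hs ↦ hKskew s hs p.2)
      (hη₀ p.2 ht) hI i j⟩
  have hsingle : ∀ s ∈ J, Z (s, 0) = F.frame s := hZ0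
  have hvel : ∀ s ∈ J, velocity (fun t ↦ (Z (s, t)).1) 0 =
      ∑ k, F.comp V k s • (Z (s, 0)).2 k := by
    intro s hs
    refine velocity_frame_family hG hJ hJ' (K := K) (L := L) (Ω := F.rotation G V) (η := η)
      (v := F.comp V) (fun s hs ↦ ?_) (fun s hs ↦ hKs s hs 0) hKL
      (fun s hs ↦ (hZη _ (hJU s hs) hm0).2) ?_ ?_ ?_ hs₀ ?_ hs
    · filter_upwards [hU.mem_nhds (hJU s hs)] with p hp
      exact ⟨(hZ p hp).1, hZsol p hp⟩
    · intro s hs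
      have : ∀ X : FrameM M, X = F.frame s →
          ∀ w, (∀ j, g.inner X.1 w (X.2 j) = 0) → w = 0 := by
        rintro X rfl w hw
        exact F.eq_zero_of_inner hε₁ hε₂ hs hw
      exact this _ (hZ0 s hs)
    · intro s hs j
      rw [hK0]
      exact h.hasDerivAt_comp hε₁ hJ hV hs G j
    · intro s hs i j
      rw [hK0]
      exact F.hasDerivAt_rotation hJ hV hs G i j
    · exact (hsol₀ 0 hm0).1.congr hZs₀
  -- The restriction |t| < ε keeps the initial frames on the transverse curve, where the Gram matrix
  -- is known; for other t the slice is empty and the condition is vacuous.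
  refine ⟨U ∩ {p | p.2 ∈ Set.Ioo (-ε) ε}, fun p ↦ (Z p).1, ⟨?_, ?_, ?_, ?_, ?_⟩, fun t ↦ ?_⟩
  · exact hU.inter (isOpen_Ioo.preimage continuous_snd)
  · exact fun s hs ↦ ⟨hJU s hs, hm0⟩
  · exact fun p hp ↦ ((hZ p hp.1).1.contMDiffAt).contMDiffWithinAt
  · exact fun s hs ↦ congrArg Sigma.fst (hZ0 s hs)
  · intro s hs
    have : ∀ X : FrameM M, X = F.frame s → ∀ w, w = ∑ k, F.comp V k s • X.2 k →
        (⟨X.1, w⟩ : TangentBundle 𝓘(ℝ, E4) M) = ⟨γ s, V s⟩ := by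
      rintro X rfl w rfl
      rw [F.eq_sum_comp hε₁ hε₂ hs V]
      rfl
    exact this _ (hZ0 s hs) _ (hvel s hs)
  · exact isPseudoArcNullCurve_of_frames (X := fun s ↦ Z (s, t)) (K := fun s ↦ K (s, t))
      ha hε₁ (isOpen_slice (hU.inter (isOpen_Ioo.preimage continuous_snd)) t)
      (fun s hs ↦ (hZ _ hs.1).1.slice_left) (fun s hs ↦ hZsol _ hs.1)
      (fun s hs ↦ hKrow s (hZη _ hs.1 hs.2).1 t) (fun s hs ↦ (hZη _ hs.1 hs.2).2)

/-- Variation fields of variations through null curves which preserve the pseudo arc-length to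
first order are admissible. -/
theorem isAdmissible_of_preservesPseudoArc (F : g.CartanFrame a ε₁ ε₂ J γ) {G : ℝ}
    (hG : g.IsSpaceForm G) (ha : 0 < a) (hε₁ : ε₁ * ε₁ = 1) (hJ : IsOpen J)
    (h : g.PreservesPseudoArc a J γ V) : F.IsAdmissible V := by
  obtain ⟨U, Γ, hΓ, hnull, hη⟩ := h
  have ha' := ha.ne'
  have hε : ε₁ ≠ 0 := left_ne_zero_of_mul_eq_one hε₁
  intro s hs
  refine ⟨hΓ.inner_covDeriv_velocity hJ hnull hs, ?_⟩
  -- Since ∇_T T = aW₁ with a ≠ 0, orthogonality to ∇_T T is orthogonality to W₁; also ⟨∇_T T, ∇_T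
  -- T⟩ = a²ε₁ ≠ 0.
  have h1 := hΓ.inner_covDeriv_covDeriv hJ hG ha hs (hη s hs) (F.T_T s hs) ?_ ?_
  · rw [F.cartan_T s hs, map_smul, smul_eq_mul, mul_eq_zero] at h1
    exact h1.resolve_left ha'
  · rw [F.cartan_T s hs, map_smul, g.symm, F.W₁_T s hs, smul_zero]
  · rw [F.cartan_T s hs]
    simp [F.W₁_W₁ s hs, ha', hε]

end CartanFrame

lemma IsTangentToLambda.preservesPseudoArc {a : ℝ} {J : Set ℝ} {γ : ℝ → M}
    {V : ∀ s, Tan M (γ s)} (h : g.IsTangentToLambda a J γ V) : g.PreservesPseudoArc a J γ V := by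
  obtain ⟨U, Γ, hΓ, hΛ⟩ := h
  refine ⟨U, Γ, hΓ, fun t ↦ (hΛ t).null, fun s hs ↦ ?_⟩
  refine (hasDerivAt_const (0 : ℝ) (1 : ℝ)).congr_of_eventuallyEq ?_
  filter_upwards [(tendsto_slice_right s 0).eventually
    (hΓ.isOpen.eventually_mem (hΓ.mem s hs))] with t ht
  exact (hΛ t).pseudoArc s ht

end SemiRiemannianMetric

end NullCurve

end

/-! ### The main theorem -/

open NullCurve in
theorem proposition1 {M : Type*} [TopologicalSpace M] [T2Space M] [ChartedSpace E4 M]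
    [IsManifold 𝓘(ℝ, E4) ∞ M] (q : ℕ) (hq : q = 1 ∨ q = 2)
    (g : SemiRiemannianMetric M q) (G : ℝ) (hG : g.IsSpaceForm G)
    (a : ℝ) (ha : 0 < a) (ε₁ ε₂ : ℝ) (hε₁ : ε₁ = 1 ∨ ε₁ = -1) (hε₂ : ε₂ = 1 ∨ ε₂ = -1)
    (J : Set ℝ) (hJ : IsOpen J) (hJ' : J.OrdConnected) (hJne : J.Nonempty)
    (γ : ℝ → M) (hγ : g.IsPseudoArcNullCurve a J γ) (F : g.CartanFrame a ε₁ ε₂ J γ)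
    (V : ∀ s, Tan M (γ s)) (hV : IsSmoothField J γ V) :
    -- the tangent space of `Λ` at `γ`
    (g.IsTangentToLambda a J γ V ↔
      g.PreservesCausalCharacter J γ V ∧ g.PreservesPseudoArc a J γ V) ∧
    (g.IsTangentToLambda a J γ V ↔
      ∀ s ∈ J, g.inner (γ s) (g.covDeriv γ V s) (velocity γ s) = 0 ∧
        g.inner (γ s) (g.covDeriv γ (g.covDeriv γ V) s) (F.W₁ s) = 0) ∧
    -- the expression of `V` in the Cartan frame, with smooth components
    (ContDiffOn ℝ ∞ (F.fV V) J ∧ ContDiffOn ℝ ∞ (F.hV V) J ∧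
      ContDiffOn ℝ ∞ (F.gV V) J ∧ ContDiffOn ℝ ∞ (F.lV V) J ∧
      ∀ s ∈ J, V s = F.fV V s • velocity γ s + F.hV V s • F.W₁ s + F.gV V s • F.N s
        + F.lV V s • F.W₂ s) ∧
    -- the formulas for the `T`- and `N`-components
    (g.IsTangentToLambda a J γ V ↔ ∃ p r : ℝ → ℝ, F.Compatibility V p r) ∧
    -- the symplectic operator; `p`, `u`, `w` stand for the indefinite integrals
    -- of `h_V`, `k₁ h_V`, `k₂ l_V`, where `u - w` is the integral of `k₁ h_V - k₂ l_V`
    (g.IsTangentToLambda a J γ V →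
      (∃ p u w : ℝ → ℝ, IsAntiderivOn J u (fun s ↦ F.k₁ s * F.hV V s) ∧
        IsAntiderivOn J w (fun s ↦ F.k₂ s * F.lV V s) ∧
        F.Compatibility V p (fun s ↦ u s - w s)) ∧
      ∀ p u w : ℝ → ℝ, IsAntiderivOn J u (fun s ↦ F.k₁ s * F.hV V s) →
        IsAntiderivOn J w (fun s ↦ F.k₂ s * F.lV V s) →
        F.Compatibility V p (fun s ↦ u s - w s) →
        ∀ s ∈ J,
          F.phiV V s = (a / 2) * ((1 / a) * deriv (F.hV V) s + F.k₁ s * p s + u s)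
            + (-(a / 2)) * w s ∧
          F.psiV V s = -(ε₁ * ε₂ * a) * F.k₂ s * p s + deriv (F.lV V) s) := by
  have hε₁' : ε₁ * ε₁ = 1 := by rcases hε₁ with rfl | rfl <;> norm_num
  have hε₂' : ε₂ * ε₂ = 1 := by rcases hε₂ with rfl | rfl <;> norm_num
  have hto : g.IsTangentToLambda a J γ V → F.IsAdmissible V := fun h ↦
    F.isAdmissible_of_preservesPseudoArc hG ha hε₁' hJ h.preservesPseudoArc
  have hof : F.IsAdmissible V → g.IsTangentToLambda a J γ V := fun h ↦
    h.isTangentToLambda hG ha hε₁' hε₂' hJ hJ' hJne hV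
  refine ⟨⟨fun h ↦ ⟨fun s hs ↦ (hto h s hs).1, h.preservesPseudoArc⟩, fun h ↦
    hof (F.isAdmissible_of_preservesPseudoArc hG ha hε₁' hJ h.2)⟩, ⟨hto, hof⟩,
    ⟨fun s hs ↦ (F.contDiffAt_fV hJ hV hs).contDiffWithinAt,
      fun s hs ↦ (F.contDiffAt_hV hJ hV hs).contDiffWithinAt,
      fun s hs ↦ (F.contDiffAt_gV hJ hV hs).contDiffWithinAt,
      fun s hs ↦ (F.contDiffAt_lV hJ hV hs).contDiffWithinAt,
      fun s hs ↦ F.eq_sum hε₁' hε₂' hs (V s)⟩,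
    ⟨fun h ↦ ⟨_, _, (hto h).exists_compatibility ha hJ hε₁' hV⟩, fun ⟨p, r, h⟩ ↦
      hof (h.isAdmissible ha hJ hε₁' hV)⟩, fun h ↦ ⟨?_, fun p u w hu hw hc s hs ↦ ⟨?_, ?_⟩⟩⟩
  · have hc := (hto h).exists_compatibility ha hJ hε₁' hV
    obtain ⟨w, hw⟩ := exists_isAntiderivOn hJ hJ' hJne
      (f := fun s ↦ F.k₂ s * F.lV V s) (F.smooth_k₂.continuousOn.mul fun s hs ↦
        (F.contDiffAt_lV hJ hV hs).continuousAt.continuousWithinAt)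
    -- Any antiderivative `w` of k₂l will do: adding it to the r of `exists_compatibility` gives an
    -- antiderivative u of k₁h with u − w = r.
    refine ⟨fun s ↦ -ε₁ / a * F.gV V s, fun s ↦ F.fV V s + F.phiV V s / a + w s, w, fun s hs ↦ ?_, hw, ?_⟩
    · refine ((hc.2.1 s hs).add (hw s hs)).congr_deriv ?_
      ring
    · simpa only [add_sub_cancel_right] using hc
  · rw [SemiRiemannianMetric.CartanFrame.phiV_eq ha hJ hε₁' hV hc hs]
    ring
  · exact SemiRiemannianMetric.CartanFrame.psiV_eq hJ hV hc hs
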